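/- **Setting.** Let $(B,g_B)$ and $(F_i,g_{F_i})$, $1\le i\le m$, be smooth finite-dimensional semi-Riemannian (in particular, Riemannian) manifolds, and let $b_i:B\times F_i\to(0,\infty)$ be smooth. Let $M=B\times_{b_1}F_1\times_{b_2}F_2\cdots\times_{b_m}F_m$ be the multiply twisted product, that is, the manifold $B\times F_1\times\cdots\times F_m$ with the metric $g=g_B\oplus b_1^2g_{F_1}\oplus\cdots\oplus b_m^2g_{F_m}$. Put $\overline n=\dim M$, $n=\dim B$, $l_i=\dim F_i$. Vector fields in $\Gamma(TB)$ and $\Gamma(TF_i)$ are smooth vector fields on $B$ and on $F_i$, identified with their lifts to $M$. Fix $r$, $P\in\Gamma(TF_r)$ and constants $\lambda_1,\lambda_2\in\mathbb R$; let $\pi(X)=g(X,P)$, let $\nabla$ be the Levi-Civita connection of $g$, and let $$\overline\nabla_XY=\nabla_XY+\lambda_1\pi(Y)X-\lambda_2g(X,Y)P .$$ **Conventions.** For a connection $D$ on a semi-Riemannian manifold, $R(X,Y)=D_XD_Y-D_YD_X-D_{[X,Y]}$ and $\mathrm{Ric}(X,Y)=\sum_k\varepsilon_k\langle R(X,E_k)Y,E_k\rangle$,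 where $E_k$ is an orthonormal frame with $\langle E_k,E_k\rangle=\varepsilon_k=\pm1$. $\overline{\mathrm{Ric}}$ is the Ricci tensor of $(M,g,\overline\nabla)$. $\mathrm{Ric}^B$ is the Ricci tensor of the Levi-Civita connection $\nabla^B$ of $(B,g_B)$ (this is also the Ricci tensor of the connection induced on $B$ by the formula for $\overline\nabla$, since $P$ has no component tangent to $B$). $\mathrm{Ric}^{F_i}$ is the Ricci tensor of the Levi-Civita connection of the fibre through the point considered, with the metric induced by $g$; that is, at a point over $p\in B$, it is the Ricci tensor of $(F_i,\,b_i(p,\cdot)^2g_{F_i})$. (It equals the Ricci tensor of $(F_i,g_{F_i})$ if $b_i$ depends only on $B$.) $\mathrm{grad}_Bb_i$, $H^{b_i}_B(X,Y)=XYb_i-(\nabla^B_XY)b_i$ and $\Delta_Bb_i=\sum_k\varepsilon_kH_B^{b_i}(E_k,E_k)$ ($E_k$ an orthonormal frame of $B$) are taken on $(B,g_B)$ with the point of $F_i$ fixed, and $|\mathrm{grad}_Bb_i|_B^2=g_B(\mathrm{grad}_Bb_i,\mathrm{grad}_Bb_i)$. Finally $\mathrm{div}_{F_r}P=\sum_{k=1}^{l_r}\varepsilon_kg(\nabla_{E_k}P,E_k)$,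 where $E_1,\dots,E_{l_r}$ are tangent to $F_r$ and orthonormal for $g$, $\varepsilon_k=g(E_k,E_k)$. **Proposition 4.7.** Let $X,Y\in\Gamma(TB)$, $V\in\Gamma(TF_i)$, $W\in\Gamma(TF_j)$. Then, at every point of $M$: 1. $\displaystyle\overline{\mathrm{Ric}}(X,Y)=\mathrm{Ric}^B(X,Y)+\sum_{s=1}^ml_s\frac{H_B^{b_s}(X,Y)}{b_s}+[(\overline n-1)\lambda_1\lambda_2-\lambda_2^2]\,\pi(P)\,g(X,Y)+\lambda_2\,g(X,Y)\,\mathrm{div}_{F_r}P$; 2. $\displaystyle\overline{\mathrm{Ric}}(X,V)=(l_i-1)\,VX(\ln b_i)+[(\overline n-1)\lambda_1-\lambda_2]\,\pi(V)\frac{Xb_r}{b_r}$; 3. $\displaystyle\overline{\mathrm{Ric}}(V,X)=(l_i-1)\,VX(\ln b_i)+[\lambda_2-(\overline n-1)\lambda_1]\,\pi(V)\frac{Xb_r}{b_r}$; 4. if $i\ne j$, then $\overline{\mathrm{Ric}}(V,W)=0$; if $i=j$, then $$\begin{aligned}\overline{\mathrm{Ric}}(V,W)={}&\mathrm{Ric}^{F_i}(V,W)+g(V,W)\Big\{\frac{\Delta_Bb_i}{b_i}+(l_i-1)\frac{|\mathrm{grad}_Bb_i|_B^2}{b_i^2}+\sum_{s\ne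 i}l_s\frac{g_B(\mathrm{grad}_Bb_i,\mathrm{grad}_Bb_s)}{b_ib_s}\\&+[(\overline n-1)\lambda_1\lambda_2-\lambda_2^2]\,\pi(P)\Big\}+[(\overline n-1)\lambda_1-\lambda_2]\,g(W,\nabla_VP)\\&+[\lambda_2^2+(1-\overline n)\lambda_1^2]\,\pi(V)\pi(W)+\lambda_2\,g(V,W)\,\mathrm{div}_{F_r}P .\end{aligned}$$ -/

import Mathlib

open scoped Manifold ContDiff Bundle
open Module

/-- A finite product of `C^n` manifolds is a `C^n` manifold (for the product atlas). -/
instance isManifold_pi {ι : Type*} [Fintype ι] {E : ι → Type*}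
    [∀ i, NormedAddCommGroup (E i)] [∀ i, NormedSpace ℝ (E i)] {H : ι → Type*}
    [∀ i, TopologicalSpace (H i)] (I : ∀ i, ModelWithCorners ℝ (E i) (H i)) (n : ℕ∞ω)
    (M : ι → Type*) [∀ i, TopologicalSpace (M i)] [∀ i, ChartedSpace (H i) (M i)]
    [∀ i, IsManifold (I i) n (M i)] :
    IsManifold (ModelWithCorners.pi I) n (∀ i, M i) := by
  apply isManifold_of_contDiffOn
  rintro _ _ ⟨f, hf, rfl⟩ ⟨f', hf', rfl⟩
  rw [contDiffOn_pi]
  intro i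
  have h := (contDiffGroupoid n (I i)).compatible (hf i trivial) (hf' i trivial)
  rw [contDiffGroupoid, mem_groupoid_of_pregroupoid] at h
  refine h.1.comp (g := (I i) ∘ ((f i).symm ≫ₕ f' i) ∘ (I i).symm)
    (contDiff_pi.mp contDiff_id i).contDiffOn ?_
  rintro x ⟨hx, y, rfl⟩
  refine ⟨?_, y i, rfl⟩
  exact ⟨hx.1 i trivial, hx.2 i trivial⟩

namespace QuarterSymmetric

section Connections

variable {E : Type*} [NormedAddCommGroup E] [NormedSpace ℝ E]
  {H : Type*} [TopologicalSpace H] (I : ModelWithCorners ℝ E H)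
  {M : Type*} [TopologicalSpace M] [ChartedSpace H M]

/-- The derivative `X f` of a function `f` along a vector field `X`. -/
noncomputable def dirDeriv (X : Π x : M, TangentSpace I x) (f : M → ℝ) : M → ℝ :=
  fun x ↦ mvfderiv I f x (X x)

/-- `g` is a semi-Riemannian metric tensor: a smooth field of nondegenerate symmetric bilinear
forms on the tangent spaces. (A Riemannian metric is the case where all forms are positive.) -/
structure IsSemiRiemannian [IsManifold I ∞ M]
    (g : Π x : M, TangentSpace I x →L[ℝ] TangentSpace I x →L[ℝ] ℝ) : Prop where
  symm : ∀ (x : M) (v w : TangentSpace I x), g x v w = g x w v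
  nondegenerate : ∀ (x : M) (v : TangentSpace I x), (∀ w, g x v w = 0) → v = 0
  smooth : ContMDiff I (I.prod 𝓘(ℝ, E →L[ℝ] E →L[ℝ] ℝ)) ∞
    (fun x ↦ Bundle.TotalSpace.mk' (E →L[ℝ] E →L[ℝ] ℝ)
      (E := fun x : M ↦ TangentSpace I x →L[ℝ] TangentSpace I x →L[ℝ] ℝ) x (g x))

/-- The gradient of `f`: the vector field with `g (grad f) v = df v` for all `v`. -/
noncomputable def gradient (g : Π x : M, TangentSpace I x →L[ℝ] TangentSpace I x →L[ℝ] ℝ)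
    (f : M → ℝ) : Π x : M, TangentSpace I x :=
  fun x ↦ (g x).inverse (mvfderiv I f x)

/-- The right-hand side of the Koszul formula. -/
noncomputable def koszul (g : Π x : M, TangentSpace I x →L[ℝ] TangentSpace I x →L[ℝ] ℝ)
    (X Y Z : Π x : M, TangentSpace I x) (x : M) : ℝ :=
  dirDeriv I X (fun y ↦ g y (Y y) (Z y)) x
    + dirDeriv I Y (fun y ↦ g y (X y) (Z y)) x
    - dirDeriv I Z (fun y ↦ g y (X y) (Y y)) x
    + g x (VectorField.mlieBracket I X Y x) (Z x)
    - g x (VectorField.mlieBracket I X Z x) (Y x)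
    - g x (VectorField.mlieBracket I Y Z x) (X x)

/-- The Levi-Civita connection of `g`: `(∇_X Y) x` is the tangent vector `w` that satisfies
`2 g(w, Z) = koszul X Y Z` at `x` for every vector field `Z` differentiable at `x`.
(For a semi-Riemannian `g` and `X`, `Y` differentiable at `x` there is exactly one such `w`.) -/
noncomputable def leviCivita [IsManifold I 1 M]
    (g : Π x : M, TangentSpace I x →L[ℝ] TangentSpace I x →L[ℝ] ℝ)
    (X Y : Π x : M, TangentSpace I x) : Π x : M, TangentSpace I x :=
  open Classical in
  fun x ↦
    if h : ∃ w : TangentSpace I x, ∀ Z : Π y : M, TangentSpace I y,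
        MDifferentiableAt I I.tangent (fun y ↦ (⟨y, Z y⟩ : TangentBundle I M)) x →
          2 * g x w (Z x) = koszul I g X Y Z x
    then h.choose else 0

/-- The connection `D_X Y = ∇_X Y + λ₁ π(Y) X - λ₂ g(X, Y) P`, where `∇` is the Levi-Civita
connection of `g` and `π(Y) = g(Y, P)`. -/
noncomputable def quarterSymmetric [IsManifold I 1 M]
    (g : Π x : M, TangentSpace I x →L[ℝ] TangentSpace I x →L[ℝ] ℝ)
    (P : Π x : M, TangentSpace I x) (lam₁ lam₂ : ℝ)
    (X Y : Π x : M, TangentSpace I x) : Π x : M, TangentSpace I x :=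
  fun x ↦ leviCivita I g X Y x + (lam₁ * g x (Y x) (P x)) • X x
    - (lam₂ * g x (X x) (Y x)) • P x

variable {I}

/-- The curvature `R(X, Y) Z = D_X D_Y Z - D_Y D_X Z - D_[X, Y] Z` of a connection `D`. -/
noncomputable def curvature
    (D : (Π x : M, TangentSpace I x) → (Π x : M, TangentSpace I x) → Π x : M, TangentSpace I x)
    (X Y Z : Π x : M, TangentSpace I x) : Π x : M, TangentSpace I x :=
  fun x ↦ D X (D Y Z) x - D Y (D X Z) x - D (VectorField.mlieBracket I X Y) Z x

/-- `e` is an orthonormal frame for `g` at the point `x`: vector fields, as many as the dimension,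
smooth at `x`, with `g(e_k, e_l) = 0` for `k ≠ l` and `g(e_k, e_k) = ±1` at `x`. -/
structure IsOrthonormalFrameAt [IsManifold I 1 M]
    (g : Π x : M, TangentSpace I x →L[ℝ] TangentSpace I x →L[ℝ] ℝ)
    (e : Fin (finrank ℝ E) → Π x : M, TangentSpace I x) (x : M) : Prop where
  smooth : ∀ k, ContMDiffAt I I.tangent ∞ (fun y ↦ (⟨y, e k y⟩ : TangentBundle I M)) x
  orthogonal : ∀ k l, k ≠ l → g x (e k x) (e l x) = 0
  unit : ∀ k, g x (e k x) (e k x) = 1 ∨ g x (e k x) (e k x) = -1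

/-- The Ricci tensor `Ric(X, Y) = ∑ₖ εₖ g(R(X, eₖ) Y, eₖ)` of a connection `D`, with
`εₖ = g(eₖ, eₖ)`, computed with the frame `e`. -/
noncomputable def ricci
    (g : Π x : M, TangentSpace I x →L[ℝ] TangentSpace I x →L[ℝ] ℝ)
    (D : (Π x : M, TangentSpace I x) → (Π x : M, TangentSpace I x) → Π x : M, TangentSpace I x)
    (e : Fin (finrank ℝ E) → Π x : M, TangentSpace I x)
    (X Y : Π x : M, TangentSpace I x) (x : M) : ℝ :=
  ∑ k, g x (e k x) (e k x) * g x (curvature D X (e k) Y x) (e k x)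

variable (I) in
/-- The Hessian `H^f(X, Y) = X Y f - (∇_X Y) f`. -/
noncomputable def hessian [IsManifold I 1 M]
    (g : Π x : M, TangentSpace I x →L[ℝ] TangentSpace I x →L[ℝ] ℝ) (f : M → ℝ)
    (X Y : Π x : M, TangentSpace I x) : M → ℝ :=
  fun x ↦ dirDeriv I X (dirDeriv I Y f) x - dirDeriv I (leviCivita I g X Y) f x

/-- The Laplacian `Δ f = ∑ₖ εₖ H^f(eₖ, eₖ)`, computed with the frame `e`. -/
noncomputable def laplacian [IsManifold I 1 M]
    (g : Π x : M, TangentSpace I x →L[ℝ] TangentSpace I x →L[ℝ] ℝ)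
    (e : Fin (finrank ℝ E) → Π x : M, TangentSpace I x) (f : M → ℝ) (x : M) : ℝ :=
  ∑ k, g x (e k x) (e k x) * hessian I g f (e k) (e k) x

end Connections

section TwistedProduct

variable {EB : Type*} [NormedAddCommGroup EB] [NormedSpace ℝ EB]
  {B : Type*} [TopologicalSpace B] [ChartedSpace EB B]
  {ι : Type*} [Fintype ι] {EF : ι → Type*}
  [∀ i, NormedAddCommGroup (EF i)] [∀ i, NormedSpace ℝ (EF i)]
  {F : ι → Type*} [∀ i, TopologicalSpace (F i)] [∀ i, ChartedSpace (EF i) (F i)]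

variable (EB EF) in
/-- The model of the product manifold `B × ∏ i, F i`; its tangent spaces are
`EB × ∏ i, EF i`. -/
noncomputable abbrev prodModel : ModelWithCorners ℝ (EB × ∀ i, EF i) (ModelProd EB (ModelPi EF)) :=
  𝓘(ℝ, EB).prod (ModelWithCorners.pi fun i ↦ 𝓘(ℝ, EF i))

/-- The metric `g_B ⊕ b₁² g_{F₁} ⊕ ⋯ ⊕ bₘ² g_{Fₘ}` on `B × ∏ i, F i`, where `b i` is a function
on `B × F i`. -/
noncomputable def twistedMetric
    (gB : Π p : B, TangentSpace 𝓘(ℝ, EB) p →L[ℝ] TangentSpace 𝓘(ℝ, EB) p →L[ℝ] ℝ)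
    (gF : ∀ i, Π y : F i, TangentSpace 𝓘(ℝ, EF i) y →L[ℝ] TangentSpace 𝓘(ℝ, EF i) y →L[ℝ] ℝ)
    (b : ∀ i, B × F i → ℝ) :
    Π q : B × (∀ i, F i), TangentSpace (prodModel EB EF) q →L[ℝ]
      TangentSpace (prodModel EB EF) q →L[ℝ] ℝ :=
  fun q ↦
    let base : EB →L[ℝ] EB →L[ℝ] ℝ := gB q.1
    let fiber : ∀ i, EF i →L[ℝ] EF i →L[ℝ] ℝ := fun i ↦ gF i (q.2 i)
    let prB : (EB × ∀ i, EF i) →L[ℝ] EB := ContinuousLinearMap.fst ℝ EB (∀ i, EF i)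
    let prF : ∀ i, (EB × ∀ i, EF i) →L[ℝ] EF i := fun i ↦
      (ContinuousLinearMap.proj i).comp (ContinuousLinearMap.snd ℝ EB (∀ i, EF i))
    (base.bilinearComp prB prB + ∑ i, (b i (q.1, q.2 i)) ^ 2 •
      (fiber i).bilinearComp (prF i) (prF i) :
        (EB × ∀ i, EF i) →L[ℝ] (EB × ∀ i, EF i) →L[ℝ] ℝ)

/-- The metric `b(p, ·)² g` that the fibre over `p` inherits from the twisted product, where `g` is
the given metric of that fibre. -/
noncomputable def fiberMetric {E : Type*} [NormedAddCommGroup E] [NormedSpace ℝ E] {N : Type*}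
    [TopologicalSpace N] [ChartedSpace E N]
    (g : Π y : N, TangentSpace 𝓘(ℝ, E) y →L[ℝ] TangentSpace 𝓘(ℝ, E) y →L[ℝ] ℝ)
    (b : B × N → ℝ) (p : B) :
    Π y : N, TangentSpace 𝓘(ℝ, E) y →L[ℝ] TangentSpace 𝓘(ℝ, E) y →L[ℝ] ℝ :=
  fun y ↦ (b (p, y)) ^ 2 • g y

variable (EF) in
/-- The lift to `B × ∏ i, F i` of a vector field on `B`. -/
noncomputable def liftB (X : Π p : B, TangentSpace 𝓘(ℝ, EB) p) :
    Π q : B × (∀ i, F i), TangentSpace (prodModel EB EF) q :=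
  fun q ↦ ((X q.1, 0) : EB × ∀ i, EF i)

variable (EB) in
/-- The lift to `B × ∏ i, F i` of a vector field on `F i`. -/
noncomputable def liftF [DecidableEq ι] (i : ι) (V : Π y : F i, TangentSpace 𝓘(ℝ, EF i) y) :
    Π q : B × (∀ i, F i), TangentSpace (prodModel EB EF) q :=
  fun q ↦ ((0, Pi.single i (V (q.2 i))) : EB × ∀ i, EF i)

/-- `X` is a smooth vector field. -/
def IsSmoothField {E : Type*} [NormedAddCommGroup E] [NormedSpace ℝ E] {M : Type*}
    [TopologicalSpace M] [ChartedSpace E M] [IsManifold 𝓘(ℝ, E) ∞ M]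
    (X : Π x : M, TangentSpace 𝓘(ℝ, E) x) : Prop :=
  ContMDiff 𝓘(ℝ, E) 𝓘(ℝ, E).tangent ∞ (fun x ↦ (⟨x, X x⟩ : TangentBundle 𝓘(ℝ, E) M))

/-- The divergence along the `r`-th fibre, `div_{F_r} P = ∑ₖ εₖ g(∇_{eₖ} P, eₖ)` with
`εₖ = g(eₖ, eₖ)`: here `g` and `∇` are a metric of the product manifold and its Levi-Civita
connection, `P` is a vector field on the product manifold, and the `eₖ` are vector fields on `F r`,
lifted to the product. -/
noncomputable def fiberDiv [DecidableEq ι] [IsManifold 𝓘(ℝ, EB) ∞ B]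
    [∀ i, IsManifold 𝓘(ℝ, EF i) ∞ (F i)]
    (g : Π q : B × (∀ i, F i), TangentSpace (prodModel EB EF) q →L[ℝ]
      TangentSpace (prodModel EB EF) q →L[ℝ] ℝ) (r : ι)
    (e : Fin (finrank ℝ (EF r)) → Π y : F r, TangentSpace 𝓘(ℝ, EF r) y)
    (P : Π q : B × (∀ i, F i), TangentSpace (prodModel EB EF) q) (q : B × (∀ i, F i)) : ℝ :=
  ∑ k, g q (liftF EB r (e k) q) (liftF EB r (e k) q) *
    g q (leviCivita (prodModel EB EF) g (liftF EB r (e k)) P q) (liftF EB r (e k) q)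

end TwistedProduct

end QuarterSymmetric

/-! The connection differs from the Levi-Civita connection `∇` by a tensor that is algebraic in `g`
and `P`. Expanding its curvature and tracing gives, with `N = dim M`, `RicBar(S,T) = Ric(S,T) +
[(N-1)λ₁ - λ₂] g(T, ∇_S P) + λ₂ g(S,T) div P + [(N-1)λ₁λ₂ - λ₂²] π(P) g(S,T) + [λ₂² + (1-N)λ₁²] π(S)
π(T)` (`flatRicci_quarterCoeff`). What remains is to find `Ric`, `∇P` and `div P` on a twisted
product.

Put `λ_i = ln b_i`. The Koszul formula shows that the base is totally geodesic, that `∇_X V = X(λ_i)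
V`, that fields on different fibres have zero covariant derivative along each other, and that each
fibre is umbilic with second fundamental form `-g(V,W) grad_B λ_i` (the `christoffel_in...` lemmas).
Inserted in `IsMetricNear.apply_curvatureTensor`, this gives every curvature component that Ricci
needs. Tracing them over frames of the base and of the fibres yields `H(b)/b`, because `D²λ + Dλ Dλ
= D²b / b`, the gradient products, by the Gauss equation, and `(l_i - 1) V X ln b_i`, which measures
how far `b_i` is from being a function on the base times a function on the fibre. In the sign
convention used here `Ric` is the negative of the usual tensor, hence the plus signs.

Since `P` is tangent to `F_r`, `∇_X P = X(ln b_r) P` for base fields, `∇_V P = 0` along the other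
fibres, and `g(X, ∇_V P) = -π(V) X(ln b_r)`. This last sign is what distinguishes the two mixed
components. The base and the other fibres contribute nothing to `div P`, which is therefore
`div_{F_r} P`.

All of this is local, so it is carried out for metrics near a point of a normed space
(`IsMetricNear`, `IsTwistedNear`) and transferred through charts (`IsMetricRep`, `IsConnectionRep`,
`ricci_eq_flatRicci`). In product charts the twisted metric satisfies `IsTwistedNear` with `λ_i = ln
b_i` (`isTwistedNear_chart`). Traces do not depend on the frame (`IsOrthonormalFamily.trace_eq`), so
an arbitrary frame of the product may be replaced by an adapted one. -/

section

set_option maxSynthPendingDepth 3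
set_option linter.unusedSectionVars false
set_option linter.unusedSimpArgs false

namespace QuarterSymmetric


/-! ### Christoffel symbols and Levi-Civita curvature in a normed space -/

section FlatConnection

open Filter Topology

variable {E : Type*} [NormedAddCommGroup E] [NormedSpace ℝ E]
  {W : Type*} [NormedAddCommGroup W] [NormedSpace ℝ W]

/-- The derivative of `u ↦ G u (f u) (h u)`. -/
lemma fderiv_bilin_apply {E' W' : Type*} [NormedAddCommGroup E'] [NormedSpace ℝ E']
    [NormedAddCommGroup W'] [NormedSpace ℝ W'] {G : E → W →L[ℝ] W' →L[ℝ] E'}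
    {f : E → W} {h : E → W'} {u : E}
    (hG : DifferentiableAt ℝ G u) (hf : DifferentiableAt ℝ f u) (hh : DifferentiableAt ℝ h u)
    (x : E) :
    fderiv ℝ (fun u' ↦ G u' (f u') (h u')) u x =
      fderiv ℝ G u x (f u) (h u) + G u (fderiv ℝ f u x) (h u) + G u (f u) (fderiv ℝ h u x) := by
  rw [((hG.hasFDerivAt.clm_apply hf.hasFDerivAt).clm_apply hh.hasFDerivAt).fderiv]
  simp
  abel

/-- A nondegenerate bilinear form on a finite-dimensional space is invertible as a map to the
dual. -/
lemma isInvertible_of_nondegenerate [FiniteDimensional ℝ E] (g : E →L[ℝ] E →L[ℝ] ℝ)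
    (hg : ∀ v, (∀ w, g v w = 0) → v = 0) : g.IsInvertible := by
  have hinj : Function.Injective g := by
    rw [injective_iff_map_eq_zero]
    intro v hv
    exact hg v fun w ↦ by simp [hv]
  have hdim : finrank ℝ E = finrank ℝ (E →L[ℝ] ℝ) := by
    rw [← (LinearMap.toContinuousLinearMap (𝕜 := ℝ) (E := E) (F' := ℝ)).finrank_eq]
    exact Subspace.dual_finrank_eq.symm
  let e := (LinearEquiv.ofInjectiveOfFinrankEq g.toLinearMap hinj hdim).toContinuousLinearEquiv
  refine ⟨e, ?_⟩
  ext v w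
  rfl

/-- The trilinear form `(v, w, z) ↦ T(v, w, z) + T(w, v, z) - T(z, v, w)`; for `T` the derivative
of a metric it is the right-hand side of the Koszul formula on constant fields. -/
noncomputable def koszulForm (T : E →L[ℝ] E →L[ℝ] E →L[ℝ] ℝ) : E →L[ℝ] E →L[ℝ] E →L[ℝ] ℝ :=
  T + T.flip -
    ((ContinuousLinearMap.flipₗᵢ ℝ E E ℝ).toContinuousLinearEquiv :
      (E →L[ℝ] E →L[ℝ] ℝ) →L[ℝ] (E →L[ℝ] E →L[ℝ] ℝ)) ∘L T.flip

lemma koszulForm_apply (T : E →L[ℝ] E →L[ℝ] E →L[ℝ] ℝ) (v w z : E) :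
    koszulForm T v w z = T v w z + T w v z - T z v w := by
  simp [koszulForm]

/-- The Christoffel symbols of the metric `G` on a normed space. -/
noncomputable def christoffel (G : E → E →L[ℝ] E →L[ℝ] ℝ) (u : E) : E →L[ℝ] E →L[ℝ] E :=
  (2⁻¹ : ℝ) • (ContinuousLinearMap.compL ℝ E (E →L[ℝ] ℝ) E (G u).inverse) ∘L
    koszulForm (fderiv ℝ G u)

/-- `G` is a semi-Riemannian metric near the point `u` of a normed space. -/
structure IsMetricNear (G : E → E →L[ℝ] E →L[ℝ] ℝ) (u : E) : Prop where
  smooth : ContDiffAt ℝ ∞ G u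
  symm : ∀ᶠ u' in 𝓝 u, ∀ v w, G u' v w = G u' w v
  nondegenerate : ∀ᶠ u' in 𝓝 u, ∀ v, (∀ w, G u' v w = 0) → v = 0

/-- Nondegeneracy is asked at the single point `u`, so that the identity can be used at every point
of a neighbourhood and then differentiated. -/
lemma christoffel_spec [FiniteDimensional ℝ E] {G : E → E →L[ℝ] E →L[ℝ] ℝ} {u : E}
    (hG : ∀ v, (∀ w, G u v w = 0) → v = 0) (v w z : E) :
    2 * G u (christoffel G u v w) z = koszulForm (fderiv ℝ G u) v w z := by
  have h := (isInvertible_of_nondegenerate (G u) hG).self_comp_inverse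
  have h' := DFunLike.congr_fun h (koszulForm (fderiv ℝ G u) v w)
  simp only [ContinuousLinearMap.comp_apply, ContinuousLinearMap.id_apply] at h'
  simp [christoffel, h']

/-- Nondegeneracy makes the Koszul equation determine its solution. The Christoffel symbols of a
twisted product are found in this way: a candidate is paired with an arbitrary vector, and the
inverse metric is never computed. -/
lemma eq_christoffel [FiniteDimensional ℝ E] {G : E → E →L[ℝ] E →L[ℝ] ℝ} {u : E}
    (hG : ∀ v, (∀ w, G u v w = 0) → v = 0) {v w a : E}
    (h : ∀ z, 2 * G u a z = koszulForm (fderiv ℝ G u) v w z) : christoffel G u v w = a := by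
  rw [← sub_eq_zero]
  refine hG _ fun z ↦ ?_
  have := christoffel_spec hG v w z
  rw [← h z] at this
  simp only [map_sub, sub_apply]
  linarith

lemma fderiv_symm {G : E → E →L[ℝ] E →L[ℝ] ℝ} {u : E} (hd : DifferentiableAt ℝ G u)
    (hG : ∀ᶠ u' in 𝓝 u, ∀ v w, G u' v w = G u' w v) (x v w : E) :
    fderiv ℝ G u x v w = fderiv ℝ G u x w v := by
  have h1 := fderiv_bilin_apply hd (differentiableAt_const v) (differentiableAt_const w) x
  have h2 := fderiv_bilin_apply hd (differentiableAt_const w) (differentiableAt_const v) x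
  have h3 : (fun u' ↦ G u' v w) =ᶠ[𝓝 u] fun u' ↦ G u' w v := hG.mono fun u' h ↦ h v w
  rw [h3.fderiv_eq] at h1
  simpa using h1.symm.trans h2

namespace IsMetricNear

variable {G : E → E →L[ℝ] E →L[ℝ] ℝ} {u : E}

/-- The pointwise properties hold on a whole neighbourhood, which is what permits differentiating
the identities derived from them. -/
lemma eventually (hG : IsMetricNear G u) : ∀ᶠ u' in 𝓝 u,
    DifferentiableAt ℝ G u' ∧ (∀ v w, G u' v w = G u' w v) ∧
      ((∀ v, (∀ w, G u' v w = 0) → v = 0)) ∧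
      (∀ x v w : E, fderiv ℝ G u' x v w = fderiv ℝ G u' x w v) := by
  have h1 : ∀ᶠ u' in 𝓝 u, ContDiffAt ℝ 1 G u' :=
    (hG.smooth.of_le (by exact_mod_cast le_top)).eventually (by simp)
  filter_upwards [h1, hG.symm, hG.nondegenerate, eventually_eventually_nhds.2 hG.symm]
    with u' h1 h2 h3 h4
  have hd := h1.differentiableAt (by simp)
  exact ⟨hd, h2, h3, fderiv_symm hd h4⟩

lemma differentiableAt (hG : IsMetricNear G u) : DifferentiableAt ℝ G u :=
  hG.eventually.self_of_nhds.1

lemma symm_self (hG : IsMetricNear G u) (v w : E) : G u v w = G u w v :=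
  hG.eventually.self_of_nhds.2.1 v w

lemma nondegenerate_self (hG : IsMetricNear G u) (v : E) (h : ∀ w, G u v w = 0) : v = 0 :=
  hG.eventually.self_of_nhds.2.2.1 v h

lemma fderiv_symm (hG : IsMetricNear G u) (x v w : E) :
    fderiv ℝ G u x v w = fderiv ℝ G u x w v :=
  hG.eventually.self_of_nhds.2.2.2 x v w

variable [FiniteDimensional ℝ E]

lemma spec (hG : IsMetricNear G u) (v w z : E) :
    2 * G u (christoffel G u v w) z = fderiv ℝ G u v w z + fderiv ℝ G u w v z
      - fderiv ℝ G u z v w := by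
  rw [christoffel_spec hG.nondegenerate_self, koszulForm_apply]

/-- Inversion of continuous linear maps is smooth at an invertible one; the other operations in
`christoffel` are continuous linear or bilinear. -/
lemma contDiffAt_christoffel (hG : IsMetricNear G u) : ContDiffAt ℝ ∞ (christoffel G) u := by
  have := FiniteDimensional.complete ℝ E
  have h1 : ContDiffAt ℝ ∞ (fderiv ℝ G) u := hG.smooth.fderiv_right (by simp)
  have h2 : ContDiffAt ℝ ∞ (fun u' ↦ (fderiv ℝ G u').flip) u :=
    (ContinuousLinearMap.flipₗᵢ ℝ E E (E →L[ℝ] ℝ)).contDiff.contDiffAt.comp u h1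
  have h3 : ContDiffAt ℝ ∞ (fun u' ↦ koszulForm (fderiv ℝ G u')) u :=
    (h1.add h2).sub (contDiffAt_const.clm_comp h2)
  have h4 : ContDiffAt ℝ ∞ (fun u' ↦ (G u').inverse) u :=
    (isInvertible_of_nondegenerate (G u) hG.nondegenerate_self).contDiffAt_map_inverse.comp u
      hG.smooth
  have h5 : ContDiffAt ℝ ∞
      (fun u' ↦ ContinuousLinearMap.compL ℝ E (E →L[ℝ] ℝ) E (G u').inverse) u :=
    (ContinuousLinearMap.contDiff _).contDiffAt.comp u h4
  have h6 : ContDiffAt ℝ ∞ (fun u' ↦ (ContinuousLinearMap.compL ℝ E (E →L[ℝ] ℝ) E (G u').inverse) ∘L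
      koszulForm (fderiv ℝ G u')) u := h5.clm_comp h3
  exact h6.const_smul (2⁻¹ : ℝ)

lemma differentiableAt_christoffel (hG : IsMetricNear G u) :
    DifferentiableAt ℝ (christoffel G) u :=
  hG.contDiffAt_christoffel.differentiableAt (by simp)

lemma christoffel_symm (hG : IsMetricNear G u) (v w : E) :
    christoffel G u v w = christoffel G u w v := by
  refine eq_christoffel hG.nondegenerate_self fun z ↦ ?_
  rw [hG.spec, koszulForm_apply, hG.fderiv_symm z]
  ring

/-- The Christoffel symbols are compatible with the metric. -/
lemma fderiv_apply (hG : IsMetricNear G u) (x v w : E) :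
    fderiv ℝ G u x v w = G u (christoffel G u x v) w + G u v (christoffel G u x w) := by
  have h1 := hG.spec x v w
  have h2 := hG.spec x w v
  have h3 := hG.fderiv_symm x v w
  have h4 := hG.fderiv_symm v x w
  have h5 := hG.fderiv_symm w x v
  rw [hG.symm_self v]
  linarith

omit [FiniteDimensional ℝ E] in
lemma fderiv_fderiv_comm (hG : IsMetricNear G u) (x y v w : E) :
    fderiv ℝ (fderiv ℝ G) u x y v w = fderiv ℝ (fderiv ℝ G) u y x v w := by
  have h : IsSymmSndFDerivAt ℝ G u := hG.smooth.isSymmSndFDerivAt (by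
    simp only [minSmoothness_of_isRCLikeNormedField]; exact WithTop.coe_le_coe.2 le_top)
  rw [h.eq x y]

omit [FiniteDimensional ℝ E] in
lemma differentiableAt_fderiv (hG : IsMetricNear G u) : DifferentiableAt ℝ (fderiv ℝ G) u :=
  (hG.smooth.fderiv_right (m := ∞) (by simp)).differentiableAt (by simp)

omit [FiniteDimensional ℝ E] in
lemma fderiv_fderiv_symm (hG : IsMetricNear G u) (x y v w : E) :
    fderiv ℝ (fderiv ℝ G) u x y v w = fderiv ℝ (fderiv ℝ G) u x y w v := by
  have key : ∀ v w, fderiv ℝ (fun u' ↦ fderiv ℝ G u' y v w) u x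
      = fderiv ℝ (fderiv ℝ G) u x y v w := by
    intro v w
    have hd := hG.differentiableAt_fderiv
    have h1 := fderiv_bilin_apply (G := fun u' ↦ fderiv ℝ G u' y)
      (hd.clm_apply (differentiableAt_const y)) (differentiableAt_const v)
      (differentiableAt_const w) x
    rw [h1, fderiv_clm_apply hd (differentiableAt_const y)]
    simp
  rw [← key, ← key]
  have h3 : (fun u' ↦ fderiv ℝ G u' y v w) =ᶠ[𝓝 u] fun u' ↦ fderiv ℝ G u' y w v :=
    hG.eventually.mono fun u' h ↦ h.2.2.2 y v w
  rw [h3.fderiv_eq]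

end IsMetricNear

/-- The curvature tensor `R(x, e) y` of the connection `Y ↦ DY(X) + A(X, Y)`. -/
noncomputable def curvatureTensor (A : E → E →L[ℝ] E →L[ℝ] E) (u x e y : E) : E :=
  fderiv ℝ A u x e y - fderiv ℝ A u e x y + A u x (A u e y) - A u e (A u x y)

/-- Differentiating `2 G(Γ(v,w), z) = koszulForm` expresses `G(DΓ, z)` through second derivatives of
`G` and a term `DG(Γ, z)`. By metric compatibility the latter splits into two products, one of which
cancels a term `Γ(·, Γ)` of the curvature. Derivatives of the inverse metric do not enter. The last
slot repeats `e` because only such components occur in a Ricci sum. -/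
lemma IsMetricNear.apply_curvatureTensor [FiniteDimensional ℝ E] {G : E → E →L[ℝ] E →L[ℝ] ℝ}
    {u : E} (hG : IsMetricNear G u) (x e y : E) :
    G u (curvatureTensor (christoffel G) u x e y) e =
      2⁻¹ * (fderiv ℝ (fderiv ℝ G) u x y e e - fderiv ℝ (fderiv ℝ G) u e x y e
        - fderiv ℝ (fderiv ℝ G) u e y x e + fderiv ℝ (fderiv ℝ G) u e e x y)
      + G u (christoffel G u x y) (christoffel G u e e)
      - G u (christoffel G u e y) (christoffel G u x e) := by
  have hd := hG.differentiableAt_fderiv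
  have key : ∀ a v w z : E,
      2 * (fderiv ℝ G u a (christoffel G u v w) z + G u (fderiv ℝ (christoffel G) u a v w) z) =
      fderiv ℝ (fderiv ℝ G) u a v w z + fderiv ℝ (fderiv ℝ G) u a w v z
        - fderiv ℝ (fderiv ℝ G) u a z v w := by
    intro a v w z
    have h1 : (fun u' ↦ 2 * G u' (christoffel G u' v w) z) =ᶠ[𝓝 u] fun u' ↦
        fderiv ℝ G u' v w z + fderiv ℝ G u' w v z - fderiv ℝ G u' z v w := by
      filter_upwards [hG.eventually] with u' h
      rw [christoffel_spec h.2.2.1, koszulForm_apply]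
    have hc : ∀ v w z : E, HasFDerivAt (fun u' ↦ fderiv ℝ G u' v w z)
        ((((fderiv ℝ (fderiv ℝ G) u).flip v).flip w).flip z) u := by
      intro v w z
      have := ((hd.hasFDerivAt.clm_apply (hasFDerivAt_const v u)).clm_apply
        (hasFDerivAt_const w u)).clm_apply (hasFDerivAt_const z u)
      refine this.congr_fderiv ?_
      ext a
      simp
    have hΓ := hG.differentiableAt_christoffel
    have h2 : DifferentiableAt ℝ (fun u' ↦ christoffel G u' v w) u :=
      (hΓ.clm_apply (differentiableAt_const v)).clm_apply (differentiableAt_const w)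
    have h3 : fderiv ℝ (fun u' ↦ christoffel G u' v w) u a = fderiv ℝ (christoffel G) u a v w := by
      rw [fderiv_bilin_apply hΓ (differentiableAt_const v) (differentiableAt_const w)]
      simp
    have h4 := h1.fderiv_eq (𝕜 := ℝ)
    rw [(((hc v w z).fun_add (hc w v z)).fun_sub (hc z v w)).fderiv,
      fderiv_const_mul ((hG.differentiableAt.clm_apply h2).clm_apply (differentiableAt_const z))]
      at h4
    have h5 := DFunLike.congr_fun h4 a
    rw [smul_apply,
      fderiv_bilin_apply hG.differentiableAt h2 (differentiableAt_const z), h3] at h5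
    simpa using h5
  have e1 := key x e y e
  have e2 := key e x y e
  rw [hG.fderiv_apply] at e1 e2
  simp only [curvatureTensor, map_add, map_sub, add_apply,
    sub_apply]
  -- The first and third second derivatives in `e1` agree by the two symmetries of `D²G`, and
  -- cancel.
  rw [hG.fderiv_fderiv_comm x e y e] at e1
  have e3 := hG.fderiv_fderiv_symm x e e y
  rw [hG.fderiv_fderiv_comm x e y e] at e3
  linarith

end FlatConnection


/-! ### The quarter-symmetric connection, orthonormal families and the Ricci trace -/

section FlatQuarterSymmetric

open Filter Topology

variable {E : Type*} [NormedAddCommGroup E] [NormedSpace ℝ E]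

/-- The connection coefficients `Γ(v, w) + λ₁ G(w, p) v - λ₂ G(v, w) p`. -/
noncomputable def quarterCoeff (G : E → E →L[ℝ] E →L[ℝ] ℝ) (p : E → E) (lam₁ lam₂ : ℝ) (u : E) :
    E →L[ℝ] E →L[ℝ] E :=
  christoffel G u + lam₁ • ContinuousLinearMap.smulRightL ℝ E E ((G u).flip (p u))
    - lam₂ • ((ContinuousLinearMap.smulRightL ℝ E E).flip (p u)) ∘L (G u)

lemma quarterCoeff_apply (G : E → E →L[ℝ] E →L[ℝ] ℝ) (p : E → E) (lam₁ lam₂ : ℝ) (u v w : E) :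
    quarterCoeff G p lam₁ lam₂ u v w =
      christoffel G u v w + (lam₁ * G u w (p u)) • v - (lam₂ * G u v w) • p u := by
  simp [quarterCoeff, mul_smul]

lemma fderiv_coeff_apply {A : E → E →L[ℝ] E →L[ℝ] E} {u : E} (hA : DifferentiableAt ℝ A u)
    (x v w : E) : fderiv ℝ (fun u' ↦ A u' v w) u x = fderiv ℝ A u x v w := by
  rw [fderiv_bilin_apply hA (differentiableAt_const v) (differentiableAt_const w)]
  simp

lemma differentiableAt_quarterCoeff [FiniteDimensional ℝ E] {G : E → E →L[ℝ] E →L[ℝ] ℝ} {p : E → E}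
    {u : E} (hG : IsMetricNear G u) (hp : DifferentiableAt ℝ p u) (lam₁ lam₂ : ℝ) :
    DifferentiableAt ℝ (quarterCoeff G p lam₁ lam₂) u := by
  have h0 := hG.differentiableAt_christoffel
  have h1 : DifferentiableAt ℝ (fun u' ↦ (G u').flip) u :=
    (ContinuousLinearMap.flipₗᵢ ℝ E E ℝ).differentiable.differentiableAt.comp u hG.differentiableAt
  have h2 : DifferentiableAt ℝ (fun u' ↦ (G u').flip (p u')) u := h1.clm_apply hp
  have h3 : DifferentiableAt ℝ
      (fun u' ↦ ContinuousLinearMap.smulRightL ℝ E E ((G u').flip (p u'))) u :=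
    (ContinuousLinearMap.differentiableAt _).comp u h2
  have h4 : DifferentiableAt ℝ
      (fun u' ↦ (ContinuousLinearMap.smulRightL ℝ E E).flip (p u')) u :=
    (ContinuousLinearMap.differentiableAt _).comp u hp
  have h5 : DifferentiableAt ℝ
      (fun u' ↦ ((ContinuousLinearMap.smulRightL ℝ E E).flip (p u')) ∘L (G u')) u :=
    h4.clm_comp hG.differentiableAt
  exact (h0.add (h3.const_smul lam₁)).sub (h5.const_smul lam₂)

lemma fderiv_quarterCoeff [FiniteDimensional ℝ E] {G : E → E →L[ℝ] E →L[ℝ] ℝ} {p : E → E} {u : E}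
    (hG : IsMetricNear G u) (hp : DifferentiableAt ℝ p u) (lam₁ lam₂ : ℝ) (x v w : E) :
    fderiv ℝ (quarterCoeff G p lam₁ lam₂) u x v w =
      fderiv ℝ (christoffel G) u x v w
      + (lam₁ * (fderiv ℝ G u x w (p u) + G u w (fderiv ℝ p u x))) • v
      - (lam₂ * fderiv ℝ G u x v w) • p u - (lam₂ * G u v w) • fderiv ℝ p u x := by
  rw [← fderiv_coeff_apply (differentiableAt_quarterCoeff hG hp lam₁ lam₂)]
  have hd := hG.differentiableAt
  have hΓ := hG.differentiableAt_christoffel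
  have h0 : HasFDerivAt (fun u' ↦ christoffel G u' v w)
      (fderiv ℝ (fun u' ↦ christoffel G u' v w) u) u :=
    ((hΓ.clm_apply (differentiableAt_const v)).clm_apply (differentiableAt_const w)).hasFDerivAt
  have h1 : HasFDerivAt (fun u' ↦ G u' w (p u')) (fderiv ℝ (fun u' ↦ G u' w (p u')) u) u :=
    ((hd.clm_apply (differentiableAt_const w)).clm_apply hp).hasFDerivAt
  have h2 : HasFDerivAt (fun u' ↦ G u' v w) (fderiv ℝ (fun u' ↦ G u' v w) u) u :=
    ((hd.clm_apply (differentiableAt_const v)).clm_apply (differentiableAt_const w)).hasFDerivAt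
  have h3 := (h0.fun_add ((h1.const_mul lam₁).smul_const v)).fun_sub
    ((h2.const_mul lam₂).fun_smul hp.hasFDerivAt)
  have h4 : (fun u' ↦ quarterCoeff G p lam₁ lam₂ u' v w) = fun u' ↦
      christoffel G u' v w + (lam₁ * G u' w (p u')) • v - (lam₂ * G u' v w) • p u' := by
    ext u'
    exact quarterCoeff_apply ..
  rw [h4, h3.fderiv]
  simp only [add_apply, sub_apply, smul_apply, ContinuousLinearMap.smulRight_apply]
  rw [fderiv_coeff_apply hΓ, fderiv_bilin_apply hd (differentiableAt_const w) hp,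
    fderiv_bilin_apply hd (differentiableAt_const v) (differentiableAt_const w)]
  simp only [fderiv_fun_const, Pi.zero_apply, zero_apply, map_zero, add_zero,
    smul_eq_mul]
  abel

/-- The curvature of the quarter-symmetric connection in terms of that of the Levi-Civita
connection. -/
lemma apply_curvatureTensor_quarterCoeff [FiniteDimensional ℝ E] {G : E → E →L[ℝ] E →L[ℝ] ℝ}
    {p : E → E} {u : E} (hG : IsMetricNear G u) (hp : DifferentiableAt ℝ p u) (lam₁ lam₂ : ℝ)
    (x e y z : E) :
    G u (curvatureTensor (quarterCoeff G p lam₁ lam₂) u x e y) z =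
      G u (curvatureTensor (christoffel G) u x e y) z
      + lam₁ * G u y (fderiv ℝ p u x + christoffel G u x (p u)) * G u e z
      - lam₁ * G u y (fderiv ℝ p u e + christoffel G u e (p u)) * G u x z
      + lam₂ * G u x y * G u (fderiv ℝ p u e + christoffel G u e (p u)) z
      - lam₂ * G u e y * G u (fderiv ℝ p u x + christoffel G u x (p u)) z
      + lam₁ * lam₂ * G u (p u) (p u) * (G u x y * G u e z - G u e y * G u x z)
      + lam₂ ^ 2 * (G u e y * G u x (p u) - G u x y * G u e (p u)) * G u (p u) z
      + lam₁ ^ 2 * G u y (p u) * (G u e (p u) * G u x z - G u x (p u) * G u e z) := by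
  -- Metric compatibility replaces each derivative of `G` by Christoffel symbols. Those acting on
  -- `p` complete `Dp` to the covariant derivative of `p`; the others cancel because `Γ` is
  -- symmetric.
  simp only [curvatureTensor, fderiv_quarterCoeff hG hp, quarterCoeff_apply, hG.fderiv_apply,
    map_add, map_sub, map_smul, add_apply, sub_apply, smul_apply, smul_eq_mul]
  rw [hG.christoffel_symm e x, hG.symm_self e x]
  ring

/-- `e` is an orthonormal family for the bilinear form `g`. -/
structure IsOrthonormalFamily (g : E →L[ℝ] E →L[ℝ] ℝ) {κ : Type*} (e : κ → E) : Prop where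
  orthogonal : ∀ k l, k ≠ l → g (e k) (e l) = 0
  unit : ∀ k, g (e k) (e k) = 1 ∨ g (e k) (e k) = -1

namespace IsOrthonormalFamily

variable {g : E →L[ℝ] E →L[ℝ] ℝ} {κ κ' : Type*} [Fintype κ] [Fintype κ'] {e : κ → E} {f : κ' → E}

omit [Fintype κ] in
lemma mul_self (he : IsOrthonormalFamily g e) (k : κ) : g (e k) (e k) * g (e k) (e k) = 1 := by
  rcases he.unit k with h | h <;> simp [h]

lemma sum_apply (he : IsOrthonormalFamily g e) (c : κ → ℝ) (l : κ) :
    g (∑ k, c k • e k) (e l) = c l * g (e l) (e l) := by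
  simp only [map_sum, map_smul, _root_.sum_apply, smul_apply, smul_eq_mul]
  rw [Finset.sum_eq_single l]
  · intro k _ hk
    rw [he.orthogonal k l hk, mul_zero]
  · simp

lemma linearIndependent (he : IsOrthonormalFamily g e) : LinearIndependent ℝ e := by
  rw [Fintype.linearIndependent_iff]
  intro c hc l
  have h := he.sum_apply c l
  have h1 := he.mul_self l
  rw [hc] at h
  simp only [map_zero, zero_apply] at h
  have : c l * (g (e l) (e l) * g (e l) (e l)) = 0 := by rw [← mul_assoc, ← h, zero_mul]
  rwa [h1, mul_one] at this

/-- The cardinality makes the independent family a basis. Pairing with `e k` recovers a coefficient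
up to the sign `g (e k) (e k)`, whose square is `1`. -/
lemma sum_smul [FiniteDimensional ℝ E] (he : IsOrthonormalFamily g e)
    (hcard : Fintype.card κ = finrank ℝ E) (v : E) :
    ∑ k, (g (e k) (e k) * g v (e k)) • e k = v := by
  have hspan := he.linearIndependent.span_eq_top_of_card_eq_finrank' hcard
  have hv : v ∈ Submodule.span ℝ (Set.range e) := by rw [hspan]; trivial
  obtain ⟨c, rfl⟩ := (Submodule.mem_span_range_iff_exists_fun ℝ).1 hv
  refine Finset.sum_congr rfl fun k _ ↦ ?_
  rw [he.sum_apply, mul_left_comm, he.mul_self, mul_one]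

/-- This is the contraction rule: apply `φ` to the expansion of `v`. Every trace in the Ricci
computations, apart from the divergence and the count `sum_one`, has this shape. -/
lemma sum_linear [FiniteDimensional ℝ E] (he : IsOrthonormalFamily g e)
    (hcard : Fintype.card κ = finrank ℝ E) (v : E) (φ : E →L[ℝ] ℝ) :
    ∑ k, g (e k) (e k) * (φ (e k) * g v (e k)) = φ v := by
  conv_rhs => rw [← he.sum_smul hcard v]
  simp only [map_sum, map_smul, smul_eq_mul]
  exact Finset.sum_congr rfl fun k _ ↦ by ring

lemma sum_one (he : IsOrthonormalFamily g e) :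
    ∑ k, g (e k) (e k) * g (e k) (e k) = Fintype.card κ := by
  simp [he.mul_self]

/-- The trace of a bilinear form does not depend on the orthonormal family. -/
lemma trace_eq [FiniteDimensional ℝ E] (he : IsOrthonormalFamily g e)
    (hcard : Fintype.card κ = finrank ℝ E) (hf : IsOrthonormalFamily g f)
    (hcard' : Fintype.card κ' = finrank ℝ E) (hg : ∀ v w, g v w = g w v)
    (T : E →L[ℝ] E →L[ℝ] ℝ) :
    ∑ k, g (e k) (e k) * T (e k) (e k) = ∑ k, g (f k) (f k) * T (f k) (f k) := by
  have h1 : ∀ k, T (e k) (e k) =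
      ∑ a, g (f a) (f a) * g (e k) (f a) * T (f a) (e k) := by
    intro k
    have h := congrArg (fun v ↦ T v (e k)) (hf.sum_smul hcard' (e k))
    simpa only [map_sum, map_smul, _root_.sum_apply, smul_apply, smul_eq_mul] using h.symm
  -- With one slot of `T` expanded in `f` and the sums exchanged, the sum over `e` is a contraction
  -- in the other slot.
  simp only [h1, Finset.mul_sum]
  rw [Finset.sum_comm]
  refine Finset.sum_congr rfl fun a _ ↦ ?_
  rw [← he.sum_linear hcard (f a) (T (f a)), Finset.mul_sum]
  refine Finset.sum_congr rfl fun k _ ↦ ?_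
  rw [hg (e k) (f a)]
  ring

end IsOrthonormalFamily

/-- The linear map `e ↦ R(x, e) y`. -/
noncomputable def curvatureMap (A : E → E →L[ℝ] E →L[ℝ] E) (u x y : E) : E →L[ℝ] E :=
  (fderiv ℝ A u x).flip y - ((fderiv ℝ A u).flip x).flip y + (A u x) ∘L ((A u).flip y)
    - (A u).flip (A u x y)

lemma curvatureMap_apply (A : E → E →L[ℝ] E →L[ℝ] E) (u x y e : E) :
    curvatureMap A u x y e = curvatureTensor A u x e y := by
  simp [curvatureMap, curvatureTensor]

/-- The Ricci tensor `∑ₖ εₖ G(R(x, eₖ) y, eₖ)` of the connection with coefficients `A`. -/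
noncomputable def flatRicci (G : E → E →L[ℝ] E →L[ℝ] ℝ) (A : E → E →L[ℝ] E →L[ℝ] E) {κ : Type*}
    [Fintype κ] (e : κ → E) (u x y : E) : ℝ :=
  ∑ k, G u (e k) (e k) * G u (curvatureTensor A u x (e k) y) (e k)

variable [FiniteDimensional ℝ E] {G : E → E →L[ℝ] E →L[ℝ] ℝ} {u : E} {κ κ' : Type*} [Fintype κ]
  [Fintype κ'] {e : κ → E} {f : κ' → E}

/-- The curvature `R(x, e) y` is linear in `e`, as `curvatureMap` records, so the Ricci sum is the
trace of a bilinear form. A given frame can thus be exchanged for one adapted to the product. -/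
lemma flatRicci_eq (hG : IsMetricNear G u) (he : IsOrthonormalFamily (G u) e)
    (hcard : Fintype.card κ = finrank ℝ E) (hf : IsOrthonormalFamily (G u) f)
    (hcard' : Fintype.card κ' = finrank ℝ E) (A : E → E →L[ℝ] E →L[ℝ] E) (x y : E) :
    flatRicci G A e u x y = flatRicci G A f u x y := by
  simpa [curvatureMap_apply, flatRicci] using
    he.trace_eq hcard hf hcard' hG.symm_self ((G u) ∘L curvatureMap A u x y)

/-- The Ricci tensor of the quarter-symmetric connection in terms of that of the Levi-Civita
connection. -/
lemma flatRicci_quarterCoeff (hG : IsMetricNear G u) (he : IsOrthonormalFamily (G u) e)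
    (hcard : Fintype.card κ = finrank ℝ E) {p : E → E} (hp : DifferentiableAt ℝ p u)
    (lam₁ lam₂ : ℝ) (x y : E) :
    flatRicci G (quarterCoeff G p lam₁ lam₂) e u x y =
      flatRicci G (christoffel G) e u x y
      + ((finrank ℝ E - 1) * lam₁ - lam₂) * G u y (fderiv ℝ p u x + christoffel G u x (p u))
      + lam₂ * G u x y *
        ∑ k, G u (e k) (e k) * G u (fderiv ℝ p u (e k) + christoffel G u (e k) (p u)) (e k)
      + ((finrank ℝ E - 1) * lam₁ * lam₂ - lam₂ ^ 2) * G u (p u) (p u) * G u x y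
      + (lam₂ ^ 2 + (1 - finrank ℝ E) * lam₁ ^ 2) * G u x (p u) * G u y (p u) := by
  have s1 := he.sum_one
  have s2 := he.sum_linear hcard x
    ((G u y) ∘L (fderiv ℝ p u + (christoffel G u).flip (p u)))
  have s3 := he.sum_linear hcard (fderiv ℝ p u x + christoffel G u x (p u)) (G u y)
  have s4 := he.sum_linear hcard x (G u y)
  have s5 := he.sum_linear hcard (p u) (G u y)
  have s6 := he.sum_linear hcard (p u) (G u (p u))
  have s7 := he.sum_linear hcard x (G u (p u))
  rw [hcard] at s1
  simp only [ContinuousLinearMap.comp_apply, add_apply, ContinuousLinearMap.flip_apply] at s2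
  -- After the split each sum is one of `s1`, ..., `s7` or the divergence. The dimension comes from
  -- `s1`, and the `1` subtracted from it comes from contracting `e k` against `x` or `y`.
  have hsplit : flatRicci G (quarterCoeff G p lam₁ lam₂) e u x y =
      flatRicci G (christoffel G) e u x y
      + lam₁ * G u y (fderiv ℝ p u x + christoffel G u x (p u))
        * ∑ k, G u (e k) (e k) * G u (e k) (e k)
      - lam₁ * ∑ k, G u (e k) (e k) *
        (G u y (fderiv ℝ p u (e k) + christoffel G u (e k) (p u)) * G u x (e k))
      + lam₂ * G u x y *
        ∑ k, G u (e k) (e k) * G u (fderiv ℝ p u (e k) + christoffel G u (e k) (p u)) (e k)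
      - lam₂ * ∑ k, G u (e k) (e k) *
        (G u y (e k) * G u (fderiv ℝ p u x + christoffel G u x (p u)) (e k))
      + lam₁ * lam₂ * G u (p u) (p u) * (G u x y * ∑ k, G u (e k) (e k) * G u (e k) (e k)
        - ∑ k, G u (e k) (e k) * (G u y (e k) * G u x (e k)))
      + lam₂ ^ 2 * (G u x (p u) * ∑ k, G u (e k) (e k) * (G u y (e k) * G u (p u) (e k))
        - G u x y * ∑ k, G u (e k) (e k) * (G u (p u) (e k) * G u (p u) (e k)))
      + lam₁ ^ 2 * G u y (p u) * (∑ k, G u (e k) (e k) * (G u (p u) (e k) * G u x (e k))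
        - G u x (p u) * ∑ k, G u (e k) (e k) * G u (e k) (e k)) := by
    simp only [flatRicci, Finset.mul_sum, ← Finset.sum_add_distrib, ← Finset.sum_sub_distrib]
    refine Finset.sum_congr rfl fun k _ ↦ ?_
    rw [apply_curvatureTensor_quarterCoeff hG hp, hG.symm_self (e k) y, hG.symm_self (e k) (p u)]
    ring
  rw [hsplit, s1, s2, s3, s4, s5, s6, s7, hG.symm_self (p u) x, hG.symm_self y x]
  ring

omit [FiniteDimensional ℝ E] in
/-- The curvature of the connection `∇_X Y = DY(X) + A(X, Y)` is the curvature tensor. -/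
lemma fderiv_connection_comm {A : E → E →L[ℝ] E →L[ℝ] E} {u : E} {X Z Y : E → E}
    (hA : DifferentiableAt ℝ A u) (hX : DifferentiableAt ℝ X u) (hZ : DifferentiableAt ℝ Z u)
    (hY : ContDiffAt ℝ 2 Y u) :
    (fderiv ℝ (fun u' ↦ fderiv ℝ Y u' (Z u') + A u' (Z u') (Y u')) u (X u)
        + A u (X u) (fderiv ℝ Y u (Z u) + A u (Z u) (Y u)))
      - (fderiv ℝ (fun u' ↦ fderiv ℝ Y u' (X u') + A u' (X u') (Y u')) u (Z u)
        + A u (Z u) (fderiv ℝ Y u (X u) + A u (X u) (Y u)))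
      - (fderiv ℝ Y u (fderiv ℝ Z u (X u) - fderiv ℝ X u (Z u))
        + A u (fderiv ℝ Z u (X u) - fderiv ℝ X u (Z u)) (Y u)) =
      curvatureTensor A u (X u) (Z u) (Y u) := by
  have hY1 : DifferentiableAt ℝ Y u := hY.differentiableAt (by simp)
  have hdY : DifferentiableAt ℝ (fderiv ℝ Y) u :=
    (hY.fderiv_right (m := 1) (by norm_num)).differentiableAt (by simp)
  have key : ∀ (V : E → E) (w : E), DifferentiableAt ℝ V u →
      fderiv ℝ (fun u' ↦ fderiv ℝ Y u' (V u') + A u' (V u') (Y u')) u w =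
        fderiv ℝ (fderiv ℝ Y) u w (V u) + fderiv ℝ Y u (fderiv ℝ V u w)
        + (fderiv ℝ A u w (V u) (Y u) + A u (fderiv ℝ V u w) (Y u)
          + A u (V u) (fderiv ℝ Y u w)) := by
    intro V w hV
    rw [fderiv_fun_add (hdY.clm_apply hV) ((hA.clm_apply hV).clm_apply hY1), add_apply,
      fderiv_bilin_apply hA hV hY1, fderiv_clm_apply hdY hV]
    simp [add_comm]
  -- The second derivatives of `Y` cancel by symmetry, and the derivatives of `X` and `Z` cancel
  -- against the bracket, leaving a tensor.
  have hsymm : IsSymmSndFDerivAt ℝ Y u := hY.isSymmSndFDerivAt (by simp)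
  rw [key Z _ hZ, key X _ hX, hsymm.eq (X u) (Z u), curvatureTensor]
  simp only [map_sub, map_add, sub_apply]
  abel

end FlatQuarterSymmetric


/-! ### Twisted metrics on a product of normed spaces and their derivatives -/

section FlatTwistedProduct

open Filter Topology

lemma contDiffAt_bilinearComp {E E' W : Type*} [NormedAddCommGroup E] [NormedSpace ℝ E]
    [NormedAddCommGroup E'] [NormedSpace ℝ E'] [NormedAddCommGroup W] [NormedSpace ℝ W]
    {n : ℕ∞ω} {f : W → E →L[ℝ] E →L[ℝ] ℝ} {u : W} (hf : ContDiffAt ℝ n f u) (L : E' →L[ℝ] E) :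
    ContDiffAt ℝ n (fun u' ↦ (f u').bilinearComp L L) u := by
  have hflip : ContDiff ℝ n (fun g : E' →L[ℝ] E →L[ℝ] ℝ ↦ g.flip) :=
    (ContinuousLinearMap.flipₗᵢ ℝ E' E ℝ).contDiff
  have hflip' : ContDiff ℝ n (fun g : E' →L[ℝ] E' →L[ℝ] ℝ ↦ g.flip) :=
    (ContinuousLinearMap.flipₗᵢ ℝ E' E' ℝ).contDiff
  have h1 : ContDiffAt ℝ n (fun u' ↦ (f u') ∘L L) u := hf.clm_comp contDiffAt_const
  have h2 : ContDiffAt ℝ n (fun u' ↦ ((f u') ∘L L).flip) u := hflip.contDiffAt.comp u h1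
  have h3 : ContDiffAt ℝ n (fun u' ↦ (((f u') ∘L L).flip) ∘L L) u := h2.clm_comp contDiffAt_const
  exact hflip'.contDiffAt.comp u h3

lemma fderiv_bilin_const {E W : Type*} [NormedAddCommGroup E] [NormedSpace ℝ E]
    [NormedAddCommGroup W] [NormedSpace ℝ W] {f : W → E →L[ℝ] E →L[ℝ] ℝ} {u : W}
    (hf : DifferentiableAt ℝ f u) (x : W) (v w : E) :
    fderiv ℝ (fun u' ↦ f u' v w) u x = fderiv ℝ f u x v w := by
  rw [fderiv_bilin_apply hf (differentiableAt_const v) (differentiableAt_const w)]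
  simp

lemma fderiv_fderiv_bilin_const {E W : Type*} [NormedAddCommGroup E] [NormedSpace ℝ E]
    [NormedAddCommGroup W] [NormedSpace ℝ W] {f : W → E →L[ℝ] E →L[ℝ] ℝ} {u : W}
    (hf : ContDiffAt ℝ ∞ f u) (x y : W) (v w : E) :
    fderiv ℝ (fun u' ↦ fderiv ℝ f u' y v w) u x = fderiv ℝ (fderiv ℝ f) u x y v w := by
  have hd : DifferentiableAt ℝ (fderiv ℝ f) u :=
    (hf.fderiv_right (m := ∞) (by simp)).differentiableAt (by simp)
  rw [fderiv_bilin_const (f := fun u' ↦ fderiv ℝ f u' y)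
    (hd.clm_apply (differentiableAt_const y)), fderiv_clm_apply hd (differentiableAt_const y)]
  simp

lemma _root_.ContDiffAt.eventually_differentiableAt {E W : Type*} [NormedAddCommGroup E]
    [NormedSpace ℝ E] [NormedAddCommGroup W] [NormedSpace ℝ W] {f : W → E} {u : W}
    (hf : ContDiffAt ℝ ∞ f u) : ∀ᶠ u' in 𝓝 u, DifferentiableAt ℝ f u' := by
  have h1 : ∀ᶠ u' in 𝓝 u, ContDiffAt ℝ 1 f u' :=
    (hf.of_le (by exact_mod_cast le_top)).eventually (by simp)
  exact h1.mono fun u' h ↦ h.differentiableAt (by simp)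

variable {EB : Type*} [NormedAddCommGroup EB] [NormedSpace ℝ EB]
  {ι : Type*} [Fintype ι] {EF : ι → Type*}
  [∀ i, NormedAddCommGroup (EF i)] [∀ i, NormedSpace ℝ (EF i)]

/-- The metric `GB ⊕ ⨁ᵢ h i` on `EB × ∏ᵢ EF i`, where `h i` depends on the base point and on the
`i`-th coordinate. -/
noncomputable def flatTwisted (GB : EB → EB →L[ℝ] EB →L[ℝ] ℝ)
    (h : ∀ i, EB × EF i → EF i →L[ℝ] EF i →L[ℝ] ℝ) (u : EB × ∀ i, EF i) :
    (EB × ∀ i, EF i) →L[ℝ] (EB × ∀ i, EF i) →L[ℝ] ℝ :=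
  (GB u.1).bilinearComp (ContinuousLinearMap.fst ℝ EB (∀ i, EF i))
      (ContinuousLinearMap.fst ℝ EB (∀ i, EF i))
    + ∑ i, (h i (u.1, u.2 i)).bilinearComp
      ((ContinuousLinearMap.proj i).comp (ContinuousLinearMap.snd ℝ EB (∀ i, EF i)))
      ((ContinuousLinearMap.proj i).comp (ContinuousLinearMap.snd ℝ EB (∀ i, EF i)))

variable {GB : EB → EB →L[ℝ] EB →L[ℝ] ℝ}
  {h : ∀ i, EB × EF i → EF i →L[ℝ] EF i →L[ℝ] ℝ} {lam : ∀ i, EB × EF i → ℝ}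
  {u : EB × ∀ i, EF i}

lemma flatTwisted_apply (GB : EB → EB →L[ℝ] EB →L[ℝ] ℝ)
    (h : ∀ i, EB × EF i → EF i →L[ℝ] EF i →L[ℝ] ℝ) (u v w : EB × ∀ i, EF i) :
    flatTwisted GB h u v w = GB u.1 v.1 w.1 + ∑ i, h i (u.1, u.2 i) (v.2 i) (w.2 i) := by
  simp [flatTwisted, _root_.sum_apply]

/-- The hypotheses on a twisted product near a point of the model space: `GB` is a metric, the `h i`
restrict to metrics on the fibres, and they are warped along the base with logarithmic warping
functions `lam i`. -/
structure IsTwistedNear (GB : EB → EB →L[ℝ] EB →L[ℝ] ℝ)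
    (h : ∀ i, EB × EF i → EF i →L[ℝ] EF i →L[ℝ] ℝ) (lam : ∀ i, EB × EF i → ℝ)
    (u : EB × ∀ i, EF i) : Prop where
  base : IsMetricNear GB u.1
  smooth : ∀ i, ContDiffAt ℝ ∞ (h i) (u.1, u.2 i)
  symm : ∀ i, ∀ᶠ z in 𝓝 (u.1, u.2 i), ∀ v w, h i z v w = h i z w v
  nondegenerate : ∀ i, ∀ᶠ z in 𝓝 (u.1, u.2 i), ∀ v, (∀ w, h i z v w = 0) → v = 0
  smooth_lam : ∀ i, ContDiffAt ℝ ∞ (lam i) (u.1, u.2 i)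
  -- For `h i = exp(2 lam i) g` with `g` a metric on the fibre, this is the derivative along the
  -- base. Derivatives along the fibre are left free, since `lam i` may depend on the fibre
  -- coordinate.
  warp : ∀ i, ∀ᶠ z in 𝓝 (u.1, u.2 i), ∀ x v w,
    fderiv ℝ (h i) z (x, 0) v w = 2 * fderiv ℝ (lam i) z (x, 0) * h i z v w

namespace IsTwistedNear

lemma tendsto (u : EB × ∀ i, EF i) (i : ι) :
    Tendsto (fun u' : EB × ∀ i, EF i ↦ (u'.1, u'.2 i)) (𝓝 u) (𝓝 (u.1, u.2 i)) :=
  Continuous.tendsto (by fun_prop) u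

lemma contDiffAt_flatTwisted (hT : IsTwistedNear GB h lam u) :
    ContDiffAt ℝ ∞ (flatTwisted GB h) u := by
  unfold flatTwisted
  refine (contDiffAt_bilinearComp (hT.base.smooth.comp u contDiffAt_fst) _).add
    (ContDiffAt.sum fun i _ ↦ contDiffAt_bilinearComp
      (ContDiffAt.comp u (hT.smooth i) ?_) _)
  exact contDiffAt_fst.prodMk ((contDiffAt_pi.1 contDiffAt_snd) i)

variable [DecidableEq ι]

/-- A vector tangent to the base. -/
def inBase (EF : ι → Type*) [∀ i, NormedAddCommGroup (EF i)] (x : EB) : EB × ∀ i, EF i := (x, 0)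

/-- A vector tangent to the `i`-th fibre. -/
def inFiber (EB : Type*) [NormedAddCommGroup EB] (i : ι) (v : EF i) : EB × ∀ i, EF i :=
  (0, Pi.single i v)

omit [DecidableEq ι] in
lemma flatTwisted_inBase (u : EB × ∀ i, EF i) (x : EB) (w : EB × ∀ i, EF i) :
    flatTwisted GB h u (inBase EF x) w = GB u.1 x w.1 := by
  simp [flatTwisted_apply, inBase]

lemma flatTwisted_inFiber (u : EB × ∀ i, EF i) (i : ι) (v : EF i) (w : EB × ∀ i, EF i) :
    flatTwisted GB h u (inFiber EB i v) w = h i (u.1, u.2 i) v (w.2 i) := by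
  rw [flatTwisted_apply, Finset.sum_eq_single i]
  · simp [inFiber]
  · intro j _ hj
    simp [inFiber, Pi.single_eq_of_ne hj]
  · simp

/-- The blocks are mutually orthogonal, so pairing with vectors tangent to one factor tests
nondegeneracy of that block alone. -/
lemma isMetricNear (hT : IsTwistedNear GB h lam u) : IsMetricNear (flatTwisted GB h) u where
  smooth := hT.contDiffAt_flatTwisted
  symm := by
    have h1 : ∀ᶠ u' in 𝓝 u, ∀ i, ∀ v w, h i (u'.1, u'.2 i) v w = h i (u'.1, u'.2 i) w v :=
      eventually_all.2 fun i ↦ (tendsto u i).eventually (hT.symm i)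
    filter_upwards [h1, (continuous_fst.tendsto u).eventually hT.base.symm] with u' h1 h2 v w
    simp only [flatTwisted_apply, h2 v.1 w.1, fun i ↦ h1 i (v.2 i) (w.2 i)]
  nondegenerate := by
    have h1 : ∀ᶠ u' in 𝓝 u, ∀ i, ∀ v, (∀ w, h i (u'.1, u'.2 i) v w = 0) → v = 0 :=
      eventually_all.2 fun i ↦ (tendsto u i).eventually (hT.nondegenerate i)
    have h1' : ∀ᶠ u' in 𝓝 u, ∀ i, ∀ v w, h i (u'.1, u'.2 i) v w = h i (u'.1, u'.2 i) w v :=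
      eventually_all.2 fun i ↦ (tendsto u i).eventually (hT.symm i)
    filter_upwards [h1, h1', (continuous_fst.tendsto u).eventually hT.base.nondegenerate,
      (continuous_fst.tendsto u).eventually hT.base.symm] with u' h1 h1' h2 h2' v hv
    have hs : ∀ v w, flatTwisted GB h u' v w = flatTwisted GB h u' w v := by
      intro v w
      simp only [flatTwisted_apply, h2' v.1 w.1, fun i ↦ h1' i (v.2 i) (w.2 i)]
    have e1 : v.1 = 0 := by
      refine h2 _ fun w ↦ ?_
      rw [h2', ← flatTwisted_inBase (EF := EF) (h := h) u' w v, hs]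
      exact hv _
    have e2 : v.2 = 0 := by
      funext i
      refine h1 i _ fun w ↦ ?_
      rw [h1', ← flatTwisted_inFiber (GB := GB) (h := h) u' i w v, hs]
      exact hv _
    exact Prod.ext e1 e2

-- Freezing the base point gives the metric induced on the fibre through the point; its Ricci tensor
-- is the one that appears in the fibre components.
omit [DecidableEq ι] in
lemma fiber (hT : IsTwistedNear GB h lam u) (i : ι) :
    IsMetricNear (fun y ↦ h i (u.1, y)) (u.2 i) := by
  have ht : Tendsto (fun y ↦ (u.1, y)) (𝓝 (u.2 i)) (𝓝 (u.1, u.2 i)) :=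
    Continuous.tendsto (by fun_prop) _
  exact ⟨ContDiffAt.comp (u.2 i) (hT.smooth i) (contDiffAt_const.prodMk contDiffAt_id),
    ht.eventually (hT.symm i), ht.eventually (hT.nondegenerate i)⟩

-- Stated on a neighbourhood because it is differentiated once more to obtain the second derivatives
-- of the twisted metric.
omit [DecidableEq ι] in
lemma eventually_fderiv (hT : IsTwistedNear GB h lam u) : ∀ᶠ u' in 𝓝 u, ∀ x v w,
    fderiv ℝ (flatTwisted GB h) u' x v w = fderiv ℝ GB u'.1 x.1 v.1 w.1
      + ∑ i, fderiv ℝ (h i) (u'.1, u'.2 i) (x.1, x.2 i) (v.2 i) (w.2 i) := by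
  have h1 : ∀ᶠ u' in 𝓝 u, ∀ i, DifferentiableAt ℝ (h i) (u'.1, u'.2 i) :=
    eventually_all.2 fun i ↦ (tendsto u i).eventually (hT.smooth i).eventually_differentiableAt
  filter_upwards [h1, hT.contDiffAt_flatTwisted.eventually_differentiableAt,
    (continuous_fst.tendsto u).eventually hT.base.smooth.eventually_differentiableAt]
    with u' h1 h2 h3 x v w
  rw [← fderiv_bilin_const h2]
  have e0 : (fun u' ↦ flatTwisted GB h u' v w) = fun u' ↦
      GB u'.1 v.1 w.1 + ∑ i, h i (u'.1, u'.2 i) (v.2 i) (w.2 i) := by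
    ext u'
    exact flatTwisted_apply ..
  have e1 : HasFDerivAt (fun u' : EB × ∀ i, EF i ↦ GB u'.1 v.1 w.1)
      ((fderiv ℝ (fun p ↦ GB p v.1 w.1) u'.1) ∘L ContinuousLinearMap.fst ℝ EB (∀ i, EF i)) u' :=
    HasFDerivAt.comp (g := fun p ↦ GB p v.1 w.1) u'
      (((h3.clm_apply (differentiableAt_const _)).clm_apply
        (differentiableAt_const _)).hasFDerivAt) hasFDerivAt_fst
  have e2 : ∀ i, HasFDerivAt (fun u' : EB × ∀ i, EF i ↦ h i (u'.1, u'.2 i) (v.2 i) (w.2 i))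
      ((fderiv ℝ (fun z ↦ h i z (v.2 i) (w.2 i)) (u'.1, u'.2 i)) ∘L
        ((ContinuousLinearMap.fst ℝ EB (∀ i, EF i)).prod
        ((ContinuousLinearMap.proj i).comp (ContinuousLinearMap.snd ℝ EB (∀ i, EF i))))) u' :=
    fun i ↦ HasFDerivAt.comp (g := fun z ↦ h i z (v.2 i) (w.2 i)) u'
      ((((h1 i).clm_apply (differentiableAt_const _)).clm_apply
        (differentiableAt_const _)).hasFDerivAt)
      ((ContinuousLinearMap.fst ℝ EB (∀ i, EF i)).prod
        ((ContinuousLinearMap.proj i).comp (ContinuousLinearMap.snd ℝ EB (∀ i, EF i)))).hasFDerivAt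
  rw [e0, (e1.fun_add (HasFDerivAt.fun_sum fun i _ ↦ e2 i)).fderiv]
  simp [_root_.sum_apply, fderiv_bilin_const h3, fun i ↦ fderiv_bilin_const (h1 i)]

omit [DecidableEq ι] in
lemma fderiv_fderiv (hT : IsTwistedNear GB h lam u) (x y v w : EB × ∀ i, EF i) :
    fderiv ℝ (fderiv ℝ (flatTwisted GB h)) u x y v w =
      fderiv ℝ (fderiv ℝ GB) u.1 x.1 y.1 v.1 w.1
      + ∑ i, fderiv ℝ (fderiv ℝ (h i)) (u.1, u.2 i) (x.1, x.2 i) (y.1, y.2 i) (v.2 i) (w.2 i) := by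
  have h3 : DifferentiableAt ℝ (fderiv ℝ GB) u.1 := hT.base.differentiableAt_fderiv
  have h1 : ∀ i, DifferentiableAt ℝ (fderiv ℝ (h i)) (u.1, u.2 i) := fun i ↦
    ((hT.smooth i).fderiv_right (m := ∞) (by simp)).differentiableAt (by simp)
  rw [← fderiv_fderiv_bilin_const hT.contDiffAt_flatTwisted]
  have e0 : (fun u' ↦ fderiv ℝ (flatTwisted GB h) u' y v w) =ᶠ[𝓝 u] fun u' ↦
      fderiv ℝ GB u'.1 y.1 v.1 w.1
      + ∑ i, fderiv ℝ (h i) (u'.1, u'.2 i) (y.1, y.2 i) (v.2 i) (w.2 i) :=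
    hT.eventually_fderiv.mono fun u' hu ↦ hu y v w
  have e1 : HasFDerivAt (fun u' : EB × ∀ i, EF i ↦ fderiv ℝ GB u'.1 y.1 v.1 w.1)
      ((fderiv ℝ (fun p ↦ fderiv ℝ GB p y.1 v.1 w.1) u.1) ∘L
        ContinuousLinearMap.fst ℝ EB (∀ i, EF i)) u :=
    HasFDerivAt.comp (g := fun p ↦ fderiv ℝ GB p y.1 v.1 w.1) u
      ((((h3.clm_apply (differentiableAt_const _)).clm_apply (differentiableAt_const _)).clm_apply
        (differentiableAt_const _)).hasFDerivAt) hasFDerivAt_fst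
  have e2 : ∀ i, HasFDerivAt (fun u' : EB × ∀ i, EF i ↦
        fderiv ℝ (h i) (u'.1, u'.2 i) (y.1, y.2 i) (v.2 i) (w.2 i))
      ((fderiv ℝ (fun z ↦ fderiv ℝ (h i) z (y.1, y.2 i) (v.2 i) (w.2 i)) (u.1, u.2 i)) ∘L
        ((ContinuousLinearMap.fst ℝ EB (∀ i, EF i)).prod
        ((ContinuousLinearMap.proj i).comp (ContinuousLinearMap.snd ℝ EB (∀ i, EF i))))) u :=
    fun i ↦ HasFDerivAt.comp (g := fun z ↦ fderiv ℝ (h i) z (y.1, y.2 i) (v.2 i) (w.2 i)) u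
      (((((h1 i).clm_apply (differentiableAt_const _)).clm_apply
        (differentiableAt_const _)).clm_apply (differentiableAt_const _)).hasFDerivAt)
      ((ContinuousLinearMap.fst ℝ EB (∀ i, EF i)).prod
        ((ContinuousLinearMap.proj i).comp (ContinuousLinearMap.snd ℝ EB (∀ i, EF i)))).hasFDerivAt
  rw [e0.fderiv_eq, (e1.fun_add (HasFDerivAt.fun_sum fun i _ ↦ e2 i)).fderiv]
  simp [_root_.sum_apply, fderiv_fderiv_bilin_const hT.base.smooth,
    fun i ↦ fderiv_fderiv_bilin_const (hT.smooth i)]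

lemma fderiv_inBase (hT : IsTwistedNear GB h lam u) (x w : EB × ∀ i, EF i) (v : EB) :
    fderiv ℝ (flatTwisted GB h) u x (inBase EF v) w = fderiv ℝ GB u.1 x.1 v w.1 := by
  rw [hT.eventually_fderiv.self_of_nhds]
  simp [inBase]

lemma fderiv_inFiber (hT : IsTwistedNear GB h lam u) (x w : EB × ∀ i, EF i) (i : ι) (v : EF i) :
    fderiv ℝ (flatTwisted GB h) u x (inFiber EB i v) w =
      fderiv ℝ (h i) (u.1, u.2 i) (x.1, x.2 i) v (w.2 i) := by
  rw [hT.eventually_fderiv.self_of_nhds, Finset.sum_eq_single i]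
  · simp [inFiber]
  · intro j _ hj
    simp [inFiber, Pi.single_eq_of_ne hj]
  · simp

lemma fderiv_fderiv_inBase (hT : IsTwistedNear GB h lam u) (x y w : EB × ∀ i, EF i) (v : EB) :
    fderiv ℝ (fderiv ℝ (flatTwisted GB h)) u x y (inBase EF v) w =
      fderiv ℝ (fderiv ℝ GB) u.1 x.1 y.1 v w.1 := by
  rw [hT.fderiv_fderiv]
  simp [inBase]

lemma fderiv_fderiv_inFiber (hT : IsTwistedNear GB h lam u) (x y w : EB × ∀ i, EF i) (i : ι)
    (v : EF i) :
    fderiv ℝ (fderiv ℝ (flatTwisted GB h)) u x y (inFiber EB i v) w =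
      fderiv ℝ (fderiv ℝ (h i)) (u.1, u.2 i) (x.1, x.2 i) (y.1, y.2 i) v (w.2 i) := by
  rw [hT.fderiv_fderiv, Finset.sum_eq_single i]
  · simp [inFiber]
  · intro j _ hj
    simp [inFiber, Pi.single_eq_of_ne hj]
  · simp

end IsTwistedNear

end FlatTwistedProduct


/-! ### Christoffel symbols and curvature components of a twisted metric -/

section FlatTwistedCurvature

open Filter Topology

variable {EB : Type*} [NormedAddCommGroup EB] [NormedSpace ℝ EB]
  {ι : Type*} [Fintype ι] {EF : ι → Type*}
  [∀ i, NormedAddCommGroup (EF i)] [∀ i, NormedSpace ℝ (EF i)]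
  {GB : EB → EB →L[ℝ] EB →L[ℝ] ℝ}
  {h : ∀ i, EB × EF i → EF i →L[ℝ] EF i →L[ℝ] ℝ} {lam : ∀ i, EB × EF i → ℝ}
  {u : EB × ∀ i, EF i}

namespace IsTwistedNear

lemma warp_self (hT : IsTwistedNear GB h lam u) (i : ι) (x : EB) (v w : EF i) :
    fderiv ℝ (h i) (u.1, u.2 i) (x, 0) v w =
      2 * fderiv ℝ (lam i) (u.1, u.2 i) (x, 0) * h i (u.1, u.2 i) v w :=
  (hT.warp i).self_of_nhds x v w

lemma symm_self (hT : IsTwistedNear GB h lam u) (i : ι) (v w : EF i) :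
    h i (u.1, u.2 i) v w = h i (u.1, u.2 i) w v :=
  (hT.symm i).self_of_nhds v w

lemma fiber_symm (hT : IsTwistedNear GB h lam u) (i : ι) (x : EB × EF i) (v w : EF i) :
    fderiv ℝ (h i) (u.1, u.2 i) x v w = fderiv ℝ (h i) (u.1, u.2 i) x w v := by
  have hd := (hT.smooth i).eventually_differentiableAt.self_of_nhds
  rw [← fderiv_bilin_const hd, ← fderiv_bilin_const hd]
  have : (fun z ↦ h i z v w) =ᶠ[𝓝 (u.1, u.2 i)] fun z ↦ h i z w v :=
    (hT.symm i).mono fun z hz ↦ hz v w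
  rw [this.fderiv_eq]

/-- The warping equation holds near the point, so it may be differentiated in any direction `ξ`. For
`ξ` along the fibre the mixed second derivative of `lam i` enters here. -/
lemma warp_fderiv (hT : IsTwistedNear GB h lam u) (i : ι) (ξ : EB × EF i) (x : EB) (v w : EF i) :
    fderiv ℝ (fderiv ℝ (h i)) (u.1, u.2 i) ξ (x, 0) v w =
      2 * fderiv ℝ (fderiv ℝ (lam i)) (u.1, u.2 i) ξ (x, 0) * h i (u.1, u.2 i) v w
      + 2 * fderiv ℝ (lam i) (u.1, u.2 i) (x, 0) * fderiv ℝ (h i) (u.1, u.2 i) ξ v w := by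
  have hd := (hT.smooth i).eventually_differentiableAt.self_of_nhds
  have hl : DifferentiableAt ℝ (fderiv ℝ (lam i)) (u.1, u.2 i) :=
    ((hT.smooth_lam i).fderiv_right (m := ∞) (by simp)).differentiableAt (by simp)
  have hl' : DifferentiableAt ℝ (fun z ↦ fderiv ℝ (lam i) z (x, 0)) (u.1, u.2 i) :=
    hl.clm_apply (differentiableAt_const _)
  have hh : DifferentiableAt ℝ (fun z ↦ h i z v w) (u.1, u.2 i) :=
    (hd.clm_apply (differentiableAt_const _)).clm_apply (differentiableAt_const _)
  have e : (fun z ↦ fderiv ℝ (h i) z (x, 0) v w) =ᶠ[𝓝 (u.1, u.2 i)]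
      fun z ↦ 2 * fderiv ℝ (lam i) z (x, 0) * h i z v w :=
    (hT.warp i).mono fun z hz ↦ hz x v w
  rw [← fderiv_fderiv_bilin_const (hT.smooth i), e.fderiv_eq,
    fderiv_fun_mul (hl'.const_mul 2) hh, fderiv_const_mul hl',
    fderiv_clm_apply hl (differentiableAt_const _)]
  simp [fderiv_bilin_const hd]
  ring

lemma fderiv_fiber (hT : IsTwistedNear GB h lam u) (i : ι) (t v w : EF i) :
    fderiv ℝ (fun y ↦ h i (u.1, y)) (u.2 i) t v w = fderiv ℝ (h i) (u.1, u.2 i) (0, t) v w := by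
  have hd := (hT.smooth i).eventually_differentiableAt.self_of_nhds
  have := HasFDerivAt.comp (g := h i) (u.2 i) hd.hasFDerivAt (hasFDerivAt_prodMk_right u.1 (u.2 i))
  have e : fderiv ℝ (fun y ↦ h i (u.1, y)) (u.2 i) = _ := this.fderiv
  rw [e]
  simp

lemma fderiv_fderiv_fiber (hT : IsTwistedNear GB h lam u) (i : ι) (s t v w : EF i) :
    fderiv ℝ (fderiv ℝ (fun y ↦ h i (u.1, y))) (u.2 i) s t v w =
      fderiv ℝ (fderiv ℝ (h i)) (u.1, u.2 i) (0, s) (0, t) v w := by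
  have ht : Tendsto (fun y ↦ (u.1, y)) (𝓝 (u.2 i)) (𝓝 (u.1, u.2 i)) :=
    Continuous.tendsto (by fun_prop) _
  have hd' : DifferentiableAt ℝ (fderiv ℝ (h i)) (u.1, u.2 i) :=
    ((hT.smooth i).fderiv_right (m := ∞) (by simp)).differentiableAt (by simp)
  have e1 : (fun y' ↦ fderiv ℝ (fun y ↦ h i (u.1, y)) y' t v w) =ᶠ[𝓝 (u.2 i)]
      fun y' ↦ fderiv ℝ (h i) (u.1, y') (0, t) v w := by
    filter_upwards [ht.eventually (hT.smooth i).eventually_differentiableAt] with y' hd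
    have := HasFDerivAt.comp (g := h i) y' hd.hasFDerivAt (hasFDerivAt_prodMk_right u.1 y')
    have e : fderiv ℝ (fun y ↦ h i (u.1, y)) y' = _ := this.fderiv
    rw [e]
    simp
  have hd'' : DifferentiableAt ℝ (fun z ↦ fderiv ℝ (h i) z (0, t) v w) (u.1, u.2 i) :=
    ((hd'.clm_apply (differentiableAt_const _)).clm_apply (differentiableAt_const _)).clm_apply
      (differentiableAt_const _)
  have := HasFDerivAt.comp (g := fun z ↦ fderiv ℝ (h i) z (0, t) v w) (u.2 i) hd''.hasFDerivAt
    (hasFDerivAt_prodMk_right u.1 (u.2 i))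
  have e : fderiv ℝ (fun y ↦ fderiv ℝ (h i) (u.1, y) (0, t) v w) (u.2 i) = _ := this.fderiv
  rw [← fderiv_fderiv_bilin_const (hT.fiber i).smooth, e1.fderiv_eq, e]
  simp [fderiv_fderiv_bilin_const (hT.smooth i)]

variable [DecidableEq ι] [FiniteDimensional ℝ EB] [∀ i, FiniteDimensional ℝ (EF i)]

/-- The base block depends on the base point only and is orthogonal to the fibres: the base is
totally geodesic. -/
lemma christoffel_inBase (hT : IsTwistedNear GB h lam u) (x y : EB) :
    christoffel (flatTwisted GB h) u (inBase EF x) (inBase EF y) =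
      inBase EF (christoffel GB u.1 x y) := by
  refine eq_christoffel hT.isMetricNear.nondegenerate_self fun z ↦ ?_
  rw [koszulForm_apply, flatTwisted_inBase, hT.base.spec, hT.fderiv_inBase, hT.fderiv_inBase,
    hT.fderiv_inBase]
  simp [inBase]

/-- Of the three Koszul terms only the derivative of `h i` along `x` survives, and the warping
equation makes it a multiple of `h i`. -/
lemma christoffel_inBase_inFiber (hT : IsTwistedNear GB h lam u) (x : EB) (i : ι) (v : EF i) :
    christoffel (flatTwisted GB h) u (inBase EF x) (inFiber EB i v) =
      fderiv ℝ (lam i) (u.1, u.2 i) (x, 0) • inFiber EB i v := by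
  refine eq_christoffel hT.isMetricNear.nondegenerate_self fun z ↦ ?_
  rw [koszulForm_apply, map_smul, smul_apply, flatTwisted_inFiber, hT.fderiv_inFiber,
    hT.fderiv_inBase, hT.fderiv_inBase]
  simp only [inBase, inFiber, Pi.zero_apply, hT.warp_self]
  simp
  ring

lemma christoffel_inFiber_inBase (hT : IsTwistedNear GB h lam u) (x : EB) (i : ι) (v : EF i) :
    christoffel (flatTwisted GB h) u (inFiber EB i v) (inBase EF x) =
      fderiv ℝ (lam i) (u.1, u.2 i) (x, 0) • inFiber EB i v := by
  rw [hT.isMetricNear.christoffel_symm, hT.christoffel_inBase_inFiber]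

/-- The `i`-th block does not depend on the `j`-th coordinate and the two blocks are orthogonal, so
every Koszul term vanishes. -/
lemma christoffel_inFiber_of_ne (hT : IsTwistedNear GB h lam u) {i j : ι} (hij : i ≠ j) (v : EF i)
    (w : EF j) :
    christoffel (flatTwisted GB h) u (inFiber EB i v) (inFiber EB j w) = 0 := by
  refine eq_christoffel hT.isMetricNear.nondegenerate_self fun z ↦ ?_
  rw [koszulForm_apply, hT.fderiv_inFiber, hT.fderiv_inFiber, hT.fderiv_inFiber]
  simp [inFiber, Pi.single_eq_of_ne hij, Pi.single_eq_of_ne hij.symm, Prod.mk_zero_zero]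

/-- The vector `γ` represents the gradient of `lam i` along the base. The fibre is umbilic: the base
part is the second fundamental form, and the other part is the Levi-Civita connection of the induced
metric. -/
lemma christoffel_inFiber (hT : IsTwistedNear GB h lam u) (i : ι) {γ : EB}
    (hγ : ∀ x, GB u.1 γ x = fderiv ℝ (lam i) (u.1, u.2 i) (x, 0)) (v w : EF i) :
    christoffel (flatTwisted GB h) u (inFiber EB i v) (inFiber EB i w) =
      inBase EF (-(h i (u.1, u.2 i) v w) • γ) +
        inFiber EB i (christoffel (fun y ↦ h i (u.1, y)) (u.2 i) v w) := by
  refine eq_christoffel hT.isMetricNear.nondegenerate_self fun z ↦ ?_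
  have hz : ((z.1, z.2 i) : EB × EF i) = (z.1, 0) + (0, z.2 i) := by simp
  have hs := (hT.fiber i).spec v w (z.2 i)
  simp only [hT.fderiv_fiber] at hs
  rw [koszulForm_apply, map_add, add_apply, flatTwisted_inFiber, flatTwisted_inBase,
    hT.fderiv_inFiber, hT.fderiv_inFiber, hT.fderiv_inFiber, mul_add, hs, hz]
  simp only [map_add, add_apply, hT.warp_self, map_smul, smul_apply, hγ]
  simp [inFiber]
  ring

lemma exists_gradient_lam (hT : IsTwistedNear GB h lam u) (i : ι) :
    ∃ γ : EB, ∀ x, GB u.1 γ x = fderiv ℝ (lam i) (u.1, u.2 i) (x, 0) := by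
  have h1 := (isInvertible_of_nondegenerate (GB u.1) hT.base.nondegenerate_self).self_comp_inverse
  have h2 := DFunLike.congr_fun h1
    ((fderiv ℝ (lam i) (u.1, u.2 i)).comp (ContinuousLinearMap.inl ℝ EB (EF i)))
  exact ⟨_, fun x ↦ by simpa using DFunLike.congr_fun h2 x⟩

/-- Pair symmetry is visible in `apply_curvatureTensor`, whose right-hand side is symmetric in `x`
and `y`. It yields the symmetry of the Levi-Civita Ricci tensor. -/
lemma _root_.QuarterSymmetric.IsMetricNear.apply_curvature_symm {E : Type*}
    [NormedAddCommGroup E] [NormedSpace ℝ E]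
    [FiniteDimensional ℝ E] {G : E → E →L[ℝ] E →L[ℝ] ℝ} {u : E} (hG : IsMetricNear G u)
    (x e y : E) :
    G u (curvatureTensor (christoffel G) u x e y) e =
      G u (curvatureTensor (christoffel G) u y e x) e := by
  rw [hG.apply_curvatureTensor, hG.apply_curvatureTensor, hG.christoffel_symm x y,
    hG.fderiv_fderiv_comm x y, hG.fderiv_fderiv_symm e e x y,
    hG.symm_self (christoffel G u e y) (christoffel G u x e), hG.christoffel_symm x e,
    hG.christoffel_symm e y]
  ring

/-- Curvature components: all directions tangent to the base. -/
lemma curvature_base_base_base (hT : IsTwistedNear GB h lam u) (x y e : EB) :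
    flatTwisted GB h u (curvatureTensor (christoffel (flatTwisted GB h)) u
        (inBase EF x) (inBase EF e) (inBase EF y)) (inBase EF e) =
      GB u.1 (curvatureTensor (christoffel GB) u.1 x e y) e := by
  rw [hT.isMetricNear.apply_curvatureTensor, hT.base.apply_curvatureTensor]
  simp only [hT.christoffel_inBase, flatTwisted_inBase, hT.fderiv_fderiv_inBase]
  simp [inBase]

/-- Half the second derivative of `h s` contributes `D²λ + 2 Dλ Dλ`, the product of the mixed
Christoffel symbols takes away one `Dλ Dλ`, and the second fundamental form paired with `Γ(x, y)`
gives `-Dλ(Γ(x, y))`. -/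
lemma curvature_base_base_fiber (hT : IsTwistedNear GB h lam u) (x y : EB) (s : ι) (t : EF s) :
    flatTwisted GB h u (curvatureTensor (christoffel (flatTwisted GB h)) u
        (inBase EF x) (inFiber EB s t) (inBase EF y)) (inFiber EB s t) =
      h s (u.1, u.2 s) t t *
        (fderiv ℝ (fderiv ℝ (lam s)) (u.1, u.2 s) (x, 0) (y, 0)
          + fderiv ℝ (lam s) (u.1, u.2 s) (x, 0) * fderiv ℝ (lam s) (u.1, u.2 s) (y, 0)
          - fderiv ℝ (lam s) (u.1, u.2 s) (christoffel GB u.1 x y, 0)) := by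
  obtain ⟨γ, hγ⟩ := hT.exists_gradient_lam s
  rw [hT.isMetricNear.apply_curvatureTensor]
  simp only [hT.christoffel_inBase, hT.christoffel_inBase_inFiber, hT.christoffel_inFiber_inBase,
    hT.christoffel_inFiber s hγ, flatTwisted_inBase, flatTwisted_inFiber, hT.fderiv_fderiv_inBase,
    hT.fderiv_fderiv_inFiber, map_smul, smul_apply, map_add, add_apply]
  rw [hT.base.symm_self]
  simp [inBase, inFiber, hT.warp_fderiv, hT.warp_self, hγ]
  ring

/-- Each second derivative is off the diagonal blocks or differentiates `GB` along a fibre, and each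
product pairs a base vector with a fibre vector. -/
lemma curvature_base_fiber_base (hT : IsTwistedNear GB h lam u) (x e : EB) (i : ι) (w : EF i) :
    flatTwisted GB h u (curvatureTensor (christoffel (flatTwisted GB h)) u
        (inBase EF x) (inBase EF e) (inFiber EB i w)) (inBase EF e) = 0 := by
  rw [hT.isMetricNear.apply_curvatureTensor, hT.isMetricNear.fderiv_fderiv_symm _ _ (inBase EF x)]
  simp only [hT.christoffel_inBase, hT.christoffel_inBase_inFiber, flatTwisted_inBase,
    flatTwisted_inFiber, hT.fderiv_fderiv_inBase, hT.fderiv_fderiv_inFiber, map_smul, smul_apply]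
  simp [inBase, inFiber]

lemma curvature_base_fiber_of_ne (hT : IsTwistedNear GB h lam u) (x : EB) {i s : ι} (his : i ≠ s)
    (w : EF i) (t : EF s) :
    flatTwisted GB h u (curvatureTensor (christoffel (flatTwisted GB h)) u
        (inBase EF x) (inFiber EB s t) (inFiber EB i w)) (inFiber EB s t) = 0 := by
  obtain ⟨γ, hγ⟩ := hT.exists_gradient_lam s
  rw [hT.isMetricNear.apply_curvatureTensor]
  simp only [hT.christoffel_inFiber_of_ne his.symm, hT.christoffel_inBase_inFiber,
    hT.christoffel_inFiber s hγ, flatTwisted_inBase,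
    flatTwisted_inFiber, hT.fderiv_fderiv_inBase, hT.fderiv_fderiv_inFiber, map_smul, smul_apply,
    map_add, add_apply]
  simp [inBase, inFiber, Pi.single_eq_of_ne his, Pi.single_eq_of_ne his.symm, Prod.mk_zero_zero]

/-- A Codazzi-type identity. The mixed derivative of `lam i` is the obstruction to a warped product:
it vanishes when `lam i` is a function on the base plus a function on the fibre. -/
lemma curvature_base_fiber_self (hT : IsTwistedNear GB h lam u) (x : EB) (i : ι) (w t : EF i) :
    flatTwisted GB h u (curvatureTensor (christoffel (flatTwisted GB h)) u
        (inBase EF x) (inFiber EB i t) (inFiber EB i w)) (inFiber EB i t) =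
      h i (u.1, u.2 i) t t * fderiv ℝ (fderiv ℝ (lam i)) (u.1, u.2 i) (0, w) (x, 0)
      - fderiv ℝ (fderiv ℝ (lam i)) (u.1, u.2 i) (0, t) (x, 0) * h i (u.1, u.2 i) w t := by
  obtain ⟨γ, hγ⟩ := hT.exists_gradient_lam i
  -- What multiplies `dλ(x)` consists of fibre derivatives of `h i` and fibre Christoffel symbols;
  -- the Koszul identities of the fibre make it vanish.
  have e1 := (hT.fiber i).spec t t w
  have e2 := (hT.fiber i).spec t w t
  simp only [hT.fderiv_fiber] at e1 e2
  have e3 := hT.symm_self i w (christoffel (fun y ↦ h i (u.1, y)) (u.2 i) t t)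
  have e4 := hT.fiber_symm i (0, t) w t
  rw [hT.isMetricNear.apply_curvatureTensor, hT.isMetricNear.fderiv_fderiv_comm (inBase EF x)]
  simp only [hT.christoffel_inBase_inFiber, hT.christoffel_inFiber i hγ, flatTwisted_inBase,
    flatTwisted_inFiber, hT.fderiv_fderiv_inBase, hT.fderiv_fderiv_inFiber, map_smul, smul_apply,
    map_add, add_apply]
  simp [inBase, inFiber, hT.warp_fderiv, e3, smul_eq_mul, Prod.mk_zero_zero]
  linear_combination fderiv ℝ (lam i) (u.1, u.2 i) (x, 0) *
    ((1 / 2) * e1 - (1 / 2) * e2 - (3 / 2) * e4)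

lemma curvature_fiber_fiber_base (hT : IsTwistedNear GB h lam u) (i : ι) (v w : EF i) (e : EB) :
    flatTwisted GB h u (curvatureTensor (christoffel (flatTwisted GB h)) u
        (inFiber EB i v) (inBase EF e) (inFiber EB i w)) (inBase EF e) =
      h i (u.1, u.2 i) v w *
        (fderiv ℝ (fderiv ℝ (lam i)) (u.1, u.2 i) (e, 0) (e, 0)
          + fderiv ℝ (lam i) (u.1, u.2 i) (e, 0) * fderiv ℝ (lam i) (u.1, u.2 i) (e, 0)
          - fderiv ℝ (lam i) (u.1, u.2 i) (christoffel GB u.1 e e, 0)) := by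
  obtain ⟨γ, hγ⟩ := hT.exists_gradient_lam i
  rw [hT.isMetricNear.apply_curvatureTensor]
  simp only [hT.christoffel_inBase, hT.christoffel_inBase_inFiber, hT.christoffel_inFiber_inBase,
    hT.christoffel_inFiber i hγ, flatTwisted_inBase, flatTwisted_inFiber, hT.fderiv_fderiv_inBase,
    hT.fderiv_fderiv_inFiber, map_smul, smul_apply, map_add, add_apply]
  simp [inBase, inFiber, hT.warp_fderiv, hT.warp_self, hγ, hT.symm_self i w v, Prod.mk_zero_zero]
  ring

lemma curvature_fiber_fiber_base_of_ne (hT : IsTwistedNear GB h lam u) {i j : ι} (hij : i ≠ j)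
    (v : EF i) (w : EF j) (e : EB) :
    flatTwisted GB h u (curvatureTensor (christoffel (flatTwisted GB h)) u
        (inFiber EB i v) (inBase EF e) (inFiber EB j w)) (inBase EF e) = 0 := by
  rw [hT.isMetricNear.apply_curvatureTensor]
  simp only [hT.christoffel_inBase_inFiber, hT.christoffel_inFiber_inBase,
    hT.christoffel_inFiber_of_ne hij, flatTwisted_inBase, flatTwisted_inFiber,
    hT.fderiv_fderiv_inBase, hT.fderiv_fderiv_inFiber, map_smul, smul_apply, map_zero, zero_apply]
  simp [inBase, inFiber, Pi.single_eq_of_ne hij, Pi.single_eq_of_ne hij.symm, Prod.mk_zero_zero]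

/-- The second derivatives vanish, as no block depends on two fibres. The product of the second
fundamental forms of the two fibres remains. -/
lemma curvature_fiber_fiber_of_ne (hT : IsTwistedNear GB h lam u) {i s : ι} (his : i ≠ s)
    {γ γ' : EB} (hγ : ∀ x, GB u.1 γ x = fderiv ℝ (lam i) (u.1, u.2 i) (x, 0))
    (hγ' : ∀ x, GB u.1 γ' x = fderiv ℝ (lam s) (u.1, u.2 s) (x, 0)) (v w : EF i) (t : EF s) :
    flatTwisted GB h u (curvatureTensor (christoffel (flatTwisted GB h)) u
        (inFiber EB i v) (inFiber EB s t) (inFiber EB i w)) (inFiber EB s t) =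
      h i (u.1, u.2 i) v w * (h s (u.1, u.2 s) t t * GB u.1 γ γ') := by
  rw [hT.isMetricNear.apply_curvatureTensor]
  simp only [hT.christoffel_inFiber_of_ne his, hT.christoffel_inFiber_of_ne his.symm,
    hT.christoffel_inFiber i hγ, hT.christoffel_inFiber s hγ', flatTwisted_inBase,
    flatTwisted_inFiber, hT.fderiv_fderiv_inBase, hT.fderiv_fderiv_inFiber, map_smul, smul_apply,
    map_add, add_apply, map_zero, zero_apply]
  simp [inBase, inFiber, Pi.single_eq_of_ne his, Pi.single_eq_of_ne his.symm, Prod.mk_zero_zero]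

/-- This is the Gauss equation for an umbilic fibre. Both curvatures are expanded by
`apply_curvatureTensor`; their second derivatives agree, and the base parts of the Christoffel
symbols leave the terms in `γ`. -/
lemma curvature_fiber_fiber_self (hT : IsTwistedNear GB h lam u) (i : ι) {γ : EB}
    (hγ : ∀ x, GB u.1 γ x = fderiv ℝ (lam i) (u.1, u.2 i) (x, 0)) (v w t : EF i) :
    flatTwisted GB h u (curvatureTensor (christoffel (flatTwisted GB h)) u
        (inFiber EB i v) (inFiber EB i t) (inFiber EB i w)) (inFiber EB i t) =
      h i (u.1, u.2 i) (curvatureTensor (christoffel fun y ↦ h i (u.1, y)) (u.2 i) v t w) t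
      + (h i (u.1, u.2 i) v w * h i (u.1, u.2 i) t t
        - h i (u.1, u.2 i) t w * h i (u.1, u.2 i) v t) * GB u.1 γ γ := by
  have e1 := (hT.fiber i).apply_curvatureTensor v t w
  simp only [hT.fderiv_fderiv_fiber] at e1
  rw [e1, hT.isMetricNear.apply_curvatureTensor]
  simp only [hT.christoffel_inFiber i hγ, flatTwisted_inBase,
    flatTwisted_inFiber, hT.fderiv_fderiv_inBase, hT.fderiv_fderiv_inFiber, map_smul, smul_apply,
    map_add, add_apply]
  simp [inBase, inFiber, Prod.mk_zero_zero]
  ring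

lemma curvature_fiber_fiber_fiber_of_ne (hT : IsTwistedNear GB h lam u) {i j : ι} (hij : i ≠ j)
    (v : EF i) (w : EF j) (s : ι) (t : EF s) :
    flatTwisted GB h u (curvatureTensor (christoffel (flatTwisted GB h)) u
        (inFiber EB i v) (inFiber EB s t) (inFiber EB j w)) (inFiber EB s t) = 0 := by
  rw [hT.isMetricNear.apply_curvatureTensor]
  -- In either case one factor of each product of Christoffel symbols vanishes; `s = j` is covered
  -- by the second case.
  by_cases his : i = s
  · subst his
    simp only [hT.christoffel_inFiber_of_ne hij, flatTwisted_inFiber, hT.fderiv_fderiv_inBase,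
      hT.fderiv_fderiv_inFiber, map_zero, zero_apply]
    simp [inFiber, Pi.single_eq_of_ne hij, Pi.single_eq_of_ne hij.symm, Prod.mk_zero_zero]
  · simp only [hT.christoffel_inFiber_of_ne hij, hT.christoffel_inFiber_of_ne his,
      flatTwisted_inFiber, hT.fderiv_fderiv_inBase,
      hT.fderiv_fderiv_inFiber, map_zero, zero_apply]
    simp [inFiber, Pi.single_eq_of_ne hij, Pi.single_eq_of_ne his, Prod.mk_zero_zero,
      Pi.single_eq_of_ne (Ne.symm hij), Pi.single_eq_of_ne (Ne.symm his)]

end IsTwistedNear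

end FlatTwistedCurvature


/-! ### The Ricci tensor of a twisted metric over an adapted frame -/

section FlatTwistedRicci

open Filter Topology

variable {EB : Type*} [NormedAddCommGroup EB] [NormedSpace ℝ EB]
  {ι : Type*} [Fintype ι] {EF : ι → Type*}
  [∀ i, NormedAddCommGroup (EF i)] [∀ i, NormedSpace ℝ (EF i)]
  {GB : EB → EB →L[ℝ] EB →L[ℝ] ℝ}
  {h : ∀ i, EB × EF i → EF i →L[ℝ] EF i →L[ℝ] ℝ} {lam : ∀ i, EB × EF i → ℝ}
  {u : EB × ∀ i, EF i}

/-- The contribution `D²λ(x, y) + Dλ(x) Dλ(y) - Dλ(Γ(x, y))` of a warping function `exp λ` to the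
curvature; it is the quotient of its Hessian by the function. -/
noncomputable def warpHessian {E : Type*} [NormedAddCommGroup E] [NormedSpace ℝ E]
    (GB : EB → EB →L[ℝ] EB →L[ℝ] ℝ) (lam : EB × E → ℝ) (z : EB × E) (x y : EB) : ℝ :=
  fderiv ℝ (fderiv ℝ lam) z (x, 0) (y, 0) + fderiv ℝ lam z (x, 0) * fderiv ℝ lam z (y, 0)
    - fderiv ℝ lam z (christoffel GB z.1 x y, 0)

variable [DecidableEq ι] 

/-- The frame of the product composed of frames of the base and of the fibres. -/
noncomputable def adaptedFrame {κ : Type*} {κF : ι → Type*} (eB : κ → EB)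
    (eF : ∀ i, κF i → EF i) : κ ⊕ (Σ i, κF i) → EB × ∀ i, EF i :=
  Sum.elim (fun a ↦ IsTwistedNear.inBase EF (eB a)) fun k ↦
    IsTwistedNear.inFiber EB k.1 (eF k.1 k.2)

namespace IsTwistedNear

variable {κ : Type*} {κF : ι → Type*} {eB : κ → EB} {eF : ∀ i, κF i → EF i}

lemma flatTwisted_inBase_inBase (x y : EB) :
    flatTwisted GB h u (inBase EF x) (inBase EF y) = GB u.1 x y :=
  flatTwisted_inBase u x _

lemma flatTwisted_inFiber_inFiber (i : ι) (v w : EF i) :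
    flatTwisted GB h u (inFiber EB i v) (inFiber EB i w) = h i (u.1, u.2 i) v w := by
  rw [flatTwisted_inFiber]
  simp [inFiber]

lemma isOrthonormalFamily (heB : IsOrthonormalFamily (GB u.1) eB)
    (heF : ∀ i, IsOrthonormalFamily (h i (u.1, u.2 i)) (eF i)) :
    IsOrthonormalFamily (flatTwisted GB h u) (adaptedFrame eB eF) := by
  refine ⟨?_, ?_⟩
  · rintro (a | ⟨i, k⟩) (b | ⟨j, l⟩) hkl
    · simpa only [adaptedFrame, Sum.elim_inl, flatTwisted_inBase_inBase] using
        heB.orthogonal a b (fun hab ↦ hkl (by rw [hab]))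
    · simp [adaptedFrame, flatTwisted_inBase, inFiber]
    · simp [adaptedFrame, flatTwisted_inFiber, inBase]
    · simp only [adaptedFrame, Sum.elim_inr, flatTwisted_inFiber]
      by_cases hij : i = j
      · subst hij
        simpa [inFiber] using (heF i).orthogonal k l (fun hab ↦ hkl (by rw [hab]))
      · simp [inFiber, Pi.single_eq_of_ne hij]
  · rintro (a | ⟨i, k⟩)
    · simpa only [adaptedFrame, Sum.elim_inl, flatTwisted_inBase_inBase] using heB.unit a
    · simpa only [adaptedFrame, Sum.elim_inr, flatTwisted_inFiber_inFiber] using (heF i).unit k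

variable [Fintype κ] [∀ i, Fintype (κF i)]
variable [FiniteDimensional ℝ EB] [∀ i, FiniteDimensional ℝ (EF i)]

lemma finrank_prod_pi : finrank ℝ (EB × ∀ i, EF i) = finrank ℝ EB + ∑ i, finrank ℝ (EF i) := by
  rw [Module.finrank_prod, Module.finrank_pi_fintype]

lemma card_adaptedFrame (hB : Fintype.card κ = finrank ℝ EB)
    (hF : ∀ i, Fintype.card (κF i) = finrank ℝ (EF i)) :
    Fintype.card (κ ⊕ (Σ i, κF i)) = finrank ℝ (EB × ∀ i, EF i) := by
  rw [finrank_prod_pi, Fintype.card_sum, Fintype.card_sigma, hB]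
  simp [hF]

lemma sum_adaptedFrame (T : (EB × ∀ i, EF i) → ℝ) :
    ∑ k, flatTwisted GB h u (adaptedFrame eB eF k) (adaptedFrame eB eF k) * T (adaptedFrame eB eF k)
      = ∑ a, GB u.1 (eB a) (eB a) * T (inBase EF (eB a))
        + ∑ i, ∑ k, h i (u.1, u.2 i) (eF i k) (eF i k) * T (inFiber EB i (eF i k)) := by
  rw [Fintype.sum_sum_type, Fintype.sum_sigma]
  simp only [adaptedFrame, Sum.elim_inl, Sum.elim_inr, flatTwisted_inBase_inBase,
    flatTwisted_inFiber_inFiber]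

/-- Each fibre direction `t` contributes `h(t,t)` times the same Hessian quotient, so fibre `s`
contributes it as many times as its dimension. -/
lemma flatRicci_base_base (hT : IsTwistedNear GB h lam u)
    (heF : ∀ i, IsOrthonormalFamily (h i (u.1, u.2 i)) (eF i))
    (hF : ∀ i, Fintype.card (κF i) = finrank ℝ (EF i)) (x y : EB) :
    flatRicci (flatTwisted GB h) (christoffel (flatTwisted GB h)) (adaptedFrame eB eF) u
        (inBase EF x) (inBase EF y) =
      flatRicci GB (christoffel GB) eB u.1 x y
      + ∑ s, (finrank ℝ (EF s) : ℝ) * warpHessian GB (lam s) (u.1, u.2 s) x y := by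
  rw [flatRicci, sum_adaptedFrame (T := fun e ↦ flatTwisted GB h u (curvatureTensor
    (christoffel (flatTwisted GB h)) u (inBase EF x) e (inBase EF y)) e)]
  simp only [hT.curvature_base_base_base, hT.curvature_base_base_fiber, flatRicci]
  congr 1
  refine Finset.sum_congr rfl fun s _ ↦ ?_
  simp only [← mul_assoc, ← Finset.sum_mul, (heF s).sum_one, hF s, warpHessian]

/-- Only the fibre of `w` contributes. In `curvature_base_fiber_self` the first term is counted once
for each frame vector and the second contracts against `w` to a single copy, hence the dimension
minus one. -/
lemma flatRicci_base_fiber (hT : IsTwistedNear GB h lam u)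
    (heF : ∀ i, IsOrthonormalFamily (h i (u.1, u.2 i)) (eF i))
    (hF : ∀ i, Fintype.card (κF i) = finrank ℝ (EF i)) (x : EB) (i : ι) (w : EF i) :
    flatRicci (flatTwisted GB h) (christoffel (flatTwisted GB h)) (adaptedFrame eB eF) u
        (inBase EF x) (inFiber EB i w) =
      (finrank ℝ (EF i) - 1) * fderiv ℝ (fderiv ℝ (lam i)) (u.1, u.2 i) (0, w) (x, 0) := by
  rw [flatRicci, sum_adaptedFrame (T := fun e ↦ flatTwisted GB h u (curvatureTensor
    (christoffel (flatTwisted GB h)) u (inBase EF x) e (inFiber EB i w)) e)]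
  simp only [hT.curvature_base_fiber_base, mul_zero, Finset.sum_const_zero, zero_add]
  rw [Finset.sum_eq_single i]
  · simp only [hT.curvature_base_fiber_self, mul_sub, Finset.sum_sub_distrib]
    have h1 := (heF i).sum_linear (hF i) w (((fderiv ℝ (fderiv ℝ (lam i)) (u.1, u.2 i)).flip (x, 0))
      ∘L (ContinuousLinearMap.inr ℝ EB (EF i)))
    simp only [ContinuousLinearMap.comp_apply, ContinuousLinearMap.flip_apply,
      ContinuousLinearMap.inr_apply] at h1
    rw [h1]
    simp only [← mul_assoc, ← Finset.sum_mul, (heF i).sum_one, hF i]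
    ring
  · intro s _ hs
    simp [hT.curvature_base_fiber_of_ne x hs.symm]
  · simp

lemma flatRicci_symm {E : Type*} [NormedAddCommGroup E] [NormedSpace ℝ E] [FiniteDimensional ℝ E]
    {G : E → E →L[ℝ] E →L[ℝ] ℝ} {u : E} (hG : IsMetricNear G u) (e : κ → E) (x y : E) :
    flatRicci G (christoffel G) e u x y = flatRicci G (christoffel G) e u y x := by
  simp only [flatRicci, hG.apply_curvature_symm x _ y]

lemma flatRicci_fiber_fiber_of_ne (hT : IsTwistedNear GB h lam u) {i j : ι} (hij : i ≠ j)
    (v : EF i) (w : EF j) :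
    flatRicci (flatTwisted GB h) (christoffel (flatTwisted GB h)) (adaptedFrame eB eF) u
        (inFiber EB i v) (inFiber EB j w) = 0 := by
  rw [flatRicci, sum_adaptedFrame (T := fun e ↦ flatTwisted GB h u (curvatureTensor
    (christoffel (flatTwisted GB h)) u (inFiber EB i v) e (inFiber EB j w)) e)]
  simp [hT.curvature_fiber_fiber_base_of_ne hij, hT.curvature_fiber_fiber_fiber_of_ne hij]

lemma flatRicci_fiber_fiber (hT : IsTwistedNear GB h lam u)
    (heF : ∀ i, IsOrthonormalFamily (h i (u.1, u.2 i)) (eF i))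
    (hF : ∀ i, Fintype.card (κF i) = finrank ℝ (EF i)) {γ : ι → EB}
    (hγ : ∀ i x, GB u.1 (γ i) x = fderiv ℝ (lam i) (u.1, u.2 i) (x, 0)) (i : ι) (v w : EF i) :
    flatRicci (flatTwisted GB h) (christoffel (flatTwisted GB h)) (adaptedFrame eB eF) u
        (inFiber EB i v) (inFiber EB i w) =
      flatRicci (fun y ↦ h i (u.1, y)) (christoffel fun y ↦ h i (u.1, y)) (eF i) (u.2 i) v w
      + h i (u.1, u.2 i) v w *
        (∑ a, GB u.1 (eB a) (eB a) * warpHessian GB (lam i) (u.1, u.2 i) (eB a) (eB a)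
        + (finrank ℝ (EF i) - 1) * GB u.1 (γ i) (γ i)
        + ∑ s ∈ Finset.univ.erase i, (finrank ℝ (EF s) : ℝ) * GB u.1 (γ i) (γ s)) := by
  rw [flatRicci, sum_adaptedFrame (T := fun e ↦ flatTwisted GB h u (curvatureTensor
    (christoffel (flatTwisted GB h)) u (inFiber EB i v) e (inFiber EB i w)) e),
    ← Finset.add_sum_erase _ _ (Finset.mem_univ i)]
  -- The other fibres contribute the products of two different gradients.
  have h1 : ∑ s ∈ Finset.univ.erase i, ∑ k, h s (u.1, u.2 s) (eF s k) (eF s k) *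
      flatTwisted GB h u (curvatureTensor (christoffel (flatTwisted GB h)) u (inFiber EB i v)
        (inFiber EB s (eF s k)) (inFiber EB i w)) (inFiber EB s (eF s k)) =
      h i (u.1, u.2 i) v w *
        ∑ s ∈ Finset.univ.erase i, (finrank ℝ (EF s) : ℝ) * GB u.1 (γ i) (γ s) := by
    rw [Finset.mul_sum]
    refine Finset.sum_congr rfl fun s hs ↦ ?_
    simp only [hT.curvature_fiber_fiber_of_ne (Finset.ne_of_mem_erase hs).symm (hγ i) (hγ s)]
    rw [← hF s, ← (heF s).sum_one, Finset.sum_mul, Finset.mul_sum]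
    exact Finset.sum_congr rfl fun k _ ↦ by ring
  -- The same fibre contributes its own Ricci tensor and, by the Gauss equation, the squared
  -- gradient with factor dimension minus one.
  have h2 : ∑ k, h i (u.1, u.2 i) (eF i k) (eF i k) *
      flatTwisted GB h u (curvatureTensor (christoffel (flatTwisted GB h)) u (inFiber EB i v)
        (inFiber EB i (eF i k)) (inFiber EB i w)) (inFiber EB i (eF i k)) =
      flatRicci (fun y ↦ h i (u.1, y)) (christoffel fun y ↦ h i (u.1, y)) (eF i) (u.2 i) v w
      + h i (u.1, u.2 i) v w * ((finrank ℝ (EF i) - 1) * GB u.1 (γ i) (γ i)) := by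
    simp only [hT.curvature_fiber_fiber_self i (hγ i), mul_add, Finset.sum_add_distrib, flatRicci]
    congr 1
    have e1 := (heF i).sum_linear (hF i) v (h i (u.1, u.2 i) w)
    have e2 := (heF i).sum_one
    rw [hF i] at e2
    have e3 : ∑ k, h i (u.1, u.2 i) (eF i k) (eF i k) *
        ((h i (u.1, u.2 i) v w * h i (u.1, u.2 i) (eF i k) (eF i k) -
          h i (u.1, u.2 i) (eF i k) w * h i (u.1, u.2 i) v (eF i k)) * GB u.1 (γ i) (γ i)) =
        (h i (u.1, u.2 i) v w * ∑ k, h i (u.1, u.2 i) (eF i k) (eF i k) *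
          h i (u.1, u.2 i) (eF i k) (eF i k) - ∑ k, h i (u.1, u.2 i) (eF i k) (eF i k) *
          (h i (u.1, u.2 i) w (eF i k) * h i (u.1, u.2 i) v (eF i k))) * GB u.1 (γ i) (γ i) := by
      rw [Finset.mul_sum, ← Finset.sum_sub_distrib, Finset.sum_mul]
      refine Finset.sum_congr rfl fun k _ ↦ ?_
      rw [hT.symm_self i w]
      ring
    rw [e3, e1, e2, hT.symm_self i w v]
    ring
  -- The base directions trace the Hessian quotient to the Laplacian quotient.
  have h3 : ∑ a, GB u.1 (eB a) (eB a) *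
      flatTwisted GB h u (curvatureTensor (christoffel (flatTwisted GB h)) u (inFiber EB i v)
        (inBase EF (eB a)) (inFiber EB i w)) (inBase EF (eB a)) =
      h i (u.1, u.2 i) v w *
        ∑ a, GB u.1 (eB a) (eB a) * warpHessian GB (lam i) (u.1, u.2 i) (eB a) (eB a) := by
    rw [Finset.mul_sum]
    refine Finset.sum_congr rfl fun a _ ↦ ?_
    rw [hT.curvature_fiber_fiber_base, warpHessian]
    ring
  rw [h1, h2, h3]
  ring

/-! ### Covariant derivatives of a field tangent to one fibre -/

section Field

variable {r : ι} {P : EF r → EF r}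

lemma hasFDerivAt_fiberField (hP : DifferentiableAt ℝ P (u.2 r)) :
    HasFDerivAt (fun u' : EB × ∀ i, EF i ↦ inFiber EB r (P (u'.2 r)))
      ((ContinuousLinearMap.inr ℝ EB (∀ i, EF i)) ∘L (ContinuousLinearMap.single ℝ EF r) ∘L
        (fderiv ℝ P (u.2 r)) ∘L (ContinuousLinearMap.proj r) ∘L
        (ContinuousLinearMap.snd ℝ EB (∀ i, EF i))) u := by
  have h1 := HasFDerivAt.comp (g := P) (f := fun u' : EB × ∀ i, EF i ↦ u'.2 r) u hP.hasFDerivAt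
    ((ContinuousLinearMap.proj r) ∘L (ContinuousLinearMap.snd ℝ EB (∀ i, EF i))).hasFDerivAt
  exact HasFDerivAt.comp (g := ((ContinuousLinearMap.inr ℝ EB (∀ i, EF i)) ∘L
    (ContinuousLinearMap.single ℝ EF r))) u (ContinuousLinearMap.hasFDerivAt _) h1

lemma fderiv_fiberField (hP : DifferentiableAt ℝ P (u.2 r)) (x : EB × ∀ i, EF i) :
    fderiv ℝ (fun u' : EB × ∀ i, EF i ↦ inFiber EB r (P (u'.2 r))) u x =
      inFiber EB r (fderiv ℝ P (u.2 r) (x.2 r)) := by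
  rw [(hasFDerivAt_fiberField hP).fderiv]
  rfl

/-- The covariant derivative along `x` of the lift of the field `P` on the `r`-th fibre. -/
noncomputable def covDerivLift (GB : EB → EB →L[ℝ] EB →L[ℝ] ℝ)
    (h : ∀ i, EB × EF i → EF i →L[ℝ] EF i →L[ℝ] ℝ) (u : EB × ∀ i, EF i) {r : ι}
    (P : EF r → EF r) (x : EB × ∀ i, EF i) : EB × ∀ i, EF i :=
  fderiv ℝ (fun u' : EB × ∀ i, EF i ↦ inFiber EB r (P (u'.2 r))) u x
    + christoffel (flatTwisted GB h) u x (inFiber EB r (P (u.2 r)))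

lemma covDerivLift_inBase (hT : IsTwistedNear GB h lam u) (hP : DifferentiableAt ℝ P (u.2 r))
    (x : EB) : covDerivLift GB h u P (inBase EF x) =
      fderiv ℝ (lam r) (u.1, u.2 r) (x, 0) • inFiber EB r (P (u.2 r)) := by
  rw [covDerivLift, fderiv_fiberField hP, hT.christoffel_inBase_inFiber]
  simp [inBase, inFiber]

lemma covDerivLift_of_ne (hT : IsTwistedNear GB h lam u) (hP : DifferentiableAt ℝ P (u.2 r))
    {i : ι} (hi : i ≠ r) (v : EF i) : covDerivLift GB h u P (inFiber EB i v) = 0 := by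
  rw [covDerivLift, fderiv_fiberField hP, hT.christoffel_inFiber_of_ne hi]
  simp [inFiber, Pi.single_eq_of_ne hi.symm]

lemma base_covDerivLift (hT : IsTwistedNear GB h lam u) (hP : DifferentiableAt ℝ P (u.2 r))
    (x y : EB) : flatTwisted GB h u (inBase EF y) (covDerivLift GB h u P (inBase EF x)) = 0 := by
  rw [hT.covDerivLift_inBase hP, flatTwisted_inBase]
  simp [inFiber]

lemma fiber_covDerivLift_base (hT : IsTwistedNear GB h lam u)
    (hP : DifferentiableAt ℝ P (u.2 r)) (x : EB) (i : ι) (w : EF i) :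
    flatTwisted GB h u (inFiber EB i w) (covDerivLift GB h u P (inBase EF x)) =
      flatTwisted GB h u (inFiber EB i w) (inFiber EB r (P (u.2 r)))
        * fderiv ℝ (lam r) (u.1, u.2 r) (x, 0) := by
  rw [hT.covDerivLift_inBase hP, map_smul, smul_eq_mul, mul_comm]

/-- Since `g(X, P) = 0`, compatibility gives `g(X, ∇_V P) = -g(∇_V X, P)`. The minus sign here,
against the plus in `fiber_covDerivLift_base`, separates the two mixed Ricci components. -/
lemma base_covDerivLift_fiber (hT : IsTwistedNear GB h lam u)
    (hP : DifferentiableAt ℝ P (u.2 r)) (x : EB) (i : ι) (v : EF i) :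
    flatTwisted GB h u (inBase EF x) (covDerivLift GB h u P (inFiber EB i v)) =
      -(flatTwisted GB h u (inFiber EB i v) (inFiber EB r (P (u.2 r)))
        * fderiv ℝ (lam r) (u.1, u.2 r) (x, 0)) := by
  by_cases hi : i = r
  · subst hi
    obtain ⟨γ, hγ⟩ := hT.exists_gradient_lam i
    rw [covDerivLift, fderiv_fiberField hP, hT.christoffel_inFiber i hγ, flatTwisted_inBase,
      flatTwisted_inFiber]
    simp [inBase, inFiber, hT.base.symm_self x γ, hγ]
  · rw [hT.covDerivLift_of_ne hP hi, flatTwisted_inFiber]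
    simp [inFiber, Pi.single_eq_of_ne hi]

lemma fiber_covDerivLift_of_ne (hT : IsTwistedNear GB h lam u)
    (hP : DifferentiableAt ℝ P (u.2 r)) {i j : ι} (hij : i ≠ j) (v : EF i) (w : EF j) :
    flatTwisted GB h u (inFiber EB j w) (covDerivLift GB h u P (inFiber EB i v)) = 0 := by
  by_cases hi : i = r
  · subst hi
    obtain ⟨γ, hγ⟩ := hT.exists_gradient_lam i
    rw [covDerivLift, fderiv_fiberField hP, hT.christoffel_inFiber i hγ, flatTwisted_inFiber]
    simp [inBase, inFiber, Pi.single_eq_of_ne hij.symm]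
  · rw [hT.covDerivLift_of_ne hP hi, map_zero]

/-- The divergence of the lift of a field on a fibre is its divergence along that fibre. -/
lemma divergence_lift (hT : IsTwistedNear GB h lam u) (hP : DifferentiableAt ℝ P (u.2 r)) :
    ∑ k, flatTwisted GB h u (adaptedFrame eB eF k) (adaptedFrame eB eF k) *
        flatTwisted GB h u (covDerivLift GB h u P (adaptedFrame eB eF k)) (adaptedFrame eB eF k) =
      ∑ k, h r (u.1, u.2 r) (eF r k) (eF r k) * flatTwisted GB h u
        (covDerivLift GB h u P (inFiber EB r (eF r k))) (inFiber EB r (eF r k)) := by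
  rw [sum_adaptedFrame (T := fun e ↦ flatTwisted GB h u (covDerivLift GB h u P e) e)]
  have h1 : ∀ x, flatTwisted GB h u (covDerivLift GB h u P (inBase EF x)) (inBase EF x) = 0 := by
    intro x
    rw [hT.isMetricNear.symm_self, hT.base_covDerivLift hP]
  rw [Finset.sum_eq_single r]
  · simp [h1]
  · intro i _ hi
    simp [hT.covDerivLift_of_ne hP hi]
  · simp

end Field

end IsTwistedNear

end FlatTwistedRicci


/-! ### Vector fields, directional derivatives and brackets in a chart -/

section LocalRepresentatives

open Filter Topology

variable {E : Type*} [NormedAddCommGroup E] [NormedSpace ℝ E]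
  {H : Type*} [TopologicalSpace H] {I : ModelWithCorners ℝ E H}
  {M : Type*} [TopologicalSpace M] [ChartedSpace H M]

variable (I) in
/-- The derivative at `y` of the extended chart at `x₀`. -/
noncomputable def chartDeriv (x₀ y : M) : TangentSpace I y →L[ℝ] E :=
  mfderiv I 𝓘(ℝ, E) (extChartAt I x₀) y

variable (I) in
/-- The inverse of the derivative at `y` of the extended chart at `x₀`. -/
noncomputable def chartDerivSymm (x₀ y : M) : E →L[ℝ] TangentSpace I y :=
  (chartDeriv I x₀ y).inverse

variable (I) in
/-- The coordinate representative of the vector field `X` in the chart at `x₀`. -/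
noncomputable def fieldRep (x₀ : M) (X : Π x : M, TangentSpace I x) : E → E :=
  fun u ↦ chartDeriv I x₀ ((extChartAt I x₀).symm u) (X ((extChartAt I x₀).symm u))

variable {x₀ y : M} {X Y Z : Π x : M, TangentSpace I x}

lemma fieldRep_extChartAt (hy : y ∈ (extChartAt I x₀).source) :
    fieldRep I x₀ X (extChartAt I x₀ y) = chartDeriv I x₀ y (X y) := by
  rw [fieldRep, (extChartAt I x₀).left_inv hy]

variable [hM : IsManifold I ∞ M]

lemma chartDeriv_isInvertible (hy : y ∈ (extChartAt I x₀).source) :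
    (chartDeriv I x₀ y).IsInvertible :=
  isInvertible_mfderiv_extChartAt hy

lemma chartDeriv_chartDerivSymm (hy : y ∈ (extChartAt I x₀).source) (v : E) :
    chartDeriv I x₀ y (chartDerivSymm I x₀ y v) = v :=
  DFunLike.congr_fun (chartDeriv_isInvertible hy).self_comp_inverse v

lemma chartDerivSymm_chartDeriv (hy : y ∈ (extChartAt I x₀).source) (v : TangentSpace I y) :
    chartDerivSymm I x₀ y (chartDeriv I x₀ y v) = v :=
  DFunLike.congr_fun (chartDeriv_isInvertible hy).inverse_comp_self v

/-- Smoothness of a field is defined through the tangent bundle; this identifies its local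
expression there with `fieldRep`. -/
lemma trivializationAt_eq_chartDeriv (hy : y ∈ (extChartAt I x₀).source) (v : TangentSpace I y) :
    (trivializationAt E (TangentSpace I) x₀ ⟨y, v⟩).2 = chartDeriv I x₀ y v := by
  rw [extChartAt_source] at hy
  have h1 := TangentBundle.continuousLinearMapAt_trivializationAt (I := I) hy
  rw [← Bundle.Trivialization.continuousLinearMapAt_apply_of_mem (R := ℝ)
    (trivializationAt E (TangentSpace I) x₀) (by simpa using hy) v]
  exact DFunLike.congr_fun h1 v

variable [I.Boundaryless]

lemma extChartAt_symm_contMDiffAt {u : E} (hu : u ∈ (extChartAt I x₀).target) :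
    ContMDiffAt 𝓘(ℝ, E) I ∞ (extChartAt I x₀).symm u :=
  (contMDiffOn_extChartAt_symm (I := I) (n := ∞) x₀).contMDiffAt
    ((isOpen_extChartAt_target x₀).mem_nhds hu)

lemma extChartAt_contMDiffAt_of_mem (hy : y ∈ (extChartAt I x₀).source) :
    ContMDiffAt I 𝓘(ℝ, E) ∞ (extChartAt I x₀) y :=
  contMDiffAt_extChartAt' (by simpa using hy)

lemma tendsto_symm (hy : y ∈ (extChartAt I x₀).source) :
    Tendsto (extChartAt I x₀).symm (𝓝 (extChartAt I x₀ y)) (𝓝 y) := by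
  have h := continuousAt_extChartAt_symm' hy
  rwa [ContinuousAt, (extChartAt I x₀).left_inv hy] at h

lemma tendsto_extChartAt (hy : y ∈ (extChartAt I x₀).source) :
    Tendsto (extChartAt I x₀) (𝓝 y) (𝓝 (extChartAt I x₀ y)) :=
  continuousAt_extChartAt' hy

lemma eventually_source (hy : y ∈ (extChartAt I x₀).source) :
    ∀ᶠ z in 𝓝 y, z ∈ (extChartAt I x₀).source :=
  (isOpen_extChartAt_source x₀).mem_nhds hy

lemma section_eventuallyEq (hy : y ∈ (extChartAt I x₀).source) :
    (fun z ↦ (trivializationAt E (TangentSpace I) x₀ ⟨z, X z⟩).2) =ᶠ[𝓝 y]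
      fun z ↦ fieldRep I x₀ X (extChartAt I x₀ z) := by
  filter_upwards [eventually_source hy] with z hz
  rw [fieldRep_extChartAt hz, trivializationAt_eq_chartDeriv hz]

/-- Both directions serve: fields pass to coordinates, and test fields built in coordinates must be
admissible in the definition of `leviCivita`. -/
lemma mdifferentiableAt_iff_fieldRep (hy : y ∈ (extChartAt I x₀).source) :
    MDifferentiableAt I I.tangent (fun z ↦ (⟨z, X z⟩ : TangentBundle I M)) y ↔
      DifferentiableAt ℝ (fieldRep I x₀ X) (extChartAt I x₀ y) := by
  rw [Bundle.Trivialization.mdifferentiableAt_section_iff I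
    (trivializationAt E (TangentSpace I) x₀) X (by simpa using hy),
    (section_eventuallyEq hy).mdifferentiableAt_iff, ← mdifferentiableAt_iff_differentiableAt]
  constructor
  · intro h
    have hu := (extChartAt I x₀).map_source hy
    have h2 : MDifferentiableAt 𝓘(ℝ, E) I (extChartAt I x₀).symm (extChartAt I x₀ y) :=
      (extChartAt_symm_contMDiffAt hu).mdifferentiableAt (by simp)
    have h3 := MDifferentiableAt.comp_of_eq (x := extChartAt I x₀ y) h h2
      ((extChartAt I x₀).left_inv hy)
    refine h3.congr_of_eventuallyEq ?_
    filter_upwards [(isOpen_extChartAt_target x₀).mem_nhds hu] with v hv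
    exact (congrArg (fieldRep I x₀ X) ((extChartAt I x₀).right_inv hv)).symm
  · intro h
    exact h.comp y ((extChartAt_contMDiffAt_of_mem hy).mdifferentiableAt (by simp))

lemma contDiffAt_fieldRep (hy : y ∈ (extChartAt I x₀).source)
    (hX : ContMDiffAt I I.tangent ∞ (fun z ↦ (⟨z, X z⟩ : TangentBundle I M)) y) :
    ContDiffAt ℝ ∞ (fieldRep I x₀ X) (extChartAt I x₀ y) := by
  rw [Bundle.Trivialization.contMDiffAt_section_iff
    (trivializationAt E (TangentSpace I) x₀) (by simpa using hy)] at hX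
  rw [← contMDiffAt_iff_contDiffAt]
  have hu := (extChartAt I x₀).map_source hy
  have h := (hX.congr_of_eventuallyEq (section_eventuallyEq hy).symm)
  have h3 := ContMDiffAt.comp_of_eq (x := extChartAt I x₀ y) h (extChartAt_symm_contMDiffAt hu)
      ((extChartAt I x₀).left_inv hy)
  refine h3.congr_of_eventuallyEq ?_
  filter_upwards [(isOpen_extChartAt_target x₀).mem_nhds hu] with v hv
  exact (congrArg (fieldRep I x₀ X) ((extChartAt I x₀).right_inv hv)).symm

/-- The derivative of a function along a field in coordinates. -/
lemma dirDeriv_eq (hy : y ∈ (extChartAt I x₀).source) {f : M → ℝ} {φ : E → ℝ}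
    (hf : f =ᶠ[𝓝 y] fun z ↦ φ (extChartAt I x₀ z))
    (hφ : DifferentiableAt ℝ φ (extChartAt I x₀ y)) :
    dirDeriv I X f y = fderiv ℝ φ (extChartAt I x₀ y) (fieldRep I x₀ X (extChartAt I x₀ y)) := by
  have h1 : mfderiv I 𝓘(ℝ, ℝ) f y = mfderiv I 𝓘(ℝ, ℝ) (φ ∘ extChartAt I x₀) y := hf.mfderiv_eq
  have h2 := mfderiv_comp y hφ.mdifferentiableAt
    ((extChartAt_contMDiffAt_of_mem hy).mdifferentiableAt (by simp))
  rw [fieldRep_extChartAt hy]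
  change mfderiv I 𝓘(ℝ, ℝ) f y (X y) = _
  rw [h1, h2, mfderiv_eq_fderiv]
  rfl

lemma mlieBracket_model_space {V W : Π x : E, TangentSpace 𝓘(ℝ, E) x} {V' W' : E → E} {u : E}
    (hV : ∀ᶠ x in 𝓝 u, V x = V' x) (hW : ∀ᶠ x in 𝓝 u, W x = W' x) :
    VectorField.mlieBracket 𝓘(ℝ, E) V W u = fderiv ℝ W' u (V' u) - fderiv ℝ V' u (W' u) := by
  have h1 : VectorField.mlieBracket 𝓘(ℝ, E) V W u = VectorField.lieBracketWithin ℝ V W Set.univ u :=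
    congrFun (VectorField.mlieBracketWithin_eq_lieBracketWithin (V := V) (W := W)) u
  have h2 : VectorField.lieBracketWithin (E := E) ℝ V W Set.univ u =
      VectorField.lieBracket ℝ V W u :=
    congrFun VectorField.lieBracketWithin_univ u
  have h3 : VectorField.lieBracket (E := E) ℝ V W u = VectorField.lieBracket ℝ V' W' u :=
    Filter.EventuallyEq.lieBracket_vectorField_eq hV hW
  exact h1.trans (h2.trans h3)

/-- The Lie bracket in coordinates. -/
lemma chartDeriv_mlieBracket [FiniteDimensional ℝ E] (hy : y ∈ (extChartAt I x₀).source)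
    (hX : DifferentiableAt ℝ (fieldRep I x₀ X) (extChartAt I x₀ y))
    (hY : DifferentiableAt ℝ (fieldRep I x₀ Y) (extChartAt I x₀ y)) :
    chartDeriv I x₀ y (VectorField.mlieBracket I X Y y) =
      fderiv ℝ (fieldRep I x₀ Y) (extChartAt I x₀ y) (fieldRep I x₀ X (extChartAt I x₀ y))
      - fderiv ℝ (fieldRep I x₀ X) (extChartAt I x₀ y) (fieldRep I x₀ Y (extChartAt I x₀ y)) := by
  have := FiniteDimensional.complete ℝ E
  have : IsManifold I (minSmoothness ℝ 2) M := IsManifold.of_le (n := ∞)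
    (by simp only [minSmoothness_of_isRCLikeNormedField]; exact WithTop.coe_le_coe.2 le_top)
  have hu := (extChartAt I x₀).map_source hy
  have hly := (extChartAt I x₀).left_inv hy
  rw [← mdifferentiableAt_iff_fieldRep hy] at hX hY
  -- The derivative of the inverse chart has inverse `chartDeriv`, so pulling a field back along the
  -- inverse chart gives its representative. Naturality of the bracket then reduces the claim to the
  -- model space.
  have key : ∀ u ∈ (extChartAt I x₀).target, ∀ V : Π x : M, TangentSpace I x,
      VectorField.mpullback 𝓘(ℝ, E) I (extChartAt I x₀).symm V u = fieldRep I x₀ V u := by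
    intro u hu V
    have h1 := mfderivWithin_extChartAt_symm_comp_mfderiv_extChartAt hu
    have h2 := mfderiv_extChartAt_comp_mfderivWithin_extChartAt_symm hu
    rw [I.range_eq_univ, mfderivWithin_univ] at h1 h2
    have h3 := ContinuousLinearMap.inverse_eq h1 h2
    rw [VectorField.mpullback_apply, h3]
    rfl
  have h := VectorField.mpullback_mlieBracket (I := 𝓘(ℝ, E)) (I' := I) (n := ∞)
    (f := (extChartAt I x₀).symm) (x₀ := extChartAt I x₀ y) (V := X) (W := Y)
    (by rw [hly]; exact hX) (by rw [hly]; exact hY) (extChartAt_symm_contMDiffAt hu)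
    (by simp only [minSmoothness_of_isRCLikeNormedField]; exact WithTop.coe_le_coe.2 le_top)
  rw [key _ hu, fieldRep_extChartAt hy] at h
  have e : ∀ V : Π x : M, TangentSpace I x, ∀ᶠ v in 𝓝 (extChartAt I x₀ y),
      VectorField.mpullback 𝓘(ℝ, E) I (extChartAt I x₀).symm V v = fieldRep I x₀ V v := by
    intro V
    filter_upwards [(isOpen_extChartAt_target x₀).mem_nhds hu] with v hv
    exact key v hv V
  exact h.trans (mlieBracket_model_space (e X) (e Y))

end LocalRepresentatives


/-! ### Levi-Civita connection, curvature, Hessian and gradient in a chart -/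

section LocalConnections

open Filter Topology

variable {E : Type*} [NormedAddCommGroup E] [NormedSpace ℝ E] [FiniteDimensional ℝ E]
  {H : Type*} [TopologicalSpace H] {I : ModelWithCorners ℝ E H} [I.Boundaryless]
  {M : Type*} [TopologicalSpace M] [ChartedSpace H M] [IsManifold I ∞ M]

variable (I) in
/-- In the chart at `x₀`, the metric `g` is given near `x₀` by `G`. -/
def IsMetricRep (x₀ : M) (g : Π x : M, TangentSpace I x →L[ℝ] TangentSpace I x →L[ℝ] ℝ)
    (G : E → E →L[ℝ] E →L[ℝ] ℝ) : Prop :=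
  ∀ᶠ y in 𝓝 x₀, ∀ v w : TangentSpace I y,
    g y v w = G (extChartAt I x₀ y) (chartDeriv I x₀ y v) (chartDeriv I x₀ y w)

/-- In the chart at `x₀`, the connection `D` is given near `x₀` by the coefficients `A`. -/
def IsConnectionRep (x₀ : M)
    (D : (Π x : M, TangentSpace I x) → (Π x : M, TangentSpace I x) → Π x : M, TangentSpace I x)
    (A : E → E →L[ℝ] E →L[ℝ] E) : Prop :=
  ∀ᶠ y in 𝓝 x₀, ∀ X Y : Π x : M, TangentSpace I x,
    DifferentiableAt ℝ (fieldRep I x₀ X) (extChartAt I x₀ y) →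
    DifferentiableAt ℝ (fieldRep I x₀ Y) (extChartAt I x₀ y) →
    chartDeriv I x₀ y (D X Y y) =
      fderiv ℝ (fieldRep I x₀ Y) (extChartAt I x₀ y) (fieldRep I x₀ X (extChartAt I x₀ y))
      + A (extChartAt I x₀ y) (fieldRep I x₀ X (extChartAt I x₀ y))
        (fieldRep I x₀ Y (extChartAt I x₀ y))

variable {x₀ y : M} {X Y Z : Π x : M, TangentSpace I x}
  {g : Π x : M, TangentSpace I x →L[ℝ] TangentSpace I x →L[ℝ] ℝ} {G : E → E →L[ℝ] E →L[ℝ] ℝ}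

lemma dirDeriv_metric (hy : y ∈ (extChartAt I x₀).source)
    (hg : ∀ᶠ z in 𝓝 y, ∀ v w : TangentSpace I z,
      g z v w = G (extChartAt I x₀ z) (chartDeriv I x₀ z v) (chartDeriv I x₀ z w))
    (hG : DifferentiableAt ℝ G (extChartAt I x₀ y))
    (hY : DifferentiableAt ℝ (fieldRep I x₀ Y) (extChartAt I x₀ y))
    (hZ : DifferentiableAt ℝ (fieldRep I x₀ Z) (extChartAt I x₀ y)) :
    dirDeriv I X (fun z ↦ g z (Y z) (Z z)) y =
      fderiv ℝ G (extChartAt I x₀ y) (fieldRep I x₀ X (extChartAt I x₀ y))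
        (fieldRep I x₀ Y (extChartAt I x₀ y)) (fieldRep I x₀ Z (extChartAt I x₀ y))
      + G (extChartAt I x₀ y)
        (fderiv ℝ (fieldRep I x₀ Y) (extChartAt I x₀ y) (fieldRep I x₀ X (extChartAt I x₀ y)))
        (fieldRep I x₀ Z (extChartAt I x₀ y))
      + G (extChartAt I x₀ y) (fieldRep I x₀ Y (extChartAt I x₀ y))
        (fderiv ℝ (fieldRep I x₀ Z) (extChartAt I x₀ y)
          (fieldRep I x₀ X (extChartAt I x₀ y))) := by
  rw [dirDeriv_eq (x₀ := x₀) hy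
    (φ := fun u ↦ G u (fieldRep I x₀ Y u) (fieldRep I x₀ Z u)) ?_
    ((hG.clm_apply hY).clm_apply hZ), fderiv_bilin_apply hG hY hZ]
  filter_upwards [hg, eventually_source hy] with z hz hz'
  rw [hz, fieldRep_extChartAt hz', fieldRep_extChartAt hz']

/-- The brackets cancel all derivatives of the fields except `DY(X)`, which occurs twice; the
derivatives of the metric form `koszulForm`. -/
lemma koszul_eq (hy : y ∈ (extChartAt I x₀).source)
    (hg : ∀ᶠ z in 𝓝 y, ∀ v w : TangentSpace I z,
      g z v w = G (extChartAt I x₀ z) (chartDeriv I x₀ z v) (chartDeriv I x₀ z w))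
    (hG : DifferentiableAt ℝ G (extChartAt I x₀ y))
    (hsymm : ∀ v w, G (extChartAt I x₀ y) v w = G (extChartAt I x₀ y) w v)
    (hnd : ∀ v, (∀ w, G (extChartAt I x₀ y) v w = 0) → v = 0)
    (hX : DifferentiableAt ℝ (fieldRep I x₀ X) (extChartAt I x₀ y))
    (hY : DifferentiableAt ℝ (fieldRep I x₀ Y) (extChartAt I x₀ y))
    (hZ : DifferentiableAt ℝ (fieldRep I x₀ Z) (extChartAt I x₀ y)) :
    koszul I g X Y Z y = 2 * G (extChartAt I x₀ y)
      (fderiv ℝ (fieldRep I x₀ Y) (extChartAt I x₀ y) (fieldRep I x₀ X (extChartAt I x₀ y))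
        + christoffel G (extChartAt I x₀ y) (fieldRep I x₀ X (extChartAt I x₀ y))
          (fieldRep I x₀ Y (extChartAt I x₀ y))) (fieldRep I x₀ Z (extChartAt I x₀ y)) := by
  have hgy := hg.self_of_nhds
  rw [koszul, dirDeriv_metric hy hg hG hY hZ, dirDeriv_metric hy hg hG hX hZ,
    dirDeriv_metric hy hg hG hX hY, hgy, hgy, hgy, chartDeriv_mlieBracket hy hX hY,
    chartDeriv_mlieBracket hy hX hZ, chartDeriv_mlieBracket hy hY hZ, map_add, add_apply, mul_add,
    christoffel_spec hnd, koszulForm_apply, ← fieldRep_extChartAt hy, ← fieldRep_extChartAt hy,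
    ← fieldRep_extChartAt hy]
  simp only [map_sub, sub_apply]
  rw [hsymm (fieldRep I x₀ Y (extChartAt I x₀ y)) (fderiv ℝ (fieldRep I x₀ Z) _ _),
    hsymm (fieldRep I x₀ X (extChartAt I x₀ y)) (fderiv ℝ (fieldRep I x₀ Z) _ _),
    hsymm (fieldRep I x₀ X (extChartAt I x₀ y)) (fderiv ℝ (fieldRep I x₀ Y) _ _)]
  ring

lemma fieldRep_const_eventuallyEq (hy : y ∈ (extChartAt I x₀).source) (v : E) :
    fieldRep I x₀ (fun z ↦ chartDerivSymm I x₀ z v) =ᶠ[𝓝 (extChartAt I x₀ y)] fun _ ↦ v := by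
  filter_upwards [(isOpen_extChartAt_target x₀).mem_nhds ((extChartAt I x₀).map_source hy)]
    with u hu
  exact chartDeriv_chartDerivSymm ((extChartAt I x₀).map_target hu) v

/-- The Levi-Civita connection in coordinates. -/
lemma isConnectionRep_leviCivita (hg : IsMetricRep I x₀ g G)
    (hG : IsMetricNear G (extChartAt I x₀ x₀)) :
    IsConnectionRep x₀ (leviCivita I g) (christoffel G) := by
  have hx₀ := mem_extChartAt_source (I := I) x₀
  filter_upwards [eventually_source hx₀, eventually_eventually_nhds.2 hg,
    (tendsto_extChartAt hx₀).eventually hG.eventually] with y hy hgy hGy X Y hX hY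
  obtain ⟨hd, hsymm, hnd, -⟩ := hGy
  have hk := fun Z ↦ koszul_eq (Z := Z) hy hgy hd hsymm hnd hX hY
  set a := fderiv ℝ (fieldRep I x₀ Y) (extChartAt I x₀ y) (fieldRep I x₀ X (extChartAt I x₀ y))
      + christoffel G (extChartAt I x₀ y) (fieldRep I x₀ X (extChartAt I x₀ y))
        (fieldRep I x₀ Y (extChartAt I x₀ y)) with ha
  -- The coordinate expression solves the Koszul equation, so `leviCivita` takes a solution and not
  -- its default value `0`.
  have hex : ∃ w : TangentSpace I y, ∀ Z : Π z : M, TangentSpace I z,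
      MDifferentiableAt I I.tangent (fun z ↦ (⟨z, Z z⟩ : TangentBundle I M)) y →
        2 * g y w (Z y) = koszul I g X Y Z y := by
    refine ⟨chartDerivSymm I x₀ y a, fun Z hZ ↦ ?_⟩
    rw [hk Z ((mdifferentiableAt_iff_fieldRep hy).1 hZ), hgy.self_of_nhds,
      chartDeriv_chartDerivSymm hy, fieldRep_extChartAt hy]
  have hlc : leviCivita I g X Y y = hex.choose := by
    rw [leviCivita, dif_pos hex]
  have hs := hex.choose_spec
  rw [← hlc] at hs
  rw [← sub_eq_zero]
  -- Uniqueness: the chosen solution is tested against the field whose representative is the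
  -- constant `v`.
  refine hnd _ fun v ↦ ?_
  have hc := fieldRep_const_eventuallyEq hy v
  have hcd : DifferentiableAt ℝ (fieldRep I x₀ fun z ↦ chartDerivSymm I x₀ z v)
      (extChartAt I x₀ y) := (differentiableAt_const v).congr_of_eventuallyEq hc
  have h1 := hs (fun z ↦ chartDerivSymm I x₀ z v) ((mdifferentiableAt_iff_fieldRep hy).2 hcd)
  rw [hk _ hcd, hgy.self_of_nhds, hc.self_of_nhds, chartDeriv_chartDerivSymm hy] at h1
  rw [map_sub, sub_apply]
  linarith

/-- The quarter-symmetric connection in coordinates. -/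
lemma isConnectionRep_quarterSymmetric (hg : IsMetricRep I x₀ g G)
    (hG : IsMetricNear G (extChartAt I x₀ x₀)) (P : Π x : M, TangentSpace I x) (lam₁ lam₂ : ℝ) :
    IsConnectionRep x₀ (quarterSymmetric I g P lam₁ lam₂)
      (quarterCoeff G (fieldRep I x₀ P) lam₁ lam₂) := by
  filter_upwards [eventually_source (mem_extChartAt_source (I := I) x₀), hg,
    isConnectionRep_leviCivita hg hG] with y hy hgy hlc X Y hX hY
  rw [quarterSymmetric, map_sub, map_add, map_smul, map_smul, hlc X Y hX hY, hgy, hgy,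
    quarterCoeff_apply]
  simp only [fieldRep_extChartAt hy]
  abel

/-- The curvature in coordinates. -/
lemma chartDeriv_curvature
    {D : (Π x : M, TangentSpace I x) → (Π x : M, TangentSpace I x) → Π x : M, TangentSpace I x}
    {A : E → E →L[ℝ] E →L[ℝ] E} (hD : IsConnectionRep x₀ D A)
    (hA : DifferentiableAt ℝ A (extChartAt I x₀ x₀))
    (hX : ContDiffAt ℝ ∞ (fieldRep I x₀ X) (extChartAt I x₀ x₀))
    (hZ : ContDiffAt ℝ ∞ (fieldRep I x₀ Z) (extChartAt I x₀ x₀))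
    (hY : ContDiffAt ℝ ∞ (fieldRep I x₀ Y) (extChartAt I x₀ x₀)) :
    chartDeriv I x₀ x₀ (curvature D X Z Y x₀) =
      curvatureTensor A (extChartAt I x₀ x₀) (fieldRep I x₀ X (extChartAt I x₀ x₀))
        (fieldRep I x₀ Z (extChartAt I x₀ x₀)) (fieldRep I x₀ Y (extChartAt I x₀ x₀)) := by
  have hx₀ := mem_extChartAt_source (I := I) x₀
  have hu₀ := (extChartAt I x₀).map_source hx₀
  have hD0 := hD.self_of_nhds
  have hX1 := hX.differentiableAt (by simp)
  have hZ1 := hZ.differentiableAt (by simp)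
  have hY1 := hY.differentiableAt (by simp)
  -- The representative of `D V Y` is needed on a neighbourhood, because the outer covariant
  -- derivative differentiates it.
  have hrep : ∀ V : Π x : M, TangentSpace I x,
      ContDiffAt ℝ ∞ (fieldRep I x₀ V) (extChartAt I x₀ x₀) →
      fieldRep I x₀ (D V Y) =ᶠ[𝓝 (extChartAt I x₀ x₀)] fun u ↦
        fderiv ℝ (fieldRep I x₀ Y) u (fieldRep I x₀ V u)
          + A u (fieldRep I x₀ V u) (fieldRep I x₀ Y u) := by
    intro V hV
    filter_upwards [(tendsto_symm hx₀).eventually hD, (isOpen_extChartAt_target x₀).mem_nhds hu₀,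
      hV.eventually_differentiableAt, hY.eventually_differentiableAt] with u h1 hu h2 h3
    have h := h1 V Y
    rw [(extChartAt I x₀).right_inv hu] at h
    exact h h2 h3
  have hdY : DifferentiableAt ℝ (fderiv ℝ (fieldRep I x₀ Y)) (extChartAt I x₀ x₀) :=
    (hY.fderiv_right (m := ∞) (by simp)).differentiableAt (by simp)
  have hdiff : ∀ V : Π x : M, TangentSpace I x,
      ContDiffAt ℝ ∞ (fieldRep I x₀ V) (extChartAt I x₀ x₀) →
      DifferentiableAt ℝ (fieldRep I x₀ (D V Y)) (extChartAt I x₀ x₀) := by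
    intro V hV
    have hV1 := hV.differentiableAt (by simp)
    exact ((hdY.clm_apply hV1).add ((hA.clm_apply hV1).clm_apply hY1)).congr_of_eventuallyEq
      (hrep V hV)
  have hbr : fieldRep I x₀ (VectorField.mlieBracket I X Z) =ᶠ[𝓝 (extChartAt I x₀ x₀)] fun u ↦
      fderiv ℝ (fieldRep I x₀ Z) u (fieldRep I x₀ X u)
        - fderiv ℝ (fieldRep I x₀ X) u (fieldRep I x₀ Z u) := by
    filter_upwards [(isOpen_extChartAt_target x₀).mem_nhds hu₀,
      hX.eventually_differentiableAt, hZ.eventually_differentiableAt] with u hu h2 h3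
    have hy := (extChartAt I x₀).map_target hu
    have hr := (extChartAt I x₀).right_inv hu
    have h := chartDeriv_mlieBracket (X := X) (Y := Z) hy (by rw [hr]; exact h2)
      (by rw [hr]; exact h3)
    rwa [hr] at h
  have hdX : DifferentiableAt ℝ (fderiv ℝ (fieldRep I x₀ X)) (extChartAt I x₀ x₀) :=
    (hX.fderiv_right (m := ∞) (by simp)).differentiableAt (by simp)
  have hdZ : DifferentiableAt ℝ (fderiv ℝ (fieldRep I x₀ Z)) (extChartAt I x₀ x₀) :=
    (hZ.fderiv_right (m := ∞) (by simp)).differentiableAt (by simp)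
  have hbd : DifferentiableAt ℝ (fieldRep I x₀ (VectorField.mlieBracket I X Z))
      (extChartAt I x₀ x₀) :=
    ((hdZ.clm_apply hX1).sub (hdX.clm_apply hZ1)).congr_of_eventuallyEq hbr
  rw [curvature, map_sub, map_sub, hD0 X (D Z Y) hX1 (hdiff Z hZ), hD0 Z (D X Y) hZ1 (hdiff X hX),
    hD0 _ Y hbd hY1, (hrep Z hZ).fderiv_eq, (hrep X hX).fderiv_eq, (hrep Z hZ).self_of_nhds,
    (hrep X hX).self_of_nhds, hbr.self_of_nhds]
  exact fderiv_connection_comm hA hX1 hZ1 (hY.of_le (WithTop.coe_le_coe.2 le_top))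

/-- The Ricci tensor in coordinates. -/
lemma ricci_eq_flatRicci
    {D : (Π x : M, TangentSpace I x) → (Π x : M, TangentSpace I x) → Π x : M, TangentSpace I x}
    {A : E → E →L[ℝ] E →L[ℝ] E} (hg : IsMetricRep I x₀ g G) (hD : IsConnectionRep x₀ D A)
    (hA : DifferentiableAt ℝ A (extChartAt I x₀ x₀))
    {e : Fin (finrank ℝ E) → Π x : M, TangentSpace I x}
    (he : ∀ k, ContDiffAt ℝ ∞ (fieldRep I x₀ (e k)) (extChartAt I x₀ x₀))
    (hX : ContDiffAt ℝ ∞ (fieldRep I x₀ X) (extChartAt I x₀ x₀))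
    (hY : ContDiffAt ℝ ∞ (fieldRep I x₀ Y) (extChartAt I x₀ x₀)) :
    ricci g D e X Y x₀ = flatRicci G A (fun k ↦ fieldRep I x₀ (e k) (extChartAt I x₀ x₀))
      (extChartAt I x₀ x₀) (fieldRep I x₀ X (extChartAt I x₀ x₀))
      (fieldRep I x₀ Y (extChartAt I x₀ x₀)) := by
  have hx₀ := mem_extChartAt_source (I := I) x₀
  have hgx := hg.self_of_nhds
  rw [ricci, flatRicci]
  refine Finset.sum_congr rfl fun k _ ↦ ?_
  rw [hgx, hgx, chartDeriv_curvature hD hA hX (he k) hY, ← fieldRep_extChartAt hx₀]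

lemma isOrthonormalFamily_fieldRep (hg : IsMetricRep I x₀ g G)
    {e : Fin (finrank ℝ E) → Π x : M, TangentSpace I x} (he : IsOrthonormalFrameAt g e x₀) :
    IsOrthonormalFamily (G (extChartAt I x₀ x₀))
      (fun k ↦ fieldRep I x₀ (e k) (extChartAt I x₀ x₀)) := by
  have hx₀ := mem_extChartAt_source (I := I) x₀
  have h : ∀ k l, G (extChartAt I x₀ x₀) (fieldRep I x₀ (e k) (extChartAt I x₀ x₀))
      (fieldRep I x₀ (e l) (extChartAt I x₀ x₀)) = g x₀ (e k x₀) (e l x₀) := by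
    intro k l
    rw [hg.self_of_nhds, fieldRep_extChartAt hx₀, fieldRep_extChartAt hx₀]
  exact ⟨fun k l hkl ↦ by rw [h]; exact he.orthogonal k l hkl,
    fun k ↦ by simp only [h]; exact he.unit k⟩

lemma dirDeriv_dirDeriv_eq {f : M → ℝ} {φ : E → ℝ}
    (hf : f =ᶠ[𝓝 x₀] fun z ↦ φ (extChartAt I x₀ z))
    (hφ : ContDiffAt ℝ ∞ φ (extChartAt I x₀ x₀))
    (hY : DifferentiableAt ℝ (fieldRep I x₀ Y) (extChartAt I x₀ x₀)) :
    dirDeriv I X (dirDeriv I Y f) x₀ =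
      fderiv ℝ (fderiv ℝ φ) (extChartAt I x₀ x₀) (fieldRep I x₀ X (extChartAt I x₀ x₀))
        (fieldRep I x₀ Y (extChartAt I x₀ x₀))
      + fderiv ℝ φ (extChartAt I x₀ x₀) (fderiv ℝ (fieldRep I x₀ Y) (extChartAt I x₀ x₀)
        (fieldRep I x₀ X (extChartAt I x₀ x₀))) := by
  have hx₀ := mem_extChartAt_source (I := I) x₀
  have hd : DifferentiableAt ℝ (fderiv ℝ φ) (extChartAt I x₀ x₀) :=
    (hφ.fderiv_right (m := ∞) (by simp)).differentiableAt (by simp)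
  have h1 : dirDeriv I Y f =ᶠ[𝓝 x₀] fun z ↦
      (fun u ↦ fderiv ℝ φ u (fieldRep I x₀ Y u)) (extChartAt I x₀ z) := by
    filter_upwards [eventually_source hx₀, eventually_eventually_nhds.2 hf,
      (tendsto_extChartAt hx₀).eventually hφ.eventually_differentiableAt] with z hz hfz hφz
    exact dirDeriv_eq hz hfz hφz
  rw [dirDeriv_eq hx₀ h1 (hd.clm_apply hY), fderiv_clm_apply hd hY]
  simp [add_comm]

/-- The Hessian in coordinates. -/
lemma hessian_eq (hg : IsMetricRep I x₀ g G) (hG : IsMetricNear G (extChartAt I x₀ x₀))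
    {f : M → ℝ} {φ : E → ℝ} (hf : f =ᶠ[𝓝 x₀] fun z ↦ φ (extChartAt I x₀ z))
    (hφ : ContDiffAt ℝ ∞ φ (extChartAt I x₀ x₀))
    (hX : DifferentiableAt ℝ (fieldRep I x₀ X) (extChartAt I x₀ x₀))
    (hY : DifferentiableAt ℝ (fieldRep I x₀ Y) (extChartAt I x₀ x₀)) :
    hessian I g f X Y x₀ =
      fderiv ℝ (fderiv ℝ φ) (extChartAt I x₀ x₀) (fieldRep I x₀ X (extChartAt I x₀ x₀))
        (fieldRep I x₀ Y (extChartAt I x₀ x₀))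
      - fderiv ℝ φ (extChartAt I x₀ x₀) (christoffel G (extChartAt I x₀ x₀)
        (fieldRep I x₀ X (extChartAt I x₀ x₀)) (fieldRep I x₀ Y (extChartAt I x₀ x₀))) := by
  have hx₀ := mem_extChartAt_source (I := I) x₀
  rw [hessian, dirDeriv_dirDeriv_eq hf hφ hY, dirDeriv_eq hx₀ hf (hφ.differentiableAt (by simp)),
    fieldRep_extChartAt (X := leviCivita I g X Y) hx₀,
    (isConnectionRep_leviCivita hg hG).self_of_nhds X Y hX hY, map_add]
  ring

/-- The gradient in coordinates. -/
lemma metric_chartDeriv_gradient (hg : IsMetricRep I x₀ g G)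
    (hG : IsMetricNear G (extChartAt I x₀ x₀))
    {f : M → ℝ} {φ : E → ℝ} (hf : f =ᶠ[𝓝 x₀] fun z ↦ φ (extChartAt I x₀ z))
    (hφ : DifferentiableAt ℝ φ (extChartAt I x₀ x₀)) (v : E) :
    G (extChartAt I x₀ x₀) (chartDeriv I x₀ x₀ (gradient I g f x₀)) v =
      fderiv ℝ φ (extChartAt I x₀ x₀) v := by
  have hx₀ := mem_extChartAt_source (I := I) x₀
  have hgx := hg.self_of_nhds
  -- `gradient` uses `inverse`, which is zero at a map that is not invertible, so invertibility of
  -- `g x₀` has to be derived from nondegeneracy of `G`.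
  have hnd : ∀ w : TangentSpace I x₀, (∀ z, g x₀ w z = 0) → w = 0 := by
    intro w hw
    have h1 : chartDeriv I x₀ x₀ w = 0 := by
      refine hG.nondegenerate_self _ fun z ↦ ?_
      have := hw (chartDerivSymm I x₀ x₀ z)
      rwa [hgx, chartDeriv_chartDerivSymm hx₀] at this
    rw [← chartDerivSymm_chartDeriv hx₀ w, h1, map_zero]
  have hinv : (g x₀).IsInvertible := isInvertible_of_nondegenerate (E := E) (g x₀) hnd
  have h1 := DFunLike.congr_fun hinv.self_comp_inverse (mvfderiv I f x₀)
  have h2 : g x₀ (gradient I g f x₀) (chartDerivSymm I x₀ x₀ v) =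
      mvfderiv I f x₀ (chartDerivSymm I x₀ x₀ v) :=
    DFunLike.congr_fun h1 (chartDerivSymm I x₀ x₀ v)
  rw [hgx, chartDeriv_chartDerivSymm hx₀] at h2
  have h3 := dirDeriv_eq (X := fun z ↦ chartDerivSymm I x₀ z v) hx₀ hf hφ
  rw [fieldRep_extChartAt hx₀, chartDeriv_chartDerivSymm hx₀] at h3
  exact h2.trans h3

end LocalConnections


/-! ### A semi-Riemannian metric in a chart -/

section MetricRepresentative

open Filter Topology

variable {E : Type*} [NormedAddCommGroup E] [NormedSpace ℝ E]
  {H : Type*} [TopologicalSpace H] {I : ModelWithCorners ℝ E H}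
  {M : Type*} [TopologicalSpace M] [ChartedSpace H M]

variable (I) in
/-- The metric `g` in the chart at `x₀`. -/
noncomputable def metricRep (x₀ : M)
    (g : Π x : M, TangentSpace I x →L[ℝ] TangentSpace I x →L[ℝ] ℝ) : E → E →L[ℝ] E →L[ℝ] ℝ :=
  fun u ↦ ContinuousLinearMap.bilinearComp (E := E) (F := E)
    (g ((extChartAt I x₀).symm u))
    (chartDerivSymm I x₀ ((extChartAt I x₀).symm u))
    (chartDerivSymm I x₀ ((extChartAt I x₀).symm u))

variable {x₀ y : M} {g : Π x : M, TangentSpace I x →L[ℝ] TangentSpace I x →L[ℝ] ℝ}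

lemma metricRep_apply (u v w : E) : metricRep I x₀ g u v w = g ((extChartAt I x₀).symm u)
    (chartDerivSymm I x₀ ((extChartAt I x₀).symm u) v)
    (chartDerivSymm I x₀ ((extChartAt I x₀).symm u) w) := rfl

variable [I.Boundaryless] [IsManifold I ∞ M]

lemma metricRep_chartDeriv (hy : y ∈ (extChartAt I x₀).source) (v w : TangentSpace I y) :
    metricRep I x₀ g (extChartAt I x₀ y) (chartDeriv I x₀ y v) (chartDeriv I x₀ y w) = g y v w := by
  rw [metricRep_apply, (extChartAt I x₀).left_inv hy, chartDerivSymm_chartDeriv hy,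
    chartDerivSymm_chartDeriv hy]

lemma isMetricRep_metricRep : IsMetricRep I x₀ g (metricRep I x₀ g) := by
  filter_upwards [eventually_source (mem_extChartAt_source (I := I) x₀)] with y hy v w
  exact (metricRep_chartDeriv hy v w).symm

lemma contMDiffAt_chartDerivSymm [FiniteDimensional ℝ E] (hy : y ∈ (extChartAt I x₀).source)
    (v : E) : ContMDiffAt I I.tangent ∞
      (fun z ↦ (⟨z, chartDerivSymm I x₀ z v⟩ : TangentBundle I M)) y := by
  rw [Bundle.Trivialization.contMDiffAt_section_iff
    (trivializationAt E (TangentSpace I) x₀) (by simpa using hy)]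
  refine (contMDiffAt_const (c := v)).congr_of_eventuallyEq ?_
  filter_upwards [section_eventuallyEq (X := fun z ↦ chartDerivSymm I x₀ z v) hy,
    eventually_source hy] with z hz hz'
  rw [hz, fieldRep_extChartAt hz', chartDeriv_chartDerivSymm hz']

lemma contMDiffAt_metric_apply [FiniteDimensional ℝ E] (hg : IsSemiRiemannian I g)
    (hy : y ∈ (extChartAt I x₀).source) (v w : E) :
    ContMDiffAt I 𝓘(ℝ) ∞ (fun z ↦ g z (chartDerivSymm I x₀ z v) (chartDerivSymm I x₀ z w)) y := by
  have h : ContMDiffAt I (I.prod 𝓘(ℝ)) ∞ (fun z ↦ Bundle.TotalSpace.mk' ℝ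
      (E := Bundle.Trivial M ℝ) z
      (g z (chartDerivSymm I x₀ z v) (chartDerivSymm I x₀ z w))) y := by
    apply ContMDiffAt.clm_bundle_apply₂ (F₁ := E) (F₂ := E) (F₃ := ℝ)
    · exact hg.smooth y
    · exact contMDiffAt_chartDerivSymm hy v
    · exact contMDiffAt_chartDerivSymm hy w
  simp only [Bundle.contMDiffAt_totalSpace] at h
  exact h.2

/-- In finite dimension smoothness can be checked on fixed pairs of vectors, where the
representative is `g` evaluated on two smooth coordinate fields. -/
lemma contDiffAt_metricRep [FiniteDimensional ℝ E] (hg : IsSemiRiemannian I g) :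
    ContDiffAt ℝ ∞ (metricRep I x₀ g) (extChartAt I x₀ x₀) := by
  have hu := (extChartAt I x₀).map_source (mem_extChartAt_source (I := I) x₀)
  refine ContDiffOn.contDiffAt (s := (extChartAt I x₀).target) ?_
    ((isOpen_extChartAt_target x₀).mem_nhds hu)
  rw [contDiffOn_clm_apply]
  intro v
  rw [contDiffOn_clm_apply]
  intro w u hu
  refine ContDiffAt.contDiffWithinAt ?_
  rw [← contMDiffAt_iff_contDiffAt]
  exact ContMDiffAt.comp u (contMDiffAt_metric_apply hg ((extChartAt I x₀).map_target hu) v w)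
    (extChartAt_symm_contMDiffAt hu)

lemma isMetricNear_metricRep [FiniteDimensional ℝ E] (hg : IsSemiRiemannian I g) :
    IsMetricNear (metricRep I x₀ g) (extChartAt I x₀ x₀) := by
  have hu₀ := (extChartAt I x₀).map_source (mem_extChartAt_source (I := I) x₀)
  refine ⟨contDiffAt_metricRep hg, .of_forall fun u v w ↦ hg.symm _ _ _, ?_⟩
  filter_upwards [(isOpen_extChartAt_target x₀).mem_nhds hu₀] with u hu v hv
  have hy := (extChartAt I x₀).map_target hu
  have h1 : chartDerivSymm I x₀ ((extChartAt I x₀).symm u) v = 0 := by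
    refine hg.nondegenerate _ _ fun w ↦ ?_
    have h := hv (chartDeriv I x₀ _ w)
    rwa [metricRep_apply, chartDerivSymm_chartDeriv hy] at h
  rw [← chartDeriv_chartDerivSymm hy v, h1, map_zero]

end MetricRepresentative

/-! ### The twisted metric in the product of charts -/

section ProductChart

open Filter Topology IsTwistedNear

lemma _root_.HasMFDerivAt.hasFDerivAt_writtenInExtChartAt {E E' : Type*} [NormedAddCommGroup E]
    [NormedSpace ℝ E] [NormedAddCommGroup E'] [NormedSpace ℝ E'] {H : Type*} [TopologicalSpace H]
    {I : ModelWithCorners ℝ E H} [I.Boundaryless] {M : Type*} [TopologicalSpace M]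
    [ChartedSpace H M] {f : M → E'} {y : M} {L : E →L[ℝ] E'}
    (hf : HasMFDerivAt I 𝓘(ℝ, E') f y L) :
    HasFDerivAt (writtenInExtChartAt I 𝓘(ℝ, E') y f) L (extChartAt I y y) :=
  hasFDerivWithinAt_univ.1 (by rw [← I.range_eq_univ]; exact hf.2)

instance boundaryless_pi {ι : Type*} [Fintype ι] {E : ι → Type*}
    [∀ i, NormedAddCommGroup (E i)] [∀ i, NormedSpace ℝ (E i)] {H : ι → Type*}
    [∀ i, TopologicalSpace (H i)] (I : ∀ i, ModelWithCorners ℝ (E i) (H i))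
    [∀ i, (I i).Boundaryless] : (ModelWithCorners.pi I).Boundaryless := by
  constructor
  change Set.range (fun (f : ∀ i, H i) i ↦ I i (f i)) = _
  have h := Set.range_piMap (fun i ↦ (I i))
  simp only [ModelWithCorners.range_eq_univ, Set.pi_univ] at h
  exact h

variable {EB : Type*} [NormedAddCommGroup EB] [NormedSpace ℝ EB]
  {B : Type*} [TopologicalSpace B] [ChartedSpace EB B]
  {ι : Type*} [Fintype ι] {EF : ι → Type*}
  [∀ i, NormedAddCommGroup (EF i)] [∀ i, NormedSpace ℝ (EF i)]
  {F : ι → Type*} [∀ i, TopologicalSpace (F i)] [∀ i, ChartedSpace (EF i) (F i)]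

lemma mem_source_prodModel {q z : B × (∀ i, F i)} :
    z ∈ (extChartAt (prodModel EB EF) q).source ↔ z.1 ∈ (extChartAt 𝓘(ℝ, EB) q.1).source ∧
      ∀ i, z.2 i ∈ (extChartAt 𝓘(ℝ, EF i) (q.2 i)).source := by
  simp only [mfld_simps]
  exact ⟨fun hz ↦ ⟨hz.1, fun i ↦ hz.2 i trivial⟩, fun hz ↦ ⟨hz.1, fun i _ ↦ hz.2 i⟩⟩

variable [IsManifold 𝓘(ℝ, EB) ∞ B] [∀ i, IsManifold 𝓘(ℝ, EF i) ∞ (F i)]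

/-- The chart of the product is the product of the charts, so its derivative acts factor by factor;
this keeps lifts of fields tangent to their factor in coordinates. -/
lemma chartDeriv_prodModel {q z : B × (∀ i, F i)}
    (hz : z ∈ (extChartAt (prodModel EB EF) q).source) (v : EB × ∀ i, EF i) :
    chartDeriv (prodModel EB EF) q z v = (chartDeriv 𝓘(ℝ, EB) q.1 z.1 v.1,
      fun i ↦ chartDeriv 𝓘(ℝ, EF i) (q.2 i) (z.2 i) (v.2 i)) := by
  obtain ⟨h1, h2⟩ := mem_source_prodModel.1 hz
  have hB := ((extChartAt_contMDiffAt_of_mem h1).mdifferentiableAt (n := ∞) (by simp)).hasMFDerivAt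
  have hF := fun i ↦
    ((extChartAt_contMDiffAt_of_mem (h2 i)).mdifferentiableAt (n := ∞) (by simp)).hasMFDerivAt
  have key : HasMFDerivAt (prodModel EB EF) 𝓘(ℝ, EB × ∀ i, EF i) (extChartAt (prodModel EB EF) q) z
      ((chartDeriv 𝓘(ℝ, EB) q.1 z.1 : EB →L[ℝ] EB).prodMap (ContinuousLinearMap.piMap
        fun i ↦ (chartDeriv 𝓘(ℝ, EF i) (q.2 i) (z.2 i) : EF i →L[ℝ] EF i))) := by
    refine ⟨(tendsto_extChartAt hz), ?_⟩
    rw [ModelWithCorners.range_eq_univ]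
    refine HasFDerivAt.hasFDerivWithinAt ?_
    refine HasFDerivAt.prodMk (HasFDerivAt.comp (f := Prod.fst)
      (extChartAt (prodModel EB EF) z z) hB.hasFDerivAt_writtenInExtChartAt hasFDerivAt_fst) ?_
    refine hasFDerivAt_pi'.2 fun i ↦ ?_
    exact HasFDerivAt.comp (f := fun u : EB × ∀ i, EF i ↦ u.2 i)
      (extChartAt (prodModel EB EF) z z) (hF i).hasFDerivAt_writtenInExtChartAt
      ((ContinuousLinearMap.proj i).comp (ContinuousLinearMap.snd ℝ EB (∀ i, EF i))).hasFDerivAt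
  have := key.mfderiv
  exact DFunLike.congr_fun this v

variable {q : B × (∀ i, F i)}

lemma fieldRep_liftB (X : Π p : B, TangentSpace 𝓘(ℝ, EB) p) {u : EB × ∀ i, EF i}
    (hu : u ∈ (extChartAt (prodModel EB EF) q).target) :
    fieldRep (prodModel EB EF) q (liftB EF X) u = inBase EF (fieldRep 𝓘(ℝ, EB) q.1 X u.1) := by
  refine (chartDeriv_prodModel ((extChartAt _ q).map_target hu) _).trans ?_
  refine Prod.ext rfl ?_
  funext i
  exact map_zero (chartDeriv 𝓘(ℝ, EF i) (q.2 i) _)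

lemma fieldRep_liftF [DecidableEq ι] (i : ι) (V : Π y : F i, TangentSpace 𝓘(ℝ, EF i) y)
    {u : EB × ∀ i, EF i} (hu : u ∈ (extChartAt (prodModel EB EF) q).target) :
    fieldRep (prodModel EB EF) q (liftF EB i V) u =
      inFiber EB i (fieldRep 𝓘(ℝ, EF i) (q.2 i) V (u.2 i)) := by
  refine (chartDeriv_prodModel ((extChartAt _ q).map_target hu) _).trans ?_
  refine Prod.ext (map_zero (chartDeriv 𝓘(ℝ, EB) q.1 _)) ?_
  funext j
  rcases eq_or_ne j i with rfl | hj
  · exact (congrArg (chartDeriv 𝓘(ℝ, EF j) (q.2 j) _ : EF j →L[ℝ] EF j)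
      (Pi.single_eq_same (M := EF) j _)).trans (Pi.single_eq_same (M := EF) j _).symm
  · exact ((congrArg (chartDeriv 𝓘(ℝ, EF j) (q.2 j) _ : EF j →L[ℝ] EF j)
      (Pi.single_eq_of_ne (M := EF) hj _)).trans (map_zero _)).trans
      (Pi.single_eq_of_ne (M := EF) hj _).symm

section Metric

variable {gB : Π p : B, TangentSpace 𝓘(ℝ, EB) p →L[ℝ] TangentSpace 𝓘(ℝ, EB) p →L[ℝ] ℝ}
  {gF : ∀ i, Π y : F i, TangentSpace 𝓘(ℝ, EF i) y →L[ℝ] TangentSpace 𝓘(ℝ, EF i) y →L[ℝ] ℝ}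
  {b : ∀ i, B × F i → ℝ}

/-- The twisting function `b` in the product of the charts at `p` and at `y`. -/
noncomputable def twistRep {E : Type*} [NormedAddCommGroup E] [NormedSpace ℝ E] {N : Type*}
    [TopologicalSpace N] [ChartedSpace E N] (p : B) (y : N) (b : B × N → ℝ) : EB × E → ℝ :=
  fun z ↦ b ((extChartAt 𝓘(ℝ, EB) p).symm z.1, (extChartAt 𝓘(ℝ, E) y).symm z.2)

/-- The metric of the fibre in the product of the charts at `p` and at `y`. -/
noncomputable def fiberRep {E : Type*} [NormedAddCommGroup E] [NormedSpace ℝ E] {N : Type*}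
    [TopologicalSpace N] [ChartedSpace E N] (p : B) (y : N)
    (g : Π y : N, TangentSpace 𝓘(ℝ, E) y →L[ℝ] TangentSpace 𝓘(ℝ, E) y →L[ℝ] ℝ)
    (b : B × N → ℝ) : EB × E → E →L[ℝ] E →L[ℝ] ℝ :=
  fun z ↦ (twistRep p y b z) ^ 2 • metricRep 𝓘(ℝ, E) y g z.2

lemma twistedMetric_apply (z : B × ∀ i, F i) (v w : EB × ∀ i, EF i) :
    twistedMetric gB gF b z v w =
      gB z.1 v.1 w.1 + ∑ i, (b i (z.1, z.2 i)) ^ 2 * gF i (z.2 i) (v.2 i) (w.2 i) :=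
  flatTwisted_apply (EB := EB) (EF := EF) (fun _ ↦ (gB z.1 : EB →L[ℝ] EB →L[ℝ] ℝ))
    (fun i _ ↦ (b i (z.1, z.2 i)) ^ 2 • (gF i (z.2 i) : EF i →L[ℝ] EF i →L[ℝ] ℝ)) 0 v w

lemma isMetricRep_twistedMetric : IsMetricRep (prodModel EB EF) q (twistedMetric gB gF b)
    (flatTwisted (metricRep 𝓘(ℝ, EB) q.1 gB) fun i ↦ fiberRep q.1 (q.2 i) (gF i) (b i)) := by
  filter_upwards [eventually_source (mem_extChartAt_source (I := prodModel EB EF) q)]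
    with z hz v w
  obtain ⟨h1, h2⟩ := mem_source_prodModel.1 hz
  refine (twistedMetric_apply z v w).trans ?_
  refine Eq.trans ?_ (congrArg₂ (fun a c : EB × ∀ i, EF i ↦ flatTwisted
    (metricRep 𝓘(ℝ, EB) q.1 gB) (fun i ↦ fiberRep q.1 (q.2 i) (gF i) (b i))
    (extChartAt (prodModel EB EF) q z) a c) (chartDeriv_prodModel hz v)
    (chartDeriv_prodModel hz w)).symm
  simp only [flatTwisted_apply]
  refine congrArg₂ (fun s t : ℝ ↦ s + t) (metricRep_chartDeriv h1 v.1 w.1).symm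
    (Finset.sum_congr rfl fun i _ ↦ ?_)
  refine congrArg₂ (fun s t : ℝ ↦ s ^ 2 * t) (congrArg (b i) (Prod.ext ?_ ?_))
    (metricRep_chartDeriv (h2 i) (v.2 i) (w.2 i)).symm
  · exact ((extChartAt 𝓘(ℝ, EB) q.1).left_inv h1).symm
  · exact ((extChartAt 𝓘(ℝ, EF i) (q.2 i)).left_inv (h2 i)).symm

variable {E : Type*} [NormedAddCommGroup E] [NormedSpace ℝ E] {N : Type*}
    [TopologicalSpace N] [ChartedSpace E N] [IsManifold 𝓘(ℝ, E) ∞ N] {p : B} {y : N}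
    {g : Π y : N, TangentSpace 𝓘(ℝ, E) y →L[ℝ] TangentSpace 𝓘(ℝ, E) y →L[ℝ] ℝ} {β : B × N → ℝ}

lemma isMetricRep_fiberMetric : IsMetricRep 𝓘(ℝ, E) y (fiberMetric g β p)
    (fun v ↦ fiberRep p y g β (extChartAt 𝓘(ℝ, EB) p p, v)) := by
  filter_upwards [eventually_source (mem_extChartAt_source (I := 𝓘(ℝ, E)) y)] with z hz v w
  change (β (p, z)) ^ 2 * g z v w = (β ((extChartAt 𝓘(ℝ, EB) p).symm (extChartAt 𝓘(ℝ, EB) p p),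
    (extChartAt 𝓘(ℝ, E) y).symm (extChartAt 𝓘(ℝ, E) y z))) ^ 2 *
      metricRep 𝓘(ℝ, E) y g (extChartAt 𝓘(ℝ, E) y z) _ _
  rw [metricRep_apply, (extChartAt 𝓘(ℝ, E) y).left_inv hz, chartDerivSymm_chartDeriv hz,
    chartDerivSymm_chartDeriv hz,
    (extChartAt 𝓘(ℝ, EB) p).left_inv (mem_extChartAt_source (I := 𝓘(ℝ, EB)) p)]

lemma contDiffAt_twistRep (hβ : ContMDiff (𝓘(ℝ, EB).prod 𝓘(ℝ, E)) 𝓘(ℝ, ℝ) ∞ β) {z : EB × E}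
    (hz₁ : z.1 ∈ (extChartAt 𝓘(ℝ, EB) p).target) (hz₂ : z.2 ∈ (extChartAt 𝓘(ℝ, E) y).target) :
    ContDiffAt ℝ ∞ (twistRep (EB := EB) (E := E) p y β) z := by
  rw [← contMDiffAt_iff_contDiffAt]
  have h1 : ContMDiffAt 𝓘(ℝ, EB × E) 𝓘(ℝ, EB) ∞
      (fun z : EB × E ↦ (extChartAt 𝓘(ℝ, EB) p).symm z.1) z :=
    ContMDiffAt.comp (f := Prod.fst) z (extChartAt_symm_contMDiffAt hz₁)
      contDiffAt_fst.contMDiffAt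
  have h2 : ContMDiffAt 𝓘(ℝ, EB × E) 𝓘(ℝ, E) ∞
      (fun z : EB × E ↦ (extChartAt 𝓘(ℝ, E) y).symm z.2) z :=
    ContMDiffAt.comp (f := Prod.snd) z (extChartAt_symm_contMDiffAt hz₂)
      contDiffAt_snd.contMDiffAt
  exact ContMDiffAt.comp (g := β) z (hβ _) (h1.prodMk h2)

lemma log_twistRep_contDiffAt (hβ : ContMDiff (𝓘(ℝ, EB).prod 𝓘(ℝ, E)) 𝓘(ℝ, ℝ) ∞ β)
    (hpos : ∀ z, 0 < β z) {z : EB × E}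
    (hz₁ : z.1 ∈ (extChartAt 𝓘(ℝ, EB) p).target) (hz₂ : z.2 ∈ (extChartAt 𝓘(ℝ, E) y).target) :
    ContDiffAt ℝ ∞ (fun z ↦ Real.log (twistRep (EB := EB) (E := E) p y β z)) z :=
  (contDiffAt_twistRep hβ hz₁ hz₂).log (hpos _).ne'

lemma eventually_mem_targets :
    ∀ᶠ z in 𝓝 (extChartAt 𝓘(ℝ, EB) p p, extChartAt 𝓘(ℝ, E) y y),
      z.1 ∈ (extChartAt 𝓘(ℝ, EB) p).target ∧ z.2 ∈ (extChartAt 𝓘(ℝ, E) y).target :=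
  ((isOpen_extChartAt_target p).prod (isOpen_extChartAt_target y)).mem_nhds
    ⟨mem_extChartAt_target (I := 𝓘(ℝ, EB)) p, mem_extChartAt_target (I := 𝓘(ℝ, E)) y⟩

/-- The metric `g` of the fibre is constant along the base, so only `b²` is differentiated: `2 b db
= 2 d(ln b) b²`. -/
lemma fderiv_fiberRep [FiniteDimensional ℝ E] (hβ : ContMDiff (𝓘(ℝ, EB).prod 𝓘(ℝ, E)) 𝓘(ℝ, ℝ) ∞ β)
    (hpos : ∀ z, 0 < β z) {z : EB × E} (hz₁ : z.1 ∈ (extChartAt 𝓘(ℝ, EB) p).target)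
    (hz₂ : z.2 ∈ (extChartAt 𝓘(ℝ, E) y).target)
    (hg : DifferentiableAt ℝ (metricRep 𝓘(ℝ, E) y g) z.2) (x : EB) (v w : E) :
    fderiv ℝ (fiberRep (EB := EB) p y g β) z (x, 0) v w =
      2 * fderiv ℝ (fun z ↦ Real.log (twistRep (EB := EB) (E := E) p y β z)) z (x, 0)
        * fiberRep p y g β z v w := by
  have hb := (contDiffAt_twistRep (p := p) (y := y) hβ hz₁ hz₂).differentiableAt (by simp)
  have hne : twistRep (EB := EB) (E := E) p y β z ≠ 0 := (hpos _).ne'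
  have hg' : HasFDerivAt (fun z : EB × E ↦ metricRep 𝓘(ℝ, E) y g z.2)
      ((fderiv ℝ (metricRep 𝓘(ℝ, E) y g) z.2) ∘L ContinuousLinearMap.snd ℝ EB E) z :=
    hg.hasFDerivAt.comp z hasFDerivAt_snd
  have h1 := (hb.hasFDerivAt.pow 2).fun_smul hg'
  have h2 : fderiv ℝ (fiberRep (EB := EB) p y g β) z = _ := h1.fderiv
  rw [h2, fderiv.log hb hne]
  simp [fiberRep]
  field_simp

lemma isTwistedNear_chart [FiniteDimensional ℝ EB] [∀ i, FiniteDimensional ℝ (EF i)]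
    (hgB : IsSemiRiemannian 𝓘(ℝ, EB) gB) (hgF : ∀ i, IsSemiRiemannian 𝓘(ℝ, EF i) (gF i))
    (hb : ∀ i, ContMDiff (𝓘(ℝ, EB).prod 𝓘(ℝ, EF i)) 𝓘(ℝ, ℝ) ∞ (b i))
    (hb_pos : ∀ i z, 0 < b i z) :
    IsTwistedNear (metricRep 𝓘(ℝ, EB) q.1 gB) (fun i ↦ fiberRep q.1 (q.2 i) (gF i) (b i))
      (fun i z ↦ Real.log (twistRep q.1 (q.2 i) (b i) z)) (extChartAt (prodModel EB EF) q q) where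
  base := isMetricNear_metricRep hgB
  smooth i := by
    refine ContDiffAt.smul ((contDiffAt_twistRep (hb i) (mem_extChartAt_target q.1)
      (mem_extChartAt_target (q.2 i))).pow 2) ?_
    exact ContDiffAt.comp (g := metricRep 𝓘(ℝ, EF i) (q.2 i) (gF i)) (f := Prod.snd) _
      (contDiffAt_metricRep (hgF i)) contDiffAt_snd
  symm i := .of_forall fun z v w ↦ by
    refine congrArg (fun t : ℝ ↦ (twistRep q.1 (q.2 i) (b i) z) ^ 2 * t) ?_
    exact (hgF i).symm _ _ _
  nondegenerate i := by
    filter_upwards [continuous_snd.continuousAt.eventually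
      (isMetricNear_metricRep (x₀ := q.2 i) (hgF i)).nondegenerate] with z hz v hv
    refine hz v fun w ↦ ?_
    have h := hv w
    exact (mul_eq_zero.1 h).resolve_left (pow_ne_zero 2 (hb_pos i _).ne')
  smooth_lam i := log_twistRep_contDiffAt (hb i) (hb_pos i) (mem_extChartAt_target q.1)
      (mem_extChartAt_target (q.2 i))
  warp i := by
    filter_upwards [eventually_mem_targets (p := q.1) (y := q.2 i),
      continuous_snd.continuousAt.eventually
      (contDiffAt_metricRep (x₀ := q.2 i) (hgF i)).eventually_differentiableAt] with z hz hd x v w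
    exact fderiv_fiberRep (hb i) (hb_pos i) hz.1 hz.2 hd x v w

end Metric

end ProductChart


/-! ### Partial derivatives and logarithms of the twisting functions -/

section PartialDerivatives

open Filter Topology

variable {E₁ E₂ : Type*} [NormedAddCommGroup E₁] [NormedSpace ℝ E₁]
  [NormedAddCommGroup E₂] [NormedSpace ℝ E₂] {β : E₁ × E₂ → ℝ} {a : E₁} {c : E₂}

lemma hasFDerivAt_partial_left {W : Type*} [NormedAddCommGroup W] [NormedSpace ℝ W]
    {f : E₁ × E₂ → W} (hf : DifferentiableAt ℝ f (a, c)) :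
    HasFDerivAt (fun u ↦ f (u, c)) ((fderiv ℝ f (a, c)) ∘L ContinuousLinearMap.inl ℝ E₁ E₂) a :=
  HasFDerivAt.comp (g := f) a hf.hasFDerivAt (hasFDerivAt_prodMk_left a c)

lemma fderiv_partial_left (hβ : DifferentiableAt ℝ β (a, c)) (x : E₁) :
    fderiv ℝ (fun u ↦ β (u, c)) a x = fderiv ℝ β (a, c) (x, 0) := by
  rw [(hasFDerivAt_partial_left hβ).fderiv]
  rfl

lemma fderiv_fderiv_partial_left (hβ : ContDiffAt ℝ ∞ β (a, c)) (x y : E₁) :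
    fderiv ℝ (fderiv ℝ fun u ↦ β (u, c)) a x y =
      fderiv ℝ (fderiv ℝ β) (a, c) (x, 0) (y, 0) := by
  have ht : Tendsto (fun u : E₁ ↦ (u, c)) (𝓝 a) (𝓝 (a, c)) :=
    (continuous_id.prodMk continuous_const).continuousAt
  have h1 : (fderiv ℝ fun u ↦ β (u, c)) =ᶠ[𝓝 a]
      fun u ↦ (fderiv ℝ β (u, c)) ∘L ContinuousLinearMap.inl ℝ E₁ E₂ := by
    filter_upwards [ht.eventually hβ.eventually_differentiableAt] with u hu
    exact (hasFDerivAt_partial_left hu).fderiv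
  have hd : DifferentiableAt ℝ (fderiv ℝ β) (a, c) :=
    (hβ.fderiv_right (m := ∞) (by simp)).differentiableAt (by simp)
  rw [h1.fderiv_eq, ((hasFDerivAt_partial_left hd).clm_comp (hasFDerivAt_const _ _)).fderiv]
  simp

lemma fderiv_log_apply {z : E₁ × E₂} (hβ : DifferentiableAt ℝ β z) (h0 : 0 < β z) (x : E₁ × E₂) :
    fderiv ℝ (fun z ↦ Real.log (β z)) z x = fderiv ℝ β z x / β z := by
  rw [fderiv.log hβ h0.ne', smul_apply, smul_eq_mul, div_eq_inv_mul]

lemma fderiv_fderiv_log {z : E₁ × E₂} (hβ : ContDiffAt ℝ ∞ β z) (h0 : 0 < β z)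
    (x y : E₁ × E₂) :
    fderiv ℝ (fderiv ℝ fun z ↦ Real.log (β z)) z x y =
      fderiv ℝ (fderiv ℝ β) z x y / β z - fderiv ℝ β z x * fderiv ℝ β z y / β z ^ 2 := by
  have h1 : (fderiv ℝ fun z ↦ Real.log (β z)) =ᶠ[𝓝 z] fun z ↦ (β z)⁻¹ • fderiv ℝ β z := by
    filter_upwards [hβ.eventually_differentiableAt,
      hβ.continuousAt.eventually (lt_mem_nhds h0)] with z' hz hz0
    exact fderiv.log hz hz0.ne'
  have hd : DifferentiableAt ℝ (fderiv ℝ β) z :=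
    (hβ.fderiv_right (m := ∞) (by simp)).differentiableAt (by simp)
  have hi : HasFDerivAt (fun z ↦ (β z)⁻¹) (-((β z) ^ 2)⁻¹ • fderiv ℝ β z) z :=
    (hasDerivAt_inv h0.ne').comp_hasFDerivAt z (hβ.differentiableAt (by simp)).hasFDerivAt
  rw [h1.fderiv_eq, (hi.fun_smul hd.hasFDerivAt).fderiv]
  simp
  field_simp
  ring

/-- From `D² ln β = D²β/β - Dβ Dβ/β²`, the added product of first derivatives of `ln β` cancels the
last term, leaving the Hessian of `β` divided by `β`. -/
lemma warpHessian_log (GB : E₁ → E₁ →L[ℝ] E₁ →L[ℝ] ℝ) (hβ : ContDiffAt ℝ ∞ β (a, c))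
    (h0 : 0 < β (a, c)) (x y : E₁) :
    warpHessian GB (fun z ↦ Real.log (β z)) (a, c) x y =
      (fderiv ℝ (fderiv ℝ fun u ↦ β (u, c)) a x y
        - fderiv ℝ (fun u ↦ β (u, c)) a (christoffel GB a x y)) / β (a, c) := by
  have hd := hβ.differentiableAt (by simp)
  rw [warpHessian, fderiv_fderiv_log hβ h0, fderiv_log_apply hd h0, fderiv_log_apply hd h0,
    fderiv_log_apply hd h0, fderiv_fderiv_partial_left hβ, fderiv_partial_left hd]
  field_simp
  ring

end PartialDerivatives

/-! ### Hessian and gradient of a twisting function along the base -/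

section BaseDerivatives

open Filter Topology

variable {EB : Type*} [NormedAddCommGroup EB] [NormedSpace ℝ EB] [FiniteDimensional ℝ EB]
  {B : Type*} [TopologicalSpace B] [ChartedSpace EB B] [IsManifold 𝓘(ℝ, EB) ∞ B]
  {gB : Π p : B, TangentSpace 𝓘(ℝ, EB) p →L[ℝ] TangentSpace 𝓘(ℝ, EB) p →L[ℝ] ℝ}
  {E : Type*} [NormedAddCommGroup E] [NormedSpace ℝ E] {N : Type*}
  [TopologicalSpace N] [ChartedSpace E N] [IsManifold 𝓘(ℝ, E) ∞ N] {p : B} {y : N} {β : B × N → ℝ}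

lemma twistRep_extChartAt {p' : B} (hp : p' ∈ (extChartAt 𝓘(ℝ, EB) p).source) {y' : N}
    (hy : y' ∈ (extChartAt 𝓘(ℝ, E) y).source) :
    twistRep p y β (extChartAt 𝓘(ℝ, EB) p p', extChartAt 𝓘(ℝ, E) y y') = β (p', y') := by
  simp only [twistRep]
  rw [(extChartAt 𝓘(ℝ, EB) p).left_inv hp, (extChartAt 𝓘(ℝ, E) y).left_inv hy]

lemma restrict_eventuallyEq : (fun p' ↦ β (p', y)) =ᶠ[𝓝 p] fun p' ↦
    (fun u ↦ twistRep p y β (u, extChartAt 𝓘(ℝ, E) y y)) (extChartAt 𝓘(ℝ, EB) p p') := by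
  filter_upwards [eventually_source (mem_extChartAt_source (I := 𝓘(ℝ, EB)) p)] with p' hp
  exact (twistRep_extChartAt hp (mem_extChartAt_source (I := 𝓘(ℝ, E)) y)).symm

lemma contDiffAt_twistRep_self (hβ : ContMDiff (𝓘(ℝ, EB).prod 𝓘(ℝ, E)) 𝓘(ℝ, ℝ) ∞ β) :
    ContDiffAt ℝ ∞ (twistRep (EB := EB) (E := E) p y β)
      (extChartAt 𝓘(ℝ, EB) p p, extChartAt 𝓘(ℝ, E) y y) :=
  contDiffAt_twistRep hβ (mem_extChartAt_target p) (mem_extChartAt_target y)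

lemma contDiffAt_twistRep_restrict (hβ : ContMDiff (𝓘(ℝ, EB).prod 𝓘(ℝ, E)) 𝓘(ℝ, ℝ) ∞ β) :
    ContDiffAt ℝ ∞ (fun u ↦ twistRep (EB := EB) p y β (u, extChartAt 𝓘(ℝ, E) y y))
      (extChartAt 𝓘(ℝ, EB) p p) :=
  (contDiffAt_twistRep_self hβ).comp (f := fun u ↦ (u, extChartAt 𝓘(ℝ, E) y y)) _
    (contDiffAt_id.prodMk contDiffAt_const)

lemma hessian_div (hgB : IsSemiRiemannian 𝓘(ℝ, EB) gB)
    (hβ : ContMDiff (𝓘(ℝ, EB).prod 𝓘(ℝ, E)) 𝓘(ℝ, ℝ) ∞ β) (hpos : ∀ z, 0 < β z)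
    {X Y : Π p : B, TangentSpace 𝓘(ℝ, EB) p}
    (hX : DifferentiableAt ℝ (fieldRep 𝓘(ℝ, EB) p X) (extChartAt 𝓘(ℝ, EB) p p))
    (hY : DifferentiableAt ℝ (fieldRep 𝓘(ℝ, EB) p Y) (extChartAt 𝓘(ℝ, EB) p p)) :
    hessian 𝓘(ℝ, EB) gB (fun p' ↦ β (p', y)) X Y p / β (p, y) =
      warpHessian (metricRep 𝓘(ℝ, EB) p gB)
        (fun z ↦ Real.log (twistRep (EB := EB) (E := E) p y β z))
        (extChartAt 𝓘(ℝ, EB) p p, extChartAt 𝓘(ℝ, E) y y)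
        (fieldRep 𝓘(ℝ, EB) p X (extChartAt 𝓘(ℝ, EB) p p))
        (fieldRep 𝓘(ℝ, EB) p Y (extChartAt 𝓘(ℝ, EB) p p)) := by
  have hφ := contDiffAt_twistRep_self (p := p) (y := y) hβ
  rw [hessian_eq isMetricRep_metricRep (isMetricNear_metricRep hgB) restrict_eventuallyEq
    (contDiffAt_twistRep_restrict hβ) hX hY, warpHessian_log _ hφ (hpos _),
    twistRep_extChartAt (mem_extChartAt_source (I := 𝓘(ℝ, EB)) p)
      (mem_extChartAt_source (I := 𝓘(ℝ, E)) y)]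

/-- The gradient of `log β` along the base, in coordinates. -/
noncomputable def logGradientRep
    (gB : Π p : B, TangentSpace 𝓘(ℝ, EB) p →L[ℝ] TangentSpace 𝓘(ℝ, EB) p →L[ℝ] ℝ)
    (β : B × N → ℝ) (p : B) (y : N) : EB :=
  (β (p, y))⁻¹ • chartDeriv 𝓘(ℝ, EB) p p (gradient 𝓘(ℝ, EB) gB (fun p' ↦ β (p', y)) p)

/-- As `d(ln β) = dβ/β`, the gradient of `β` divided by `β` serves as the vector `γ` of the
curvature formulas. -/
lemma metric_logGradientRep (hgB : IsSemiRiemannian 𝓘(ℝ, EB) gB)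
    (hβ : ContMDiff (𝓘(ℝ, EB).prod 𝓘(ℝ, E)) 𝓘(ℝ, ℝ) ∞ β) (hpos : ∀ z, 0 < β z) (x : EB) :
    metricRep 𝓘(ℝ, EB) p gB (extChartAt 𝓘(ℝ, EB) p p) (logGradientRep gB β p y) x =
      fderiv ℝ (fun z ↦ Real.log (twistRep (EB := EB) (E := E) p y β z))
        (extChartAt 𝓘(ℝ, EB) p p, extChartAt 𝓘(ℝ, E) y y) (x, 0) := by
  have hφ := contDiffAt_twistRep_self (p := p) (y := y) hβ
  rw [logGradientRep, map_smul, smul_apply,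
    metric_chartDeriv_gradient isMetricRep_metricRep (isMetricNear_metricRep hgB)
      (restrict_eventuallyEq (E := E))
      ((contDiffAt_twistRep_restrict hβ).differentiableAt (by simp)),
    fderiv_partial_left (hφ.differentiableAt (by simp)),
    fderiv_log_apply (hφ.differentiableAt (by simp)) (hpos _),
    twistRep_extChartAt (mem_extChartAt_source (I := 𝓘(ℝ, EB)) p)
      (mem_extChartAt_source (I := 𝓘(ℝ, E)) y), smul_eq_mul, div_eq_inv_mul]

lemma metric_logGradientRep_logGradientRep {N' : Type*} {β' : B × N' → ℝ} {y' : N'} :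
    metricRep 𝓘(ℝ, EB) p gB (extChartAt 𝓘(ℝ, EB) p p) (logGradientRep gB β p y)
        (logGradientRep gB β' p y') =
      gB p (gradient 𝓘(ℝ, EB) gB (fun p' ↦ β (p', y)) p)
        (gradient 𝓘(ℝ, EB) gB (fun p' ↦ β' (p', y')) p) / (β (p, y) * β' (p, y')) := by
  rw [logGradientRep, logGradientRep, map_smul, map_smul, smul_apply,
    metricRep_chartDeriv (mem_extChartAt_source (I := 𝓘(ℝ, EB)) p), smul_eq_mul, smul_eq_mul]
  ring

end BaseDerivatives


/-! ### Lifted fields and their derivatives in the product chart -/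

section TwistedProductRicci

open Filter Topology IsTwistedNear

variable {EB : Type*} [NormedAddCommGroup EB] [NormedSpace ℝ EB]
  {B : Type*} [TopologicalSpace B] [ChartedSpace EB B]
  {ι : Type*} [Fintype ι] [DecidableEq ι] {EF : ι → Type*}
  [∀ i, NormedAddCommGroup (EF i)] [∀ i, NormedSpace ℝ (EF i)]
  {F : ι → Type*} [∀ i, TopologicalSpace (F i)] [∀ i, ChartedSpace (EF i) (F i)]
  [IsManifold 𝓘(ℝ, EB) ∞ B] [∀ i, IsManifold 𝓘(ℝ, EF i) ∞ (F i)]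
  {gB : Π p : B, TangentSpace 𝓘(ℝ, EB) p →L[ℝ] TangentSpace 𝓘(ℝ, EB) p →L[ℝ] ℝ}
  {gF : ∀ i, Π y : F i, TangentSpace 𝓘(ℝ, EF i) y →L[ℝ] TangentSpace 𝓘(ℝ, EF i) y →L[ℝ] ℝ}
  {b : ∀ i, B × F i → ℝ} {q : B × (∀ i, F i)}

/-- The metrics of the fibres in the product chart at `q`. -/
noncomputable def fiberReps
    (gF : ∀ i, Π y : F i, TangentSpace 𝓘(ℝ, EF i) y →L[ℝ] TangentSpace 𝓘(ℝ, EF i) y →L[ℝ] ℝ)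
    (b : ∀ i, B × F i → ℝ) (q : B × (∀ i, F i)) (i : ι) : EB × EF i → EF i →L[ℝ] EF i →L[ℝ] ℝ :=
  fiberRep q.1 (q.2 i) (gF i) (b i)

variable (EB EF) in
/-- The logarithms of the twisting functions in the product chart at `q`. -/
noncomputable def logTwistReps (b : ∀ i, B × F i → ℝ) (q : B × (∀ i, F i)) (i : ι) :
    EB × EF i → ℝ :=
  fun z ↦ Real.log (twistRep q.1 (q.2 i) (b i) z)

lemma logTwistReps_eq (i : ι) : logTwistReps EB EF b q i =
    fun z ↦ Real.log (twistRep q.1 (q.2 i) (b i) z) := rfl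

variable (EB EF) in
/-- The point `q` in the product chart at `q`. -/
noncomputable abbrev chartCenter (q : B × (∀ i, F i)) : EB × ∀ i, EF i :=
  (extChartAt 𝓘(ℝ, EB) q.1 q.1, fun i ↦ extChartAt 𝓘(ℝ, EF i) (q.2 i) (q.2 i))

/-- The value at `p` of the representative of a field in the chart at `p`. -/
noncomputable abbrev vecRep {E : Type*} [NormedAddCommGroup E] [NormedSpace ℝ E] {N : Type*}
    [TopologicalSpace N] [ChartedSpace E N] (X : Π y : N, TangentSpace 𝓘(ℝ, E) y) (p : N) : E :=
  fieldRep 𝓘(ℝ, E) p X (extChartAt 𝓘(ℝ, E) p p)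

lemma IsSmoothField.contDiffAt_fieldRep {E : Type*} [NormedAddCommGroup E] [NormedSpace ℝ E]
    {N : Type*} [TopologicalSpace N] [ChartedSpace E N] [IsManifold 𝓘(ℝ, E) ∞ N]
    {X : Π y : N, TangentSpace 𝓘(ℝ, E) y} (hX : IsSmoothField X) (p : N) :
    ContDiffAt ℝ ∞ (fieldRep 𝓘(ℝ, E) p X) (extChartAt 𝓘(ℝ, E) p p) :=
  QuarterSymmetric.contDiffAt_fieldRep (mem_extChartAt_source p) (hX p)

lemma fieldRep_liftB_eventuallyEq (X : Π p : B, TangentSpace 𝓘(ℝ, EB) p) :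
    fieldRep (prodModel EB EF) q (liftB EF X) =ᶠ[𝓝 (chartCenter EB EF q)]
      fun u ↦ inBase EF (fieldRep 𝓘(ℝ, EB) q.1 X u.1) := by
  filter_upwards [(isOpen_extChartAt_target (I := prodModel EB EF) q).mem_nhds
    (mem_extChartAt_target q)] with u hu
  exact fieldRep_liftB X hu

lemma fieldRep_liftF_eventuallyEq (i : ι) (V : Π y : F i, TangentSpace 𝓘(ℝ, EF i) y) :
    fieldRep (prodModel EB EF) q (liftF EB i V) =ᶠ[𝓝 (chartCenter EB EF q)]
      fun u ↦ inFiber EB i (fieldRep 𝓘(ℝ, EF i) (q.2 i) V (u.2 i)) := by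
  filter_upwards [(isOpen_extChartAt_target (I := prodModel EB EF) q).mem_nhds
    (mem_extChartAt_target q)] with u hu
  exact fieldRep_liftF i V hu

lemma fieldRep_liftB_center (X : Π p : B, TangentSpace 𝓘(ℝ, EB) p) :
    fieldRep (prodModel EB EF) q (liftB EF X) (chartCenter EB EF q) = inBase EF (vecRep X q.1) :=
  (fieldRep_liftB_eventuallyEq X).self_of_nhds

lemma fieldRep_liftF_center (i : ι) (V : Π y : F i, TangentSpace 𝓘(ℝ, EF i) y) :
    fieldRep (prodModel EB EF) q (liftF EB i V) (chartCenter EB EF q) =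
      inFiber EB i (vecRep V (q.2 i)) :=
  (fieldRep_liftF_eventuallyEq i V).self_of_nhds

lemma contDiffAt_fieldRep_liftB {X : Π p : B, TangentSpace 𝓘(ℝ, EB) p}
    (hX : ContDiffAt ℝ ∞ (fieldRep 𝓘(ℝ, EB) q.1 X) (extChartAt 𝓘(ℝ, EB) q.1 q.1)) :
    ContDiffAt ℝ ∞ (fieldRep (prodModel EB EF) q (liftB EF X)) (chartCenter EB EF q) := by
  refine ContDiffAt.congr_of_eventuallyEq ?_ (fieldRep_liftB_eventuallyEq X)
  exact (hX.comp (f := Prod.fst) (chartCenter EB EF q) contDiffAt_fst).prodMk contDiffAt_const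

lemma contDiffAt_fieldRep_liftF {i : ι} {V : Π y : F i, TangentSpace 𝓘(ℝ, EF i) y}
    (hV : ContDiffAt ℝ ∞ (fieldRep 𝓘(ℝ, EF i) (q.2 i) V) (extChartAt 𝓘(ℝ, EF i) (q.2 i) (q.2 i))) :
    ContDiffAt ℝ ∞ (fieldRep (prodModel EB EF) q (liftF EB i V)) (chartCenter EB EF q) := by
  refine ContDiffAt.congr_of_eventuallyEq ?_ (fieldRep_liftF_eventuallyEq i V)
  exact contDiffAt_const.prodMk (ContDiffAt.comp (g := ContinuousLinearMap.single ℝ EF i)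
    (chartCenter EB EF q) (ContinuousLinearMap.contDiff _).contDiffAt
    (hV.comp (f := fun u : EB × ∀ i, EF i ↦ u.2 i) (chartCenter EB EF q)
      ((ContinuousLinearMap.proj i).comp
        (ContinuousLinearMap.snd ℝ EB (∀ i, EF i))).contDiff.contDiffAt))

variable (EB EF) in
/-- The values of the metric of the twisted product at `q`, in coordinates. -/
lemma twistedMetric_eq (S T : Π z : B × (∀ i, F i), TangentSpace (prodModel EB EF) z) :
    twistedMetric gB gF b q (S q) (T q) =
      flatTwisted (metricRep 𝓘(ℝ, EB) q.1 gB) (fiberReps gF b q) (chartCenter EB EF q)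
        (fieldRep (prodModel EB EF) q S (chartCenter EB EF q))
        (fieldRep (prodModel EB EF) q T (chartCenter EB EF q)) := by
  refine ((isMetricRep_twistedMetric (gB := gB) (gF := gF) (b := b) (q := q)).self_of_nhds
    (S q) (T q)).trans ?_
  exact (congrArg₂ (fun v w ↦ flatTwisted (metricRep 𝓘(ℝ, EB) q.1 gB) (fiberReps gF b q)
    (chartCenter EB EF q) v w) (fieldRep_extChartAt (I := prodModel EB EF) (X := S)
      (mem_extChartAt_source q)) (fieldRep_extChartAt (I := prodModel EB EF) (X := T)
      (mem_extChartAt_source q))).symm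

variable [FiniteDimensional ℝ EB] [∀ i, FiniteDimensional ℝ (EF i)]

/-- The logarithmic twisting functions in coordinates. -/
lemma dirDeriv_liftB_div (hb : ∀ i, ContMDiff (𝓘(ℝ, EB).prod 𝓘(ℝ, EF i)) 𝓘(ℝ, ℝ) ∞ (b i))
    (hb_pos : ∀ i z, 0 < b i z) (X : Π p : B, TangentSpace 𝓘(ℝ, EB) p) (r : ι) :
    dirDeriv (prodModel EB EF) (liftB EF X) (fun z ↦ b r (z.1, z.2 r)) q / b r (q.1, q.2 r) =
      fderiv ℝ (logTwistReps EB EF b q r) ((chartCenter EB EF q).1, (chartCenter EB EF q).2 r)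
        (vecRep X q.1, 0) := by
  have hβ := contDiffAt_twistRep_self (p := q.1) (y := q.2 r) (hb r)
  have hd := hβ.differentiableAt (by simp)
  have hφ : HasFDerivAt (fun u : EB × ∀ i, EF i ↦ twistRep q.1 (q.2 r) (b r) (u.1, u.2 r)) _
      (chartCenter EB EF q) :=
    HasFDerivAt.comp (f := fun u : EB × ∀ i, EF i ↦ (u.1, u.2 r)) (chartCenter EB EF q)
      hd.hasFDerivAt ((ContinuousLinearMap.fst ℝ EB (∀ i, EF i)).prod
        ((ContinuousLinearMap.proj r).comp
          (ContinuousLinearMap.snd ℝ EB (∀ i, EF i)))).hasFDerivAt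
  have hf : (fun z : B × ∀ i, F i ↦ b r (z.1, z.2 r)) =ᶠ[𝓝 q] fun z ↦
      (fun u : EB × ∀ i, EF i ↦ twistRep q.1 (q.2 r) (b r) (u.1, u.2 r))
        (extChartAt (prodModel EB EF) q z) := by
    filter_upwards [eventually_source (mem_extChartAt_source (I := prodModel EB EF) q)] with z hz
    obtain ⟨h1, h2⟩ := mem_source_prodModel.1 hz
    exact (twistRep_extChartAt h1 (h2 r)).symm
  have h := dirDeriv_eq (X := liftB EF X) (mem_extChartAt_source (I := prodModel EB EF) q) hf
    hφ.differentiableAt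
  change _ = fderiv ℝ _ (chartCenter EB EF q) (fieldRep (prodModel EB EF) q (liftB EF X)
    (chartCenter EB EF q)) at h
  rw [h, fieldRep_liftB_center, hφ.fderiv, logTwistReps_eq, fderiv_log_apply hd (hb_pos r _),
    twistRep_extChartAt (mem_extChartAt_source q.1) (mem_extChartAt_source (q.2 r))]
  rfl

/-- The coordinates of a lifted base field do not vary along the fibres, so `V X ln b` has no
first-order term and is the mixed second derivative. -/
lemma dirDeriv_liftF_dirDeriv_liftB_log
    (hb : ∀ i, ContMDiff (𝓘(ℝ, EB).prod 𝓘(ℝ, EF i)) 𝓘(ℝ, ℝ) ∞ (b i))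
    (hb_pos : ∀ i z, 0 < b i z) {X : Π p : B, TangentSpace 𝓘(ℝ, EB) p}
    (hX : ContDiffAt ℝ ∞ (fieldRep 𝓘(ℝ, EB) q.1 X) (extChartAt 𝓘(ℝ, EB) q.1 q.1)) (i : ι)
    (V : Π y : F i, TangentSpace 𝓘(ℝ, EF i) y) :
    dirDeriv (prodModel EB EF) (liftF EB i V) (dirDeriv (prodModel EB EF) (liftB EF X)
        fun z ↦ Real.log (b i (z.1, z.2 i))) q =
      fderiv ℝ (fderiv ℝ (logTwistReps EB EF b q i))
        ((chartCenter EB EF q).1, (chartCenter EB EF q).2 i) (0, vecRep V (q.2 i))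
        (vecRep X q.1, 0) := by
  have hlam : ContDiffAt ℝ ∞ (logTwistReps EB EF b q i)
      ((chartCenter EB EF q).1, (chartCenter EB EF q).2 i) :=
    log_twistRep_contDiffAt (hb i) (hb_pos i) (mem_extChartAt_target q.1)
      (mem_extChartAt_target (q.2 i))
  set L : (EB × ∀ i, EF i) →L[ℝ] EB × EF i := (ContinuousLinearMap.fst ℝ EB (∀ i, EF i)).prod
        ((ContinuousLinearMap.proj i).comp (ContinuousLinearMap.snd ℝ EB (∀ i, EF i))) with hL
  have hφ : ContDiffAt ℝ ∞ (fun u ↦ logTwistReps EB EF b q i (L u)) (chartCenter EB EF q) :=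
    ContDiffAt.comp (f := L) (chartCenter EB EF q) hlam L.contDiff.contDiffAt
  have hf : (fun z : B × ∀ i, F i ↦ Real.log (b i (z.1, z.2 i))) =ᶠ[𝓝 q] fun z ↦
      (fun u : EB × ∀ i, EF i ↦ logTwistReps EB EF b q i (L u))
        (extChartAt (prodModel EB EF) q z) := by
    filter_upwards [eventually_source (mem_extChartAt_source (I := prodModel EB EF) q)] with z hz
    obtain ⟨h1, h2⟩ := mem_source_prodModel.1 hz
    exact congrArg Real.log (twistRep_extChartAt h1 (h2 i)).symm
  have hX1 := (contDiffAt_fieldRep_liftB (EF := EF) (q := q) hX).differentiableAt (by simp)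
  have h := dirDeriv_dirDeriv_eq (I := prodModel EB EF) (X := liftF EB i V) hf hφ hX1
  have h1 : fderiv ℝ (fieldRep (prodModel EB EF) q (liftB EF X)) (chartCenter EB EF q)
      (inFiber EB i (vecRep V (q.2 i))) = 0 := by
    have h2 : HasFDerivAt (fun u : EB × ∀ i, EF i ↦ inBase EF (fieldRep 𝓘(ℝ, EB) q.1 X u.1)) _
        (chartCenter EB EF q) :=
      (HasFDerivAt.comp (f := Prod.fst) (chartCenter EB EF q)
        (hX.differentiableAt (by simp)).hasFDerivAt hasFDerivAt_fst).prodMk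
        (hasFDerivAt_const (0 : ∀ i, EF i) _)
    rw [(fieldRep_liftB_eventuallyEq X).fderiv_eq, h2.fderiv]
    simp [inFiber]
  have h3 : fderiv ℝ (fun u ↦ logTwistReps EB EF b q i (L u)) =ᶠ[𝓝 (chartCenter EB EF q)]
      fun u ↦ (fderiv ℝ (logTwistReps EB EF b q i) (L u)) ∘L L := by
    filter_upwards [L.continuous.continuousAt.eventually hlam.eventually_differentiableAt]
      with u hu
    exact (hu.hasFDerivAt.comp u L.hasFDerivAt).fderiv
  have hd : DifferentiableAt ℝ (fderiv ℝ (logTwistReps EB EF b q i))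
      (L (chartCenter EB EF q)) :=
    (hlam.fderiv_right (m := ∞) (by simp)).differentiableAt (by simp)
  have h4 : HasFDerivAt (fun u ↦ fderiv ℝ (logTwistReps EB EF b q i) (L u)) _
      (chartCenter EB EF q) := hd.hasFDerivAt.comp _ L.hasFDerivAt
  change _ = fderiv ℝ (fderiv ℝ _) (chartCenter EB EF q) (fieldRep (prodModel EB EF) q
    (liftF EB i V) (chartCenter EB EF q)) (fieldRep (prodModel EB EF) q (liftB EF X)
    (chartCenter EB EF q)) + fderiv ℝ _ (chartCenter EB EF q) (fderiv ℝ _ (chartCenter EB EF q)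
    (fieldRep (prodModel EB EF) q (liftF EB i V) (chartCenter EB EF q))) at h
  rw [fieldRep_liftF_center, fieldRep_liftB_center, h1, map_zero, add_zero, h3.fderiv_eq,
    (h4.clm_comp (hasFDerivAt_const L _)).fderiv] at h
  refine h.trans ?_
  simp [hL, inBase, inFiber]

/-- The covariant derivative of the lift of a field on a fibre, in coordinates. -/
lemma fieldRep_leviCivita_lift
    (hT : IsTwistedNear (metricRep 𝓘(ℝ, EB) q.1 gB) (fiberReps gF b q) (logTwistReps EB EF b q)
      (chartCenter EB EF q)) {r : ι} {P : Π y : F r, TangentSpace 𝓘(ℝ, EF r) y}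
    (hP : IsSmoothField P) {S : Π z : B × (∀ i, F i), TangentSpace (prodModel EB EF) z}
    (hS : DifferentiableAt ℝ (fieldRep (prodModel EB EF) q S) (chartCenter EB EF q)) :
    fieldRep (prodModel EB EF) q
        (leviCivita (prodModel EB EF) (twistedMetric gB gF b) S (liftF EB r P))
        (chartCenter EB EF q) =
      covDerivLift (metricRep 𝓘(ℝ, EB) q.1 gB) (fiberReps gF b q) (chartCenter EB EF q)
        (fieldRep 𝓘(ℝ, EF r) (q.2 r) P)
        (fieldRep (prodModel EB EF) q S (chartCenter EB EF q)) := by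
  have hPr := (contDiffAt_fieldRep_liftF (EB := EB) (q := q)
    (hP.contDiffAt_fieldRep (q.2 r))).differentiableAt (by simp)
  have h := (isConnectionRep_leviCivita (isMetricRep_twistedMetric (gB := gB) (gF := gF) (b := b)
    (q := q)) hT.isMetricNear).self_of_nhds S (liftF EB r P) hS hPr
  refine (fieldRep_extChartAt (I := prodModel EB EF) (mem_extChartAt_source q)).trans
    (h.trans ?_)
  change fderiv ℝ _ (chartCenter EB EF q) (fieldRep (prodModel EB EF) q S (chartCenter EB EF q)) +
    christoffel (flatTwisted (metricRep 𝓘(ℝ, EB) q.1 gB) (fiberReps gF b q)) (chartCenter EB EF q)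
      (fieldRep (prodModel EB EF) q S (chartCenter EB EF q))
      (fieldRep (prodModel EB EF) q (liftF EB r P) (chartCenter EB EF q)) = _
  rw [(fieldRep_liftF_eventuallyEq r P).fderiv_eq, fieldRep_liftF_center]
  rfl

end TwistedProductRicci


/-! ### The Ricci tensors of product, base and fibres in coordinates -/

section QuarterSymmetricRicci

open Filter Topology IsTwistedNear

variable {EB : Type*} [NormedAddCommGroup EB] [NormedSpace ℝ EB]
  {B : Type*} [TopologicalSpace B] [ChartedSpace EB B]
  {ι : Type*} [Fintype ι] [DecidableEq ι] {EF : ι → Type*}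
  [∀ i, NormedAddCommGroup (EF i)] [∀ i, NormedSpace ℝ (EF i)]
  {F : ι → Type*} [∀ i, TopologicalSpace (F i)] [∀ i, ChartedSpace (EF i) (F i)]
  [IsManifold 𝓘(ℝ, EB) ∞ B] [∀ i, IsManifold 𝓘(ℝ, EF i) ∞ (F i)]
  {gB : Π p : B, TangentSpace 𝓘(ℝ, EB) p →L[ℝ] TangentSpace 𝓘(ℝ, EB) p →L[ℝ] ℝ}
  {gF : ∀ i, Π y : F i, TangentSpace 𝓘(ℝ, EF i) y →L[ℝ] TangentSpace 𝓘(ℝ, EF i) y →L[ℝ] ℝ}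
  {b : ∀ i, B × F i → ℝ} {q : B × (∀ i, F i)}
  [FiniteDimensional ℝ EB] [∀ i, FiniteDimensional ℝ (EF i)]
  {r : ι} {P : Π y : F r, TangentSpace 𝓘(ℝ, EF r) y}
  {eM : Fin (finrank ℝ (EB × ∀ i, EF i)) →
      Π z : B × (∀ i, F i), TangentSpace (prodModel EB EF) z}
  {eB : Fin (finrank ℝ EB) → Π p : B, TangentSpace 𝓘(ℝ, EB) p}
  {eF : ∀ i, Fin (finrank ℝ (EF i)) → Π y : F i, TangentSpace 𝓘(ℝ, EF i) y}

lemma isOrthonormalFamily_vecRep_base (heB : IsOrthonormalFrameAt gB eB q.1) :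
    IsOrthonormalFamily (metricRep 𝓘(ℝ, EB) q.1 gB (chartCenter EB EF q).1)
      fun k ↦ vecRep (eB k) q.1 :=
  isOrthonormalFamily_fieldRep isMetricRep_metricRep heB

lemma isOrthonormalFamily_vecRep_fiber (i : ι)
    (heF : IsOrthonormalFrameAt (fiberMetric (gF i) (b i) q.1) (eF i) (q.2 i)) :
    IsOrthonormalFamily
      (fiberReps gF b q i ((chartCenter EB EF q).1, (chartCenter EB EF q).2 i))
      fun k ↦ vecRep (eF i k) (q.2 i) :=
  isOrthonormalFamily_fieldRep isMetricRep_fiberMetric heF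

lemma fiberDiv_eq
    (hT : IsTwistedNear (metricRep 𝓘(ℝ, EB) q.1 gB) (fiberReps gF b q) (logTwistReps EB EF b q)
      (chartCenter EB EF q)) (hP : IsSmoothField P)
    (heF : IsOrthonormalFrameAt (fiberMetric (gF r) (b r) q.1) (eF r) (q.2 r)) :
    fiberDiv (twistedMetric gB gF b) r (eF r) (liftF EB r P) q =
      ∑ k, fiberReps gF b q r ((chartCenter EB EF q).1, (chartCenter EB EF q).2 r)
          (vecRep (eF r k) (q.2 r)) (vecRep (eF r k) (q.2 r)) *
        flatTwisted (metricRep 𝓘(ℝ, EB) q.1 gB) (fiberReps gF b q) (chartCenter EB EF q)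
          (covDerivLift (metricRep 𝓘(ℝ, EB) q.1 gB) (fiberReps gF b q) (chartCenter EB EF q)
            (fieldRep 𝓘(ℝ, EF r) (q.2 r) P) (inFiber EB r (vecRep (eF r k) (q.2 r))))
          (inFiber EB r (vecRep (eF r k) (q.2 r))) := by
  rw [fiberDiv]
  refine Finset.sum_congr rfl fun k _ ↦ ?_
  have hk : DifferentiableAt ℝ (fieldRep (prodModel EB EF) q (liftF EB r (eF r k)))
      (chartCenter EB EF q) := (contDiffAt_fieldRep_liftF (contDiffAt_fieldRep
        (mem_extChartAt_source (q.2 r)) (heF.smooth k))).differentiableAt (by simp)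
  rw [twistedMetric_eq, twistedMetric_eq EB EF (leviCivita _ _ _ _),
    fieldRep_leviCivita_lift hT hP hk, fieldRep_liftF_center, flatTwisted_inFiber_inFiber]

/-- The Ricci tensor of the quarter-symmetric connection of a twisted product, in coordinates. -/
lemma ricci_quarterSymmetric
    (hT : IsTwistedNear (metricRep 𝓘(ℝ, EB) q.1 gB) (fiberReps gF b q) (logTwistReps EB EF b q)
      (chartCenter EB EF q)) (hP : IsSmoothField P)
    (heM : IsOrthonormalFrameAt (twistedMetric gB gF b) eM q)
    (heB : IsOrthonormalFrameAt gB eB q.1)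
    (heF : ∀ i, IsOrthonormalFrameAt (fiberMetric (gF i) (b i) q.1) (eF i) (q.2 i))
    (lam₁ lam₂ : ℝ) {S T : Π z : B × (∀ i, F i), TangentSpace (prodModel EB EF) z}
    {s t : EB × ∀ i, EF i}
    (hS : ContDiffAt ℝ ∞ (fieldRep (prodModel EB EF) q S) (chartCenter EB EF q))
    (hS' : ContDiffAt ℝ ∞ (fieldRep (prodModel EB EF) q T) (chartCenter EB EF q))
    (hs : fieldRep (prodModel EB EF) q S (chartCenter EB EF q) = s)
    (ht : fieldRep (prodModel EB EF) q T (chartCenter EB EF q) = t) :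
    ricci (twistedMetric gB gF b) (quarterSymmetric (prodModel EB EF) (twistedMetric gB gF b)
        (liftF EB r P) lam₁ lam₂) eM S T q =
      flatRicci (flatTwisted (metricRep 𝓘(ℝ, EB) q.1 gB) (fiberReps gF b q))
        (christoffel (flatTwisted (metricRep 𝓘(ℝ, EB) q.1 gB) (fiberReps gF b q)))
        (adaptedFrame (fun k ↦ vecRep (eB k) q.1) fun i k ↦ vecRep (eF i k) (q.2 i))
        (chartCenter EB EF q) s t
      + (((finrank ℝ EB + ∑ i, (finrank ℝ (EF i) : ℝ)) - 1) * lam₁ - lam₂) *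
        flatTwisted (metricRep 𝓘(ℝ, EB) q.1 gB) (fiberReps gF b q) (chartCenter EB EF q) t
          (covDerivLift (metricRep 𝓘(ℝ, EB) q.1 gB) (fiberReps gF b q) (chartCenter EB EF q)
            (fieldRep 𝓘(ℝ, EF r) (q.2 r) P) s)
      + lam₂ * flatTwisted (metricRep 𝓘(ℝ, EB) q.1 gB) (fiberReps gF b q) (chartCenter EB EF q) s t
        * fiberDiv (twistedMetric gB gF b) r (eF r) (liftF EB r P) q
      + (((finrank ℝ EB + ∑ i, (finrank ℝ (EF i) : ℝ)) - 1) * lam₁ * lam₂ - lam₂ ^ 2) *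
        twistedMetric gB gF b q (liftF EB r P q) (liftF EB r P q) *
        flatTwisted (metricRep 𝓘(ℝ, EB) q.1 gB) (fiberReps gF b q) (chartCenter EB EF q) s t
      + (lam₂ ^ 2 + (1 - (finrank ℝ EB + ∑ i, (finrank ℝ (EF i) : ℝ))) * lam₁ ^ 2) *
        twistedMetric gB gF b q (S q) (liftF EB r P q) *
        twistedMetric gB gF b q (T q) (liftF EB r P q) := by
  subst hs ht
  have hg := isMetricRep_twistedMetric (gB := gB) (gF := gF) (b := b) (q := q)
  have hG := hT.isMetricNear
  have hp := (contDiffAt_fieldRep_liftF (EB := EB) (q := q)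
    (hP.contDiffAt_fieldRep (q.2 r))).differentiableAt (by simp)
  have hPd := (hP.contDiffAt_fieldRep (q.2 r)).differentiableAt (by simp)
  have heM' : IsOrthonormalFamily
      (flatTwisted (metricRep 𝓘(ℝ, EB) q.1 gB) (fiberReps gF b q) (chartCenter EB EF q))
      (fun k ↦ fieldRep (prodModel EB EF) q (eM k) (chartCenter EB EF q)) :=
    isOrthonormalFamily_fieldRep hg heM
  have hA : IsOrthonormalFamily
      (flatTwisted (metricRep 𝓘(ℝ, EB) q.1 gB) (fiberReps gF b q) (chartCenter EB EF q))
      (adaptedFrame (fun k ↦ vecRep (eB k) q.1) fun i k ↦ vecRep (eF i k) (q.2 i)) :=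
    IsTwistedNear.isOrthonormalFamily (isOrthonormalFamily_vecRep_base (EF := EF) heB)
      fun i ↦ isOrthonormalFamily_vecRep_fiber (EB := EB) i (heF i)
  have hcA := card_adaptedFrame (EB := EB) (EF := EF) (κ := Fin (finrank ℝ EB))
    (κF := fun i ↦ Fin (finrank ℝ (EF i))) (Fintype.card_fin _) fun i ↦ Fintype.card_fin _
  have hN : (finrank ℝ (EB × ∀ i, EF i) : ℝ) = finrank ℝ EB + ∑ i, (finrank ℝ (EF i) : ℝ) := by
    rw [finrank_prod_pi]
    push_cast
    rfl
  have hcov : ∀ x, fderiv ℝ (fieldRep (prodModel EB EF) q (liftF EB r P)) (chartCenter EB EF q) x +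
      christoffel (flatTwisted (metricRep 𝓘(ℝ, EB) q.1 gB) (fiberReps gF b q)) (chartCenter EB EF q)
        x (fieldRep (prodModel EB EF) q (liftF EB r P) (chartCenter EB EF q)) =
      covDerivLift (metricRep 𝓘(ℝ, EB) q.1 gB) (fiberReps gF b q) (chartCenter EB EF q)
        (fieldRep 𝓘(ℝ, EF r) (q.2 r) P) x := by
    intro x
    rw [(fieldRep_liftF_eventuallyEq r P).fderiv_eq, fieldRep_liftF_center]
    rfl
  -- The divergence of `P` is a trace, so it may be computed in the adapted frame, where only the
  -- `r`-th fibre contributes.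
  have hdiv := heM'.trace_eq (Fintype.card_fin _) hA hcA hG.symm_self
    ((flatTwisted (metricRep 𝓘(ℝ, EB) q.1 gB) (fiberReps gF b q) (chartCenter EB EF q)) ∘L
      (fderiv ℝ (fieldRep (prodModel EB EF) q (liftF EB r P)) (chartCenter EB EF q) +
      (christoffel (flatTwisted (metricRep 𝓘(ℝ, EB) q.1 gB) (fiberReps gF b q))
        (chartCenter EB EF q)).flip
        (fieldRep (prodModel EB EF) q (liftF EB r P) (chartCenter EB EF q))))
  simp only [ContinuousLinearMap.comp_apply, add_apply, ContinuousLinearMap.flip_apply,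
    hcov] at hdiv
  rw [hT.divergence_lift hPd, ← fiberDiv_eq hT hP (heF r)] at hdiv
  refine (ricci_eq_flatRicci hg (isConnectionRep_quarterSymmetric hg hG (liftF EB r P) lam₁ lam₂)
    (differentiableAt_quarterCoeff hG hp lam₁ lam₂)
    (fun k ↦ contDiffAt_fieldRep (mem_extChartAt_source q) (heM.smooth k)) hS hS').trans ?_
  refine (flatRicci_quarterCoeff hG heM' (Fintype.card_fin _) hp lam₁ lam₂ _ _).trans ?_
  simp only [hcov]
  rw [hdiv, flatRicci_eq hG heM' (Fintype.card_fin _) hA hcA, hN, twistedMetric_eq,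
    twistedMetric_eq EB EF S, twistedMetric_eq EB EF T]
  rfl

/-- The Ricci tensor of the base in coordinates. -/
lemma ricci_base (hgB : IsSemiRiemannian 𝓘(ℝ, EB) gB) (heB : IsOrthonormalFrameAt gB eB q.1)
    {X Y : Π p : B, TangentSpace 𝓘(ℝ, EB) p} (hX : IsSmoothField X) (hY : IsSmoothField Y) :
    ricci gB (leviCivita 𝓘(ℝ, EB) gB) eB X Y q.1 =
      flatRicci (metricRep 𝓘(ℝ, EB) q.1 gB) (christoffel (metricRep 𝓘(ℝ, EB) q.1 gB))
        (fun k ↦ vecRep (eB k) q.1) (chartCenter EB EF q).1 (vecRep X q.1) (vecRep Y q.1) :=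
  ricci_eq_flatRicci isMetricRep_metricRep
    (isConnectionRep_leviCivita isMetricRep_metricRep (isMetricNear_metricRep hgB))
    (isMetricNear_metricRep hgB).differentiableAt_christoffel
    (fun k ↦ contDiffAt_fieldRep (mem_extChartAt_source _) (heB.smooth k))
    (hX.contDiffAt_fieldRep _) (hY.contDiffAt_fieldRep _)

/-- The Ricci tensor of a fibre in coordinates. -/
lemma ricci_fiber
    (hT : IsTwistedNear (metricRep 𝓘(ℝ, EB) q.1 gB) (fiberReps gF b q) (logTwistReps EB EF b q)
      (chartCenter EB EF q)) (i : ι)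
    (heF : IsOrthonormalFrameAt (fiberMetric (gF i) (b i) q.1) (eF i) (q.2 i))
    {V W : Π y : F i, TangentSpace 𝓘(ℝ, EF i) y} (hV : IsSmoothField V) (hW : IsSmoothField W) :
    ricci (fiberMetric (gF i) (b i) q.1) (leviCivita 𝓘(ℝ, EF i) (fiberMetric (gF i) (b i) q.1))
        (eF i) V W (q.2 i) =
      flatRicci (fun y ↦ fiberReps gF b q i ((chartCenter EB EF q).1, y))
        (christoffel fun y ↦ fiberReps gF b q i ((chartCenter EB EF q).1, y))
        (fun k ↦ vecRep (eF i k) (q.2 i)) ((chartCenter EB EF q).2 i) (vecRep V (q.2 i))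
        (vecRep W (q.2 i)) :=
  ricci_eq_flatRicci isMetricRep_fiberMetric
    (isConnectionRep_leviCivita isMetricRep_fiberMetric (hT.fiber i))
    (hT.fiber i).differentiableAt_christoffel
    (fun k ↦ contDiffAt_fieldRep (mem_extChartAt_source _) (heF.smooth k))
    (hV.contDiffAt_fieldRep _) (hW.contDiffAt_fieldRep _)

/-- The Laplacian of a twisting function in coordinates. -/
lemma laplacian_div (hgB : IsSemiRiemannian 𝓘(ℝ, EB) gB)
    (hb : ∀ i, ContMDiff (𝓘(ℝ, EB).prod 𝓘(ℝ, EF i)) 𝓘(ℝ, ℝ) ∞ (b i))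
    (hb_pos : ∀ i z, 0 < b i z) (heB : IsOrthonormalFrameAt gB eB q.1) (i : ι) :
    laplacian gB eB (fun p ↦ b i (p, q.2 i)) q.1 / b i (q.1, q.2 i) =
      ∑ k, metricRep 𝓘(ℝ, EB) q.1 gB (chartCenter EB EF q).1 (vecRep (eB k) q.1)
          (vecRep (eB k) q.1) *
        warpHessian (metricRep 𝓘(ℝ, EB) q.1 gB) (logTwistReps EB EF b q i)
          ((chartCenter EB EF q).1, (chartCenter EB EF q).2 i) (vecRep (eB k) q.1)
          (vecRep (eB k) q.1) := by
  rw [laplacian, Finset.sum_div]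
  refine Finset.sum_congr rfl fun k _ ↦ ?_
  have hk := (contDiffAt_fieldRep (mem_extChartAt_source q.1)
    (heB.smooth k)).differentiableAt (by simp)
  rw [mul_div_assoc, hessian_div hgB (hb i) (hb_pos i) hk hk, vecRep, fieldRep_extChartAt
    (mem_extChartAt_source (I := 𝓘(ℝ, EB)) q.1), metricRep_chartDeriv
    (mem_extChartAt_source (I := 𝓘(ℝ, EB)) q.1)]
  rfl

end QuarterSymmetricRicci


/-! ### The Ricci components on lifted fields -/

section Components

open Filter Topology IsTwistedNear

variable {EB : Type*} [NormedAddCommGroup EB] [NormedSpace ℝ EB]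
  {B : Type*} [TopologicalSpace B] [ChartedSpace EB B]
  {ι : Type*} [Fintype ι] [DecidableEq ι] {EF : ι → Type*}
  [∀ i, NormedAddCommGroup (EF i)] [∀ i, NormedSpace ℝ (EF i)]
  {F : ι → Type*} [∀ i, TopologicalSpace (F i)] [∀ i, ChartedSpace (EF i) (F i)]
  [IsManifold 𝓘(ℝ, EB) ∞ B] [∀ i, IsManifold 𝓘(ℝ, EF i) ∞ (F i)]
  {gB : Π p : B, TangentSpace 𝓘(ℝ, EB) p →L[ℝ] TangentSpace 𝓘(ℝ, EB) p →L[ℝ] ℝ}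
  {gF : ∀ i, Π y : F i, TangentSpace 𝓘(ℝ, EF i) y →L[ℝ] TangentSpace 𝓘(ℝ, EF i) y →L[ℝ] ℝ}
  {b : ∀ i, B × F i → ℝ} {q : B × (∀ i, F i)}
  [FiniteDimensional ℝ EB] [∀ i, FiniteDimensional ℝ (EF i)]
  {r : ι} {P : Π y : F r, TangentSpace 𝓘(ℝ, EF r) y}
  {eM : Fin (finrank ℝ (EB × ∀ i, EF i)) →
      Π z : B × (∀ i, F i), TangentSpace (prodModel EB EF) z}
  {eB : Fin (finrank ℝ EB) → Π p : B, TangentSpace 𝓘(ℝ, EB) p}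
  {eF : ∀ i, Fin (finrank ℝ (EF i)) → Π y : F i, TangentSpace 𝓘(ℝ, EF i) y}

lemma isTwistedNear_reps (hgB : IsSemiRiemannian 𝓘(ℝ, EB) gB)
    (hgF : ∀ i, IsSemiRiemannian 𝓘(ℝ, EF i) (gF i))
    (hb : ∀ i, ContMDiff (𝓘(ℝ, EB).prod 𝓘(ℝ, EF i)) 𝓘(ℝ, ℝ) ∞ (b i)) (hb_pos : ∀ i z, 0 < b i z) :
    IsTwistedNear (metricRep 𝓘(ℝ, EB) q.1 gB) (fiberReps gF b q) (logTwistReps EB EF b q)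
      (chartCenter EB EF q) :=
  isTwistedNear_chart hgB hgF hb hb_pos

lemma twistedMetric_liftB_liftF (X : Π p : B, TangentSpace 𝓘(ℝ, EB) p) (i : ι)
    (V : Π y : F i, TangentSpace 𝓘(ℝ, EF i) y) :
    twistedMetric gB gF b q (liftB EF X q) (liftF EB i V q) = 0 := by
  rw [twistedMetric_eq, fieldRep_liftB_center, fieldRep_liftF_center, flatTwisted_inBase]
  simp [inFiber]

lemma twistedMetric_liftF_liftB (X : Π p : B, TangentSpace 𝓘(ℝ, EB) p) (i : ι)
    (V : Π y : F i, TangentSpace 𝓘(ℝ, EF i) y) :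
    twistedMetric gB gF b q (liftF EB i V q) (liftB EF X q) = 0 := by
  rw [twistedMetric_eq, fieldRep_liftB_center, fieldRep_liftF_center, flatTwisted_inFiber]
  simp [inBase]

lemma twistedMetric_liftF_liftF_of_ne {i j : ι} (hij : i ≠ j)
    (V : Π y : F i, TangentSpace 𝓘(ℝ, EF i) y) (W : Π y : F j, TangentSpace 𝓘(ℝ, EF j) y) :
    twistedMetric gB gF b q (liftF EB i V q) (liftF EB j W q) = 0 := by
  rw [twistedMetric_eq, fieldRep_liftF_center, fieldRep_liftF_center, flatTwisted_inFiber]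
  simp [inFiber, Pi.single_eq_of_ne hij]

/-- Two terms of the general formula drop out: `∇_X P` is tangent to `F r`, hence orthogonal to the
base, and `π` vanishes on base fields. -/
lemma ricci_quarterSymmetric_base_base
    (hgB : IsSemiRiemannian 𝓘(ℝ, EB) gB) (hgF : ∀ i, IsSemiRiemannian 𝓘(ℝ, EF i) (gF i))
    (hb : ∀ i, ContMDiff (𝓘(ℝ, EB).prod 𝓘(ℝ, EF i)) 𝓘(ℝ, ℝ) ∞ (b i)) (hb_pos : ∀ i z, 0 < b i z)
    (hP : IsSmoothField P) (heM : IsOrthonormalFrameAt (twistedMetric gB gF b) eM q)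
    (heB : IsOrthonormalFrameAt gB eB q.1)
    (heF : ∀ i, IsOrthonormalFrameAt (fiberMetric (gF i) (b i) q.1) (eF i) (q.2 i))
    (lam₁ lam₂ : ℝ)
    {X Y : Π p : B, TangentSpace 𝓘(ℝ, EB) p} (hX : IsSmoothField X) (hY : IsSmoothField Y) :
    ricci (twistedMetric gB gF b) (quarterSymmetric (prodModel EB EF) (twistedMetric gB gF b)
        (liftF EB r P) lam₁ lam₂) eM (liftB EF X) (liftB EF Y) q =
      ricci gB (leviCivita 𝓘(ℝ, EB) gB) eB X Y q.1
      + ∑ s, (finrank ℝ (EF s) : ℝ) *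
        (hessian 𝓘(ℝ, EB) gB (fun p ↦ b s (p, q.2 s)) X Y q.1 / b s (q.1, q.2 s))
      + (((finrank ℝ EB + ∑ s, (finrank ℝ (EF s) : ℝ)) - 1) * lam₁ * lam₂ - lam₂ ^ 2) *
        twistedMetric gB gF b q (liftF EB r P q) (liftF EB r P q) *
        twistedMetric gB gF b q (liftB EF X q) (liftB EF Y q)
      + lam₂ * twistedMetric gB gF b q (liftB EF X q) (liftB EF Y q) *
        fiberDiv (twistedMetric gB gF b) r (eF r) (liftF EB r P) q := by
  have hT := isTwistedNear_reps (q := q) hgB hgF hb hb_pos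
  have hPd := (hP.contDiffAt_fieldRep (q.2 r)).differentiableAt (by simp)
  have h := ricci_quarterSymmetric hT hP heM heB heF lam₁ lam₂
    (contDiffAt_fieldRep_liftB (hX.contDiffAt_fieldRep q.1))
    (contDiffAt_fieldRep_liftB (hY.contDiffAt_fieldRep q.1))
    (fieldRep_liftB_center X) (fieldRep_liftB_center Y)
  rw [hT.base_covDerivLift hPd, twistedMetric_liftB_liftF X,
    hT.flatRicci_base_base (fun i ↦ isOrthonormalFamily_vecRep_fiber i (heF i))
      (fun i ↦ Fintype.card_fin _), ← ricci_base hgB heB hX hY, ← fieldRep_liftB_center (EF := EF) X,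
    ← fieldRep_liftB_center (EF := EF) Y, ← twistedMetric_eq EB EF] at h
  have hH : ∀ s, hessian 𝓘(ℝ, EB) gB (fun p ↦ b s (p, q.2 s)) X Y q.1 / b s (q.1, q.2 s) =
      warpHessian (metricRep 𝓘(ℝ, EB) q.1 gB) (logTwistReps EB EF b q s)
        ((chartCenter EB EF q).1, (chartCenter EB EF q).2 s) (vecRep X q.1) (vecRep Y q.1) :=
    fun s ↦ hessian_div hgB (hb s) (hb_pos s)
      ((hX.contDiffAt_fieldRep q.1).differentiableAt (by simp))
      ((hY.contDiffAt_fieldRep q.1).differentiableAt (by simp))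
  simp only [hH]
  rw [h]
  ring

lemma ricci_quarterSymmetric_base_fiber
    (hgB : IsSemiRiemannian 𝓘(ℝ, EB) gB) (hgF : ∀ i, IsSemiRiemannian 𝓘(ℝ, EF i) (gF i))
    (hb : ∀ i, ContMDiff (𝓘(ℝ, EB).prod 𝓘(ℝ, EF i)) 𝓘(ℝ, ℝ) ∞ (b i)) (hb_pos : ∀ i z, 0 < b i z)
    (hP : IsSmoothField P) (heM : IsOrthonormalFrameAt (twistedMetric gB gF b) eM q)
    (heB : IsOrthonormalFrameAt gB eB q.1)
    (heF : ∀ i, IsOrthonormalFrameAt (fiberMetric (gF i) (b i) q.1) (eF i) (q.2 i))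
    (lam₁ lam₂ : ℝ)
    {X : Π p : B, TangentSpace 𝓘(ℝ, EB) p} (hX : IsSmoothField X) {i : ι}
    {V : Π y : F i, TangentSpace 𝓘(ℝ, EF i) y} (hV : IsSmoothField V) :
    ricci (twistedMetric gB gF b) (quarterSymmetric (prodModel EB EF) (twistedMetric gB gF b)
        (liftF EB r P) lam₁ lam₂) eM (liftB EF X) (liftF EB i V) q =
      (finrank ℝ (EF i) - 1) * dirDeriv (prodModel EB EF) (liftF EB i V)
        (dirDeriv (prodModel EB EF) (liftB EF X) fun z ↦ Real.log (b i (z.1, z.2 i))) q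
      + (((finrank ℝ EB + ∑ s, (finrank ℝ (EF s) : ℝ)) - 1) * lam₁ - lam₂) *
        twistedMetric gB gF b q (liftF EB i V q) (liftF EB r P q) *
        (dirDeriv (prodModel EB EF) (liftB EF X) (fun z ↦ b r (z.1, z.2 r)) q
          / b r (q.1, q.2 r)) := by
  have hT := isTwistedNear_reps (q := q) hgB hgF hb hb_pos
  have hPd := (hP.contDiffAt_fieldRep (q.2 r)).differentiableAt (by simp)
  have h := ricci_quarterSymmetric hT hP heM heB heF lam₁ lam₂
    (contDiffAt_fieldRep_liftB (hX.contDiffAt_fieldRep q.1))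
    (contDiffAt_fieldRep_liftF (hV.contDiffAt_fieldRep (q.2 i)))
    (fieldRep_liftB_center X) (fieldRep_liftF_center i V)
  rw [hT.fiber_covDerivLift_base hPd, twistedMetric_liftB_liftF X,
    hT.flatRicci_base_fiber (fun i ↦ isOrthonormalFamily_vecRep_fiber i (heF i))
      (fun i ↦ Fintype.card_fin _), ← fieldRep_liftB_center (EF := EF) X,
    ← fieldRep_liftF_center (EB := EB) i V, ← twistedMetric_eq EB EF,
    twistedMetric_liftB_liftF X, ← fieldRep_liftF_center (EB := EB) r P,
    ← twistedMetric_eq EB EF] at h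
  rw [h, dirDeriv_liftB_div hb hb_pos,
    dirDeriv_liftF_dirDeriv_liftB_log hb hb_pos (hX.contDiffAt_fieldRep q.1)]
  ring

/-- The Levi-Civita part is symmetric and equals that of the other mixed component; the sign of the
`π(V)` term is reversed by `base_covDerivLift_fiber`. -/
lemma ricci_quarterSymmetric_fiber_base
    (hgB : IsSemiRiemannian 𝓘(ℝ, EB) gB) (hgF : ∀ i, IsSemiRiemannian 𝓘(ℝ, EF i) (gF i))
    (hb : ∀ i, ContMDiff (𝓘(ℝ, EB).prod 𝓘(ℝ, EF i)) 𝓘(ℝ, ℝ) ∞ (b i)) (hb_pos : ∀ i z, 0 < b i z)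
    (hP : IsSmoothField P) (heM : IsOrthonormalFrameAt (twistedMetric gB gF b) eM q)
    (heB : IsOrthonormalFrameAt gB eB q.1)
    (heF : ∀ i, IsOrthonormalFrameAt (fiberMetric (gF i) (b i) q.1) (eF i) (q.2 i))
    (lam₁ lam₂ : ℝ)
    {X : Π p : B, TangentSpace 𝓘(ℝ, EB) p} (hX : IsSmoothField X) {i : ι}
    {V : Π y : F i, TangentSpace 𝓘(ℝ, EF i) y} (hV : IsSmoothField V) :
    ricci (twistedMetric gB gF b) (quarterSymmetric (prodModel EB EF) (twistedMetric gB gF b)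
        (liftF EB r P) lam₁ lam₂) eM (liftF EB i V) (liftB EF X) q =
      (finrank ℝ (EF i) - 1) * dirDeriv (prodModel EB EF) (liftF EB i V)
        (dirDeriv (prodModel EB EF) (liftB EF X) fun z ↦ Real.log (b i (z.1, z.2 i))) q
      + (lam₂ - ((finrank ℝ EB + ∑ s, (finrank ℝ (EF s) : ℝ)) - 1) * lam₁) *
        twistedMetric gB gF b q (liftF EB i V q) (liftF EB r P q) *
        (dirDeriv (prodModel EB EF) (liftB EF X) (fun z ↦ b r (z.1, z.2 r)) q
          / b r (q.1, q.2 r)) := by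
  have hT := isTwistedNear_reps (q := q) hgB hgF hb hb_pos
  have hPd := (hP.contDiffAt_fieldRep (q.2 r)).differentiableAt (by simp)
  have h := ricci_quarterSymmetric hT hP heM heB heF lam₁ lam₂
    (contDiffAt_fieldRep_liftF (hV.contDiffAt_fieldRep (q.2 i)))
    (contDiffAt_fieldRep_liftB (hX.contDiffAt_fieldRep q.1))
    (fieldRep_liftF_center i V) (fieldRep_liftB_center X)
  rw [hT.base_covDerivLift_fiber hPd, twistedMetric_liftB_liftF X,
    flatRicci_symm hT.isMetricNear,
    hT.flatRicci_base_fiber (fun i ↦ isOrthonormalFamily_vecRep_fiber i (heF i))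
      (fun i ↦ Fintype.card_fin _), ← fieldRep_liftB_center (EF := EF) X,
    ← fieldRep_liftF_center (EB := EB) i V, ← twistedMetric_eq EB EF,
    twistedMetric_liftF_liftB X, ← fieldRep_liftF_center (EB := EB) r P,
    ← twistedMetric_eq EB EF] at h
  rw [h, dirDeriv_liftB_div hb hb_pos,
    dirDeriv_liftF_dirDeriv_liftB_log hb hb_pos (hX.contDiffAt_fieldRep q.1)]
  ring

lemma ricci_quarterSymmetric_fiber_fiber_of_ne
    (hgB : IsSemiRiemannian 𝓘(ℝ, EB) gB) (hgF : ∀ i, IsSemiRiemannian 𝓘(ℝ, EF i) (gF i))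
    (hb : ∀ i, ContMDiff (𝓘(ℝ, EB).prod 𝓘(ℝ, EF i)) 𝓘(ℝ, ℝ) ∞ (b i)) (hb_pos : ∀ i z, 0 < b i z)
    (hP : IsSmoothField P) (heM : IsOrthonormalFrameAt (twistedMetric gB gF b) eM q)
    (heB : IsOrthonormalFrameAt gB eB q.1)
    (heF : ∀ i, IsOrthonormalFrameAt (fiberMetric (gF i) (b i) q.1) (eF i) (q.2 i))
    (lam₁ lam₂ : ℝ)
    {i j : ι} (hij : i ≠ j) {V : Π y : F i, TangentSpace 𝓘(ℝ, EF i) y} (hV : IsSmoothField V)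
    {W : Π y : F j, TangentSpace 𝓘(ℝ, EF j) y} (hW : IsSmoothField W) :
    ricci (twistedMetric gB gF b) (quarterSymmetric (prodModel EB EF) (twistedMetric gB gF b)
        (liftF EB r P) lam₁ lam₂) eM (liftF EB i V) (liftF EB j W) q = 0 := by
  have hT := isTwistedNear_reps (q := q) hgB hgF hb hb_pos
  have hPd := (hP.contDiffAt_fieldRep (q.2 r)).differentiableAt (by simp)
  have h := ricci_quarterSymmetric hT hP heM heB heF lam₁ lam₂
    (contDiffAt_fieldRep_liftF (hV.contDiffAt_fieldRep (q.2 i)))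
    (contDiffAt_fieldRep_liftF (hW.contDiffAt_fieldRep (q.2 j)))
    (fieldRep_liftF_center i V) (fieldRep_liftF_center j W)
  -- `P` is tangent to a single fibre, so it is orthogonal to at least one of `V` and `W`.
  have h0 : twistedMetric gB gF b q (liftF EB i V q) (liftF EB r P q) *
      twistedMetric gB gF b q (liftF EB j W q) (liftF EB r P q) = 0 := by
    by_cases hi : i = r
    · rw [twistedMetric_liftF_liftF_of_ne (hi ▸ hij.symm) W P, mul_zero]
    · rw [twistedMetric_liftF_liftF_of_ne hi V P, zero_mul]
  rw [hT.fiber_covDerivLift_of_ne hPd hij, hT.flatRicci_fiber_fiber_of_ne hij,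
    ← fieldRep_liftF_center (EB := EB) i V, ← fieldRep_liftF_center (EB := EB) j W,
    ← twistedMetric_eq EB EF, twistedMetric_liftF_liftF_of_ne hij, mul_assoc (_ + _ : ℝ), h0] at h
  rw [h]
  ring

lemma ricci_quarterSymmetric_fiber_fiber
    (hgB : IsSemiRiemannian 𝓘(ℝ, EB) gB) (hgF : ∀ i, IsSemiRiemannian 𝓘(ℝ, EF i) (gF i))
    (hb : ∀ i, ContMDiff (𝓘(ℝ, EB).prod 𝓘(ℝ, EF i)) 𝓘(ℝ, ℝ) ∞ (b i)) (hb_pos : ∀ i z, 0 < b i z)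
    (hP : IsSmoothField P) (heM : IsOrthonormalFrameAt (twistedMetric gB gF b) eM q)
    (heB : IsOrthonormalFrameAt gB eB q.1)
    (heF : ∀ i, IsOrthonormalFrameAt (fiberMetric (gF i) (b i) q.1) (eF i) (q.2 i))
    (lam₁ lam₂ : ℝ)
    {i : ι} {V W : Π y : F i, TangentSpace 𝓘(ℝ, EF i) y} (hV : IsSmoothField V)
    (hW : IsSmoothField W) :
    ricci (twistedMetric gB gF b) (quarterSymmetric (prodModel EB EF) (twistedMetric gB gF b)
        (liftF EB r P) lam₁ lam₂) eM (liftF EB i V) (liftF EB i W) q =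
      ricci (fiberMetric (gF i) (b i) q.1)
        (leviCivita 𝓘(ℝ, EF i) (fiberMetric (gF i) (b i) q.1)) (eF i) V W (q.2 i)
      + twistedMetric gB gF b q (liftF EB i V q) (liftF EB i W q) *
        (laplacian gB eB (fun p ↦ b i (p, q.2 i)) q.1 / b i (q.1, q.2 i)
        + (finrank ℝ (EF i) - 1) * (gB q.1 (gradient 𝓘(ℝ, EB) gB (fun p ↦ b i (p, q.2 i)) q.1)
            (gradient 𝓘(ℝ, EB) gB (fun p ↦ b i (p, q.2 i)) q.1) / (b i (q.1, q.2 i)) ^ 2)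
        + ∑ s ∈ Finset.univ.erase i, (finrank ℝ (EF s) : ℝ) *
            (gB q.1 (gradient 𝓘(ℝ, EB) gB (fun p ↦ b i (p, q.2 i)) q.1)
              (gradient 𝓘(ℝ, EB) gB (fun p ↦ b s (p, q.2 s)) q.1)
              / (b i (q.1, q.2 i) * b s (q.1, q.2 s)))
        + (((finrank ℝ EB + ∑ s, (finrank ℝ (EF s) : ℝ)) - 1) * lam₁ * lam₂ - lam₂ ^ 2) *
          twistedMetric gB gF b q (liftF EB r P q) (liftF EB r P q))
      + (((finrank ℝ EB + ∑ s, (finrank ℝ (EF s) : ℝ)) - 1) * lam₁ - lam₂) *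
        twistedMetric gB gF b q (liftF EB i W q)
          (leviCivita (prodModel EB EF) (twistedMetric gB gF b) (liftF EB i V) (liftF EB r P) q)
      + (lam₂ ^ 2 + (1 - (finrank ℝ EB + ∑ s, (finrank ℝ (EF s) : ℝ))) * lam₁ ^ 2) *
        twistedMetric gB gF b q (liftF EB i V q) (liftF EB r P q) *
        twistedMetric gB gF b q (liftF EB i W q) (liftF EB r P q)
      + lam₂ * twistedMetric gB gF b q (liftF EB i V q) (liftF EB i W q) *
        fiberDiv (twistedMetric gB gF b) r (eF r) (liftF EB r P) q := by
  have hT := isTwistedNear_reps (q := q) hgB hgF hb hb_pos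
  have hV' := contDiffAt_fieldRep_liftF (EB := EB) (q := q) (hV.contDiffAt_fieldRep (q.2 i))
  have h := ricci_quarterSymmetric hT hP heM heB heF lam₁ lam₂ hV'
    (contDiffAt_fieldRep_liftF (hW.contDiffAt_fieldRep (q.2 i)))
    (fieldRep_liftF_center i V) (fieldRep_liftF_center i W)
  -- With `γ` taken as `grad b_s / b_s`, the products of these vectors become the quotients in the
  -- formula.
  have hγ : ∀ s x, metricRep 𝓘(ℝ, EB) q.1 gB (chartCenter EB EF q).1
      (logGradientRep gB (b s) q.1 (q.2 s)) x = fderiv ℝ (logTwistReps EB EF b q s)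
        ((chartCenter EB EF q).1, (chartCenter EB EF q).2 s) (x, 0) :=
    fun s x ↦ metric_logGradientRep hgB (hb s) (hb_pos s) x
  rw [hT.flatRicci_fiber_fiber (fun i ↦ isOrthonormalFamily_vecRep_fiber i (heF i))
      (fun i ↦ Fintype.card_fin _) hγ, ← ricci_fiber hT i (heF i) hV hW,
    ← laplacian_div hgB hb hb_pos heB, ← flatTwisted_inFiber_inFiber (u := chartCenter EB EF q)
      (GB := metricRep 𝓘(ℝ, EB) q.1 gB), ← fieldRep_liftF_center (EB := EB) i V,
    ← fieldRep_leviCivita_lift hT hP (hV'.differentiableAt (by simp)),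
    ← fieldRep_liftF_center (EB := EB) i W, ← twistedMetric_eq EB EF, ← twistedMetric_eq EB EF] at h
  simp only [metric_logGradientRep_logGradientRep] at h
  rw [h]
  ring

end Components

end QuarterSymmetric

end

open QuarterSymmetric in
theorem proposition4p7
    -- the base manifold
    {EB : Type*} [NormedAddCommGroup EB] [NormedSpace ℝ EB] [FiniteDimensional ℝ EB]
    {B : Type*} [TopologicalSpace B] [ChartedSpace EB B] [IsManifold 𝓘(ℝ, EB) ∞ B]
    -- the fibres
    {ι : Type*} [Fintype ι] [DecidableEq ι]
    {EF : ι → Type*} [∀ i, NormedAddCommGroup (EF i)] [∀ i, NormedSpace ℝ (EF i)]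
    [∀ i, FiniteDimensional ℝ (EF i)]
    {F : ι → Type*} [∀ i, TopologicalSpace (F i)] [∀ i, ChartedSpace (EF i) (F i)]
    [∀ i, IsManifold 𝓘(ℝ, EF i) ∞ (F i)]
    -- the metrics and the twisting functions
    (gB : Π p : B, TangentSpace 𝓘(ℝ, EB) p →L[ℝ] TangentSpace 𝓘(ℝ, EB) p →L[ℝ] ℝ)
    (hgB : IsSemiRiemannian 𝓘(ℝ, EB) gB)
    (gF : ∀ i, Π y : F i, TangentSpace 𝓘(ℝ, EF i) y →L[ℝ] TangentSpace 𝓘(ℝ, EF i) y →L[ℝ] ℝ)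
    (hgF : ∀ i, IsSemiRiemannian 𝓘(ℝ, EF i) (gF i))
    (b : ∀ i, B × F i → ℝ)
    (hb : ∀ i, ContMDiff (𝓘(ℝ, EB).prod 𝓘(ℝ, EF i)) 𝓘(ℝ, ℝ) ∞ (b i))
    (hb_pos : ∀ i z, 0 < b i z)
    -- the connection
    (lam₁ lam₂ : ℝ) (r : ι)
    (P : Π y : F r, TangentSpace 𝓘(ℝ, EF r) y) (hP : IsSmoothField P)
    -- a point and orthonormal frames there, for the product, the base and the fibres
    (q : B × (∀ i, F i))
    (eM : Fin (finrank ℝ (EB × ∀ i, EF i)) →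
      Π z : B × (∀ i, F i), TangentSpace (prodModel EB EF) z)
    (heM : IsOrthonormalFrameAt (twistedMetric gB gF b) eM q)
    (eB : Fin (finrank ℝ EB) → Π p : B, TangentSpace 𝓘(ℝ, EB) p)
    (heB : IsOrthonormalFrameAt gB eB q.1)
    (eF : ∀ i, Fin (finrank ℝ (EF i)) → Π y : F i, TangentSpace 𝓘(ℝ, EF i) y)
    (heF : ∀ i, IsOrthonormalFrameAt (fiberMetric (gF i) (b i) q.1) (eF i) (q.2 i))
    -- vector fields on the base and on a fibre
    (X Y : Π p : B, TangentSpace 𝓘(ℝ, EB) p) (hX : IsSmoothField X) (hY : IsSmoothField Y)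
    (i : ι) (V : Π y : F i, TangentSpace 𝓘(ℝ, EF i) y) (hV : IsSmoothField V) :
    let I := prodModel EB EF
    let g := twistedMetric gB gF b
    let XM := liftB EF (F := F) X
    let YM := liftB EF (F := F) Y
    let VM := liftF EB (B := B) i V
    let PM := liftF EB (B := B) r P
    -- `RicBar` is the Ricci tensor of the quarter-symmetric connection at `q`, `piP` the 1-form of
    -- the lift of `P`
    let RicBar := fun S T ↦ ricci g (quarterSymmetric I g PM lam₁ lam₂) eM S T q
    let piP := fun S : Π z : B × (∀ i, F i), TangentSpace I z ↦ g q (S q) (PM q)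
    let N : ℝ := (finrank ℝ EB : ℝ) + ∑ s, (finrank ℝ (EF s) : ℝ)
    let l : ι → ℝ := fun s ↦ (finrank ℝ (EF s) : ℝ)
    -- `bM s` is `b s` as a function on the product, `bB s` is its restriction to the copy of the
    -- base through `q`
    let bM : ι → B × (∀ i, F i) → ℝ := fun s z ↦ b s (z.1, z.2 s)
    let bB : ι → B → ℝ := fun s p ↦ b s (p, q.2 s)
    let grad : ι → TangentSpace 𝓘(ℝ, EB) q.1 := fun s ↦ gradient 𝓘(ℝ, EB) gB (bB s) q.1
    -- base components
    RicBar XM YM =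
        ricci gB (leviCivita 𝓘(ℝ, EB) gB) eB X Y q.1
        + ∑ s, l s * (hessian 𝓘(ℝ, EB) gB (bB s) X Y q.1 / bM s q)
        + ((N - 1) * lam₁ * lam₂ - lam₂ ^ 2) * piP PM * g q (XM q) (YM q)
        + lam₂ * g q (XM q) (YM q) * fiberDiv g r (eF r) PM q
    -- mixed components
    ∧ RicBar XM VM =
        (l i - 1) * dirDeriv I VM (dirDeriv I XM (fun z ↦ Real.log (bM i z))) q
        + ((N - 1) * lam₁ - lam₂) * piP VM * (dirDeriv I XM (bM r) q / bM r q)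
    ∧ RicBar VM XM =
        (l i - 1) * dirDeriv I VM (dirDeriv I XM (fun z ↦ Real.log (bM i z))) q
        + (lam₂ - (N - 1) * lam₁) * piP VM * (dirDeriv I XM (bM r) q / bM r q)
    -- components along different fibres
    ∧ (∀ j, i ≠ j → ∀ W : Π y : F j, TangentSpace 𝓘(ℝ, EF j) y, IsSmoothField W →
        RicBar VM (liftF EB (B := B) j W) = 0)
    -- components along one fibre
    ∧ (∀ W : Π y : F i, TangentSpace 𝓘(ℝ, EF i) y, IsSmoothField W →
        let WM := liftF EB (B := B) i W
        RicBar VM WM =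
          ricci (fiberMetric (gF i) (b i) q.1)
              (leviCivita 𝓘(ℝ, EF i) (fiberMetric (gF i) (b i) q.1)) (eF i) V W (q.2 i)
          + g q (VM q) (WM q) *
            (laplacian gB eB (bB i) q.1 / bM i q
              + (l i - 1) * (gB q.1 (grad i) (grad i) / (bM i q) ^ 2)
              + ∑ s ∈ Finset.univ.erase i,
                  l s * (gB q.1 (grad i) (grad s) / (bM i q * bM s q))
              + ((N - 1) * lam₁ * lam₂ - lam₂ ^ 2) * piP PM)
          + ((N - 1) * lam₁ - lam₂) * g q (WM q) (leviCivita I g VM PM q)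
          + (lam₂ ^ 2 + (1 - N) * lam₁ ^ 2) * piP VM * piP WM
          + lam₂ * g q (VM q) (WM q) * fiberDiv g r (eF r) PM q) := by
  intro I g XM YM VM PM RicBar piP N l bM bB grad
  exact ⟨ricci_quarterSymmetric_base_base hgB hgF hb hb_pos hP heM heB heF lam₁ lam₂ hX hY,
    ricci_quarterSymmetric_base_fiber hgB hgF hb hb_pos hP heM heB heF lam₁ lam₂ hX hV,
    ricci_quarterSymmetric_fiber_base hgB hgF hb hb_pos hP heM heB heF lam₁ lam₂ hX hV,
    fun j hij W hW ↦ ricci_quarterSymmetric_fiber_fiber_of_ne hgB hgF hb hb_pos hP heM heB heF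
      lam₁ lam₂ hij hV hW,
    fun W hW ↦ ricci_quarterSymmetric_fiber_fiber hgB hgF hb hb_pos hP heM heB heF lam₁ lam₂ hV hW⟩
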